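/- **Notation.** Let $z_1,\dots,z_4\in\mathbb R$ be pairwise distinct, let $\epsilon_j\in\{1,-1\}$ and $\kappa\in\mathbb R$, and let $\bar z_1,\dots,\bar z_4$ be real variables independent of the $z_j$; write $z_{ij}=z_i-z_j$, $\bar z_{ij}=\bar z_i-\bar z_j$. Celestial (Mellin) amplitudes are regarded as distributions in $(\Delta_j,\bar z_j)$, paired over vertical lines in each $\Delta_j$ (with the measure $d\,\mathrm{Im}\,\Delta_j$) with the test functions $\Phi(\Delta,\bar z)=\int_{t_j>0}\prod_j dt_j\,t_j^{-\Delta_j-1}\,\varphi(t,\bar z)$, $\varphi$ smooth with compact support. Here $\delta(\sum_j\Delta_j-2)$ is the analytic functional which restricts to $\sum_j\Delta_j=2$, normalised by $\delta(s)=\int_{\mathbb R}du\,e^{us}$ for imaginary $s$, and a delta function of functions of $\bar z$ (or of energies and $\bar z$) is the limit of box approximations $\eta^{-1}1_{|\cdot|<\eta/2}$ as $\eta\to0^+$. The operator $T_j$ shifts $\Delta_j\to\Delta_j+1$. The three-point amplitude is $$\tilde{\mathcal M}_3^{--+}=\mathrm{sgn}(z_{23}z_{31})\frac{z_{12}^6\,\delta(\bar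 z_{23})\delta(\bar z_{21})}{z_{23}^3z_{31}^3}\Big(\frac{\epsilon_3z_{23}}{\epsilon_1z_{12}}\Big)^{\Delta_1+1}\Big(\frac{\epsilon_3z_{31}}{\epsilon_2z_{12}}\Big)^{\Delta_2+1}\delta\Big(\sum_{i=1}^3\Delta_i-2\Big)$$ on the support $\frac{\epsilon_3z_{23}}{\epsilon_1z_{12}}>0$, $\frac{\epsilon_3z_{31}}{\epsilon_2z_{12}}>0$, and zero otherwise. The celestial (Hodges) recursion for $n$ hard particles and a soft particle $s=n+1$ is $$\tilde{\mathcal M}_{n+1}=\frac\kappa2\int_0^\infty\frac{d\omega}{\omega}\,\omega^{\Delta_s}\sum_{i=1}^{n-2}\frac{\bar z_{si}z_{(n-1)i}}{z_{si}z_{(n-1)s}}\,\frac{(1+\alpha_i)^{J_i-\Delta_i}(1+\alpha_n^{(i)})^{J_n-\Delta_n}}{\alpha_i}\;\tilde{\mathcal M}_n\Big|_{\bar z_i\to\frac{\bar z_i+\alpha_i\bar z_s}{1+\alpha_i},\ \bar z_n\to\frac{\bar z_n+\alpha_n^{(i)}\bar z_s}{1+\alpha_n^{(i)}}},$$ $$\alpha_i=\frac{\epsilon_s\,\omega\,z_{ns}}{\epsilon_iz_{ni}}T_i^{-1},\qquad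 \alpha_n^{(i)}=\frac{\epsilon_s\,\omega\,z_{is}}{\epsilon_nz_{in}}T_n^{-1},$$ with all operators $T$ standing to the left of functions of $\Delta$, and restricted to $\alpha_i,\alpha_n^{(i)}>-1$ (a function of the $T$'s acts on the component of the test function with profile at $t$ by replacing $T_j$ by the number $t_j$). **Theorem.** Apply the recursion with $n=3$, $s=4$ and helicities $(J_1,J_2,J_3)=(-2,-2,+2)$ to $\tilde{\mathcal M}_3^{--+}$. Then, as distributions on the region where the recursion holds, $\frac{\bar z_{14}}{\bar z_{24}}>0$, $\frac{\bar z_{34}}{\bar z_{24}}>0$, away from $\bar z_{12}=0$, the result is $$\tilde{\mathcal M}_4^{--++}=-\frac\kappa2\,\epsilon_1\epsilon_2\frac{z_{12}^7\bar z_{12}}{z_{23}z_{41}z_{42}z_{31}z_{34}^2}\Big(\frac{\epsilon_3}{\epsilon_1}\frac{z_{23}\bar z_{34}}{z_{12}\bar z_{14}}\Big)^{\Delta_1+2}\Big(\frac{\epsilon_3}{\epsilon_2}\frac{z_{13}\bar z_{34}}{z_{12}\bar z_{42}}\Big)^{\Delta_2+2}\Big(\frac{\epsilon_3}{\epsilon_4}\frac{z_{23}\bar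 z_{13}}{z_{42}\bar z_{14}}\Big)^{\Delta_4-3}$$ $$\qquad\times\ \delta\big(z_{12}z_{34}\bar z_{13}\bar z_{24}-z_{13}z_{24}\bar z_{12}\bar z_{34}\big)\,\delta\Big(\sum_{i=1}^4\Delta_i-2\Big)$$ on the support $$\frac{\epsilon_3z_{23}}{\epsilon_1z_{12}}>0,\qquad\frac{\epsilon_3z_{31}}{\epsilon_2z_{12}}>0,\qquad\frac{\bar z_{12}\epsilon_1z_{31}}{\bar z_{24}\epsilon_4z_{34}}>0,$$ and zero off it. Moreover: 1. The formula is symmetric under the exchange of the particles $1\leftrightarrow2$ (that is, of $z,\bar z,\epsilon,\Delta$ with labels $1,2$), as a distribution on the same region. 2. It agrees with the direct calculation: on this region it is the Mellin transform $\int_0^\infty\prod_jd\omega_j\,\omega_j^{\Delta_j-1}\,\mathcal M_4$ (defined by Parseval's formula on the above test functions) of the momentum-space amplitude $$\mathcal M_4=\frac\kappa2\,\delta^4\Big(\sum_j\lambda_j\tilde\lambda_j\Big)\frac{\langle12\rangle^7[12]}{\langle13\rangle\langle14\rangle\langle23\rangle\langle24\rangle\langle34\rangle^2},$$ with $\lambda_j=\epsilon_j\sqrt{\omega_j}(z_j,1)$,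 $\tilde\lambda_j=-\sqrt{\omega_j}(\bar z_j,1)$, $\langle ij\rangle=\lambda_{i,1}\lambda_{j,2}-\lambda_{i,2}\lambda_{j,1}$, $[ij]=\tilde\lambda_{i,1}\tilde\lambda_{j,2}-\tilde\lambda_{i,2}\tilde\lambda_{j,1}$ (and $\delta^4$ of the four real components of $\sum_j\lambda_j\tilde\lambda_j$). 3. On this region and on the zero set of $z_{12}z_{34}\bar z_{13}\bar z_{24}-z_{13}z_{24}\bar z_{12}\bar z_{34}$, the support conditions are equivalent to the positivity of the three bases of the powers above. -/

import Mathlib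

open MeasureTheory Filter Topology Function
open scoped Real

noncomputable section

namespace Celestial

/-! ### Test functions, distributions and delta functions -/

/-- Functions of the weights `Δ` and of the antiholomorphic coordinates `z̄` of `n` particles. -/
abbrev Test (n : ℕ) : Type := (Fin n → ℂ) → (Fin n → ℝ) → ℂ

/-- Distributional Mellin amplitudes of `n` particles: functionals on functions of `(Δ, z̄)`
(the points `z` are fixed parameters).  A distribution `D` pairs with `Φ` as
`∫ dz̄ ∫ d(Im Δ) D(Δ, z̄) Φ(Δ, z̄)`, over vertical lines in each `Δ_j`. -/
abbrev Dist (n : ℕ) : Type := Test n → ℂ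

/-- The test function in Mellin space
`Φ(Δ, z̄) = ∫_{t > 0} ∏ dt_j t_j^{-Δ_j - 1} φ(t, z̄)` with profile `φ` in energy space;
it is entire in `Δ` if `φ` is smooth with compact support in `t > 0`. -/
def mellinTest {n : ℕ} (φ : (Fin n → ℝ) × (Fin n → ℝ) → ℂ) : Test n := fun Δ zb =>
  ∫ t in {t : Fin n → ℝ | ∀ j, 0 < t j}, (∏ j, ((t j : ℝ) : ℂ) ^ (-Δ j - 1)) * φ (t, zb)

/-- Integration against `δ(∑ Δ_j - 2)`.  The integral is over
`Δ_j = c_j + i l_j` for all particles but the last, whose weight is `2 - ∑ Δ_j`.  The factor `2π`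
is that of `δ(i x) = ∫_ℝ du exp(i u x) = 2π δ(x)`.  (As an analytic functional on entire
functions which decay on vertical lines it does not depend on `c`.) -/
def deltaSum {n : ℕ} (c : Fin n → ℝ) (F : (Fin (n + 1) → ℂ) → ℂ) : ℂ :=
  (2 * π : ℝ) * ∫ l : Fin n → ℝ,
    F (Fin.snoc (α := fun _ => ℂ) (fun j => (c j : ℂ) + Complex.I * (l j : ℂ))
      (2 - ∑ j, ((c j : ℂ) + Complex.I * (l j : ℂ))))

/-- `∫ dx ∏_k δ(f_k(x)) g(x) = L`, the delta functions being the limit of the boxes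
`η⁻¹ 1_{|f_k| < η/2}` as `η → 0⁺`. -/
def IsDeltaIntegral {E ι : Type} [MeasureSpace E] [Fintype ι] (f : E → ι → ℝ) (g : E → ℂ)
    (L : ℂ) : Prop :=
  Tendsto (fun η : ℝ => ((η⁻¹ ^ Fintype.card ι : ℝ) : ℂ) *
    ∫ x in {x : E | ∀ k, |f x k| < η / 2}, g x) (𝓝[>] 0) (𝓝 L)

/-! ### The celestial recursion -/

section Recursion

variable {m : ℕ}

/-- The label `i` of a summand, as one of the `n = m + 2` hard particles. -/
def hard (i : Fin m) : Fin (m + 2) := i.castSucc.castSucc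

/-- The hard particle `n`. -/
def lastHard (m : ℕ) : Fin (m + 2) := Fin.last (m + 1)

/-- The hard particle `n - 1`. -/
def prevHard (m : ℕ) : Fin (m + 2) := (Fin.last m).castSucc

/-- The soft particle `s = n + 1`. -/
def soft (m : ℕ) : Fin (m + 3) := Fin.last (m + 2)

/-- The action `z̄ ↦ (z̄ + α z̄_s) / (1 + α)` of the one-particle Lorentz transformation. -/
def lorentzAct (α zbs zb : ℝ) : ℝ := (zb + α * zbs) / (1 + α)

/-- The inverse of `lorentzAct`. -/
def lorentzInv (α zbs zb : ℝ) : ℝ := (1 + α) * zb - α * zbs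

theorem lorentzAct_lorentzInv (α zbs zb : ℝ) (h : 1 + α ≠ 0) :
    lorentzAct α zbs (lorentzInv α zbs zb) = zb := by
  unfold lorentzAct lorentzInv
  field_simp
  ring

/-- `α_i = ε_s ω z_{ns} / (ε_i z_{ni}) T_i⁻¹`, with the number `τ` in place of `T_i`. -/
def alphaI (z ε : Fin (m + 3) → ℝ) (i : Fin m) (ω τ : ℝ) : ℝ :=
  ε (soft m) * ω * (z (lastHard m).castSucc - z (soft m)) /
    (ε (hard i).castSucc * (z (lastHard m).castSucc - z (hard i).castSucc)) / τ

/-- `α_n^{(i)} = ε_s ω z_{is} / (ε_n z_{in}) T_n⁻¹`, with the number `τ` in place of `T_n`. -/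
def alphaN (z ε : Fin (m + 3) → ℝ) (i : Fin m) (ω τ : ℝ) : ℝ :=
  ε (soft m) * ω * (z (hard i).castSucc - z (soft m)) /
    (ε (lastHard m).castSucc * (z (hard i).castSucc - z (lastHard m).castSucc)) / τ

/-- The coordinates `z̄` of all `n + 1` particles such that the Lorentz transformations move
`z̄_i, z̄_n` to the values prescribed by `zb`. -/
def unboost (i : Fin m) (αi αn zbs : ℝ) (zb : Fin (m + 2) → ℝ) : Fin (m + 3) → ℝ :=
  Fin.snoc (α := fun _ => ℝ)
    (update (update zb (hard i) (lorentzInv αi zbs (zb (hard i))))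
      (lastHard m) (lorentzInv αn zbs (zb (lastHard m)))) zbs

/-- The transpose, for numerical `α_i, α_n > -1`, of the operation
`M̃_n ↦ z̄_{si} z_{(n-1)i} / (z_{si} z_{(n-1)s}) α_i⁻¹ (1 + α_i)^{-2 h̄_i} (1 + α_n)^{-2 h̄_n}
  M̃_n(…, (z̄_i + α_i z̄_s)/(1 + α_i), …, (z̄_n + α_n z̄_s)/(1 + α_n))`,
where `2 h̄ = Δ - J`; it acts on a function `ψ` of `z̄_1, …, z̄_n, z̄_s`.
The factor `(1 + α_i) (1 + α_n)` is the Jacobian of the change of variables in `z̄_i, z̄_n`. -/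
def boostTranspose (z : Fin (m + 3) → ℝ) (J : Fin (m + 2) → ℝ) (i : Fin m) (αi αn zbs : ℝ)
    (ψ : (Fin (m + 3) → ℝ) → ℂ) (Δ : Fin (m + 2) → ℂ) (zb : Fin (m + 2) → ℝ) : ℂ :=
  open scoped Classical in
  if 0 < 1 + αi ∧ 0 < 1 + αn then
    (((zbs - unboost i αi αn zbs zb (hard i).castSucc) *
        (z (prevHard m).castSucc - z (hard i).castSucc) /
        ((z (soft m) - z (hard i).castSucc) * (z (prevHard m).castSucc - z (soft m))) / αi *
        ((1 + αi) * (1 + αn)) : ℝ) : ℂ) *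
      ((1 + αi : ℝ) : ℂ) ^ (-(Δ (hard i) - (J (hard i) : ℂ))) *
      ((1 + αn : ℝ) : ℂ) ^ (-(Δ (lastHard m) - (J (lastHard m) : ℂ))) *
      ψ (unboost i αi αn zbs zb)
  else 0

/-- The transpose of the `i`-th summand of the recursion, with operators `α_i, α_n^{(i)}`.
The shift operator `T_j : Δ_j ↦ Δ_j + 1` acts on distributions, to the left of every function of
`Δ`; its transpose `Δ_j ↦ Δ_j - 1` multiplies the component `t_j^{-Δ_j}` of a test function by
`t_j`.  So `T_j` becomes the number `t_j` on each component of `mellinTest φ`. -/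
def summandTranspose (z ε : Fin (m + 3) → ℝ) (J : Fin (m + 2) → ℝ) (i : Fin m) (ω : ℝ)
    (Δs : ℂ) (zbs : ℝ) (φ : (Fin (m + 3) → ℝ) × (Fin (m + 3) → ℝ) → ℂ) : Test (m + 2) :=
  fun Δ zb => ∫ t in {t : Fin (m + 3) → ℝ | ∀ j, 0 < t j},
    (∏ j, ((t j : ℝ) : ℂ) ^ (-(Fin.snoc (α := fun _ => ℂ) Δ Δs : Fin (m + 3) → ℂ) j - 1)) *
      boostTranspose z J i (alphaI z ε i ω (t (hard i).castSucc))
        (alphaN z ε i ω (t (lastHard m).castSucc)) zbs (fun y => φ (t, y)) Δ zb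

/-- The celestial recursion
`∫_0^∞ dω ω^{Δ_s - 1} (κ/2) ∑_{i=1}^{n-2} z̄_{si} z_{(n-1)i} / (z_{si} z_{(n-1)s})
  (1 + α_i)^{-2 h̄_i} (1 + α_n^{(i)})^{-2 h̄_n} / α_i
  M̃_n(…, {z_i, (z̄_i + α_i z̄_s)/(1 + α_i), Δ_i}, …, {z_n, (z̄_n + α_n^{(i)} z̄_s)/(1 + α_n^{(i)}), Δ_n})`
for `n = m + 2` hard particles, paired with `mellinTest φ`; the contour of `Δ_s` is
`Re Δ_s = cs`. -/
def recursion (κ : ℝ) (z ε : Fin (m + 3) → ℝ) (J : Fin (m + 2) → ℝ) (cs : ℝ)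
    (M : Dist (m + 2)) (φ : (Fin (m + 3) → ℝ) × (Fin (m + 3) → ℝ) → ℂ) : ℂ :=
  ((κ / 2 : ℝ) : ℂ) * ∑ i : Fin m, ∫ zbs : ℝ, ∫ l : ℝ, ∫ ω in Set.Ioi (0 : ℝ),
    (ω : ℂ) ^ (((cs : ℂ) + Complex.I * (l : ℂ)) - 1) *
      M (summandTranspose z ε J i ω ((cs : ℂ) + Complex.I * (l : ℂ)) zbs φ)

end Recursion

/-! ### Three points -/

/-- The three-point Mellin amplitude
`sgn(z₂₃ z₃₁) z₁₂⁶ δ(z̄₂₃) δ(z̄₂₁) / (z₂₃³ z₃₁³) (ε₃ z₂₃ / (ε₁ z₁₂))^{Δ₁ + 1}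
  (ε₃ z₃₁ / (ε₂ z₁₂))^{Δ₂ + 1} δ(∑ Δ - 2)`,
supported on `ε₃ z₂₃ / (ε₁ z₁₂) > 0`, `ε₃ z₃₁ / (ε₂ z₁₂) > 0`. -/
def threePoint (z ε : Fin 3 → ℝ) (c : Fin 2 → ℝ) : Dist 3 := fun Φ =>
  open scoped Classical in
  if 0 < ε 2 * (z 1 - z 2) / (ε 0 * (z 0 - z 1)) ∧
      0 < ε 2 * (z 2 - z 0) / (ε 1 * (z 0 - z 1)) then
    ((Real.sign ((z 1 - z 2) * (z 2 - z 0)) * (z 0 - z 1) ^ 6 /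
        ((z 1 - z 2) ^ 3 * (z 2 - z 0) ^ 3) : ℝ) : ℂ) *
      ∫ x : ℝ, deltaSum c fun Δ =>
        ((ε 2 * (z 1 - z 2) / (ε 0 * (z 0 - z 1)) : ℝ) : ℂ) ^ (Δ 0 + 1) *
        ((ε 2 * (z 2 - z 0) / (ε 1 * (z 0 - z 1)) : ℝ) : ℂ) ^ (Δ 1 + 1) * Φ Δ fun _ => x
  else 0

/-! ### Four points -/

/-- The region `z̄₁₄ / z̄₂₄ > 0`, `z̄₃₄ / z̄₂₄ > 0` in which the recursion holds (`1 + α₁ > 0` and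
`1 + α₃ > 0`), without the singular locus `z̄₁₂ = 0`. -/
def region : Set (Fin 4 → ℝ) :=
  {zb | zb 0 - zb 1 ≠ 0 ∧ 0 < (zb 0 - zb 3) / (zb 1 - zb 3) ∧ 0 < (zb 2 - zb 3) / (zb 1 - zb 3)}

/-- `z₁₂ z₃₄ z̄₁₃ z̄₂₄ - z₁₃ z₂₄ z̄₁₂ z̄₃₄`. -/
def cross (z zb : Fin 4 → ℝ) : ℝ :=
  (z 0 - z 1) * (z 2 - z 3) * (zb 0 - zb 2) * (zb 1 - zb 3) -
    (z 0 - z 2) * (z 1 - z 3) * (zb 0 - zb 1) * (zb 2 - zb 3)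

/-- `ε₃ z₂₃ z̄₃₄ / (ε₁ z₁₂ z̄₁₄)`. -/
def ratio₁ (z ε zb : Fin 4 → ℝ) : ℝ :=
  ε 2 / ε 0 * ((z 1 - z 2) * (zb 2 - zb 3) / ((z 0 - z 1) * (zb 0 - zb 3)))

/-- `ε₃ z₁₃ z̄₃₄ / (ε₂ z₁₂ z̄₄₂)`. -/
def ratio₂ (z ε zb : Fin 4 → ℝ) : ℝ :=
  ε 2 / ε 1 * ((z 0 - z 2) * (zb 2 - zb 3) / ((z 0 - z 1) * (zb 3 - zb 1)))

/-- `ε₃ z₂₃ z̄₁₃ / (ε₄ z₄₂ z̄₁₄)`. -/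
def ratio₄ (z ε zb : Fin 4 → ℝ) : ℝ :=
  ε 2 / ε 3 * ((z 1 - z 2) * (zb 0 - zb 2) / ((z 3 - z 1) * (zb 0 - zb 3)))

/-- `ε₃ z₂₃ / (ε₁ z₁₂) > 0`, `ε₃ z₃₁ / (ε₂ z₁₂) > 0`, `z̄₁₂ ε₁ z₃₁ / (z̄₂₄ ε₄ z₃₄) > 0`. -/
def InSupport (z ε zb : Fin 4 → ℝ) : Prop :=
  0 < ε 2 * (z 1 - z 2) / (ε 0 * (z 0 - z 1)) ∧
  0 < ε 2 * (z 2 - z 0) / (ε 1 * (z 0 - z 1)) ∧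
  0 < (zb 0 - zb 1) * ε 0 * (z 2 - z 0) / ((zb 1 - zb 3) * ε 3 * (z 2 - z 3))

/-- The four-point Mellin amplitude without `δ(z₁₂ z₃₄ z̄₁₃ z̄₂₄ - z₁₃ z₂₄ z̄₁₂ z̄₃₄)`, paired in
`Δ` with `mellinTest φ`: the factor in front of this delta function is
`-(κ/2) ε₁ ε₂ z₁₂⁷ z̄₁₂ / (z₂₃ z₄₁ z₄₂ z₃₁ z₃₄²) (ratio₁)^{Δ₁ + 2} (ratio₂)^{Δ₂ + 2}
  (ratio₄)^{Δ₄ - 3} δ(∑ Δ - 2)` on the support and `0` off it. -/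
def fourPoint (κ : ℝ) (z ε : Fin 4 → ℝ) (c : Fin 3 → ℝ)
    (φ : (Fin 4 → ℝ) × (Fin 4 → ℝ) → ℂ) (zb : Fin 4 → ℝ) : ℂ :=
  open scoped Classical in
  if InSupport z ε zb then
    ((-(κ / 2) * (ε 0 * ε 1) * ((z 0 - z 1) ^ 7 * (zb 0 - zb 1) /
        ((z 1 - z 2) * (z 3 - z 0) * (z 3 - z 1) * (z 2 - z 0) * (z 2 - z 3) ^ 2)) : ℝ) : ℂ) *
      deltaSum c fun Δ =>
        (ratio₁ z ε zb : ℂ) ^ (Δ 0 + 2) * (ratio₂ z ε zb : ℂ) ^ (Δ 1 + 2) *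
          (ratio₄ z ε zb : ℂ) ^ (Δ 3 - 3) * mellinTest φ Δ zb
  else 0

/-! ### The four-graviton amplitude in momentum space -/

/-- `λ_i = ε_i √ω_i (z_i, 1)`. -/
def lam (z ε ω : Fin 4 → ℝ) (i : Fin 4) : Fin 2 → ℝ := (ε i * √(ω i)) • ![z i, 1]

/-- `λ̃_i = -√ω_i (z̄_i, 1)`. -/
def lamTilde (zb ω : Fin 4 → ℝ) (i : Fin 4) : Fin 2 → ℝ := (-√(ω i)) • ![zb i, 1]

/-- The bracket of two spinors. -/
def bracket (a b : Fin 2 → ℝ) : ℝ := a 0 * b 1 - a 1 * b 0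

/-- The total momentum `∑ λ_i^α λ̃_i^α̇`, as a function of `(ω, z̄)`. -/
def totalMomentum (z ε : Fin 4 → ℝ) (p : (Fin 4 → ℝ) × (Fin 4 → ℝ)) (k : Fin 2 × Fin 2) : ℝ :=
  ∑ i, lam z ε p.1 i k.1 * lamTilde p.2 p.1 i k.2

/-- The tree amplitude `⟨12⟩⁷ [12] / (⟨13⟩ ⟨14⟩ ⟨23⟩ ⟨24⟩ ⟨34⟩²)` of gravitons of helicities
`--++`. -/
def treeAmplitude (z ε : Fin 4 → ℝ) (p : (Fin 4 → ℝ) × (Fin 4 → ℝ)) : ℝ :=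
  let a := fun i j => bracket (lam z ε p.1 i) (lam z ε p.1 j)
  a 0 1 ^ 7 * bracket (lamTilde p.2 p.1 0) (lamTilde p.2 p.1 1) /
    (a 0 2 * a 0 3 * a 1 2 * a 1 3 * a 2 3 ^ 2)

/-- The integrand of the Mellin transform `∫ ∏ dω_j ω_j^{Δ_j - 1} (κ/2) A(ω, z̄)` of a
distribution on energy space, paired in `Δ` with `mellinTest φ`; by Parseval's formula
`∫ d(Im Δ)⁴ ω^{Δ - 1} (mellinTest φ)(Δ) = (2π)⁴ φ(ω) / ∏ ω_j`. -/
def momentumIntegrand (κ : ℝ) (z ε : Fin 4 → ℝ) (φ : (Fin 4 → ℝ) × (Fin 4 → ℝ) → ℂ)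
    (p : (Fin 4 → ℝ) × (Fin 4 → ℝ)) : ℂ :=
  (((2 * π) ^ 4 * (κ / 2) * treeAmplitude z ε p / ∏ j, p.1 j : ℝ) : ℂ) * φ p

/-- The relabelling `1 ↔ 2` of the particles. -/
def swap₁₂ {X : Type} (x : Fin 4 → X) : Fin 4 → X := x ∘ Equiv.swap 0 1

end Celestial

end

/-! Every distribution in the statement, paired with a profile `φ`, equals one and the same integral
over the momentum shell, `∫ q, shellIntegrand κ z ε φ q`, in the free variables `(ω₃, ω₄, z̄₂,
z̄₄)`. Uniqueness of limits then compares them, without comparing formulas.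

Momentum space. The components `(0, 1)` and `(1, 1)` of the total momentum are free of `z̄` and
linear in the energies; for given energies the other two are linear in `z̄`. Solving the first pair
for `ω₁, ω₂` and the second for `z̄₁, z̄₃` turns the four-dimensional delta function into evaluation
at zero of a continuous function (`isDeltaIntegral_momentum`).

Recursion. With `T_j` replaced by the number `t_j`, the products `α₁ t₁` and `α₃ t₃` are constants
times `ω`, so the boost translates the energies: `p = t (1 + α)`. The factors `(1 + α)` with
exponents in `Δ` are what turns the Mellin kernel in `t` into the Mellin kernel in `p`
(`boostTranspose_eq_boosted`). Mellin inversion (`deltaSum_mellin`) against the three-point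
amplitude puts `p` on the ray through `(base₁, base₂, 1)`, and inversion in the soft weight puts `t₄
= ω`. What is left is the shell in shifted coordinates, with the same density
(`boosted_eq_shellIntegrand`, `recursion_eq_integral`).

Four-point formula. Mellin inversion puts the energies on the ray through `(ratio₁, ratio₂, 1,
ratio₄)`. Since `cross` is affine in `z̄₁`, its delta function is solved for `z̄₁`, and an affine
substitution from `z̄₃` to `ω₄` gives the shell again; `jacobian_rayIntegrand` matches the
densities. The formula is a smooth test function only near `cross = 0`. There the two terms of
`cross` have a positive product, which makes the stated support equal to the positivity of the three
bases (`inSupport_iff`), and the slope of `cross` in `z̄₁` does not vanish. Compactness of the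
support of `φ` makes both facts uniform.

Symmetry holds because the momentum-space amplitude and the total momentum are invariant under
relabelling 1 and 2. Throughout, the integrands are smooth with compact support (`IsTest`), which
supplies Fubini and continuity in parameters. -/

noncomputable section

namespace Celestial

/-! ### Smooth functions with compact support in a given set -/

section IsTest

variable {E F : Type*} [NormedAddCommGroup E] [NormedSpace ℝ E] [NormedAddCommGroup F]
  [NormedSpace ℝ F]

/-- `f` is smooth and vanishes off a compact subset of `S`. -/
def IsTest (S : Set E) (f : E → ℂ) : Prop :=
  ContDiff ℝ (⊤ : ℕ∞) f ∧ ∃ K, IsCompact K ∧ K ⊆ S ∧ ∀ x, x ∉ K → f x = 0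

/-- The complement of `K` is open and `f` vanishes there, so smoothness has to be checked at points
of `K` only. This allows integrands with denominators that are singular off the support. -/
theorem IsTest.of_contDiffAt {S K : Set E} {f : E → ℂ} (hK : IsCompact K) (hKS : K ⊆ S)
    (hf : ∀ x ∈ K, ContDiffAt ℝ (⊤ : ℕ∞) f x) (h0 : ∀ x, x ∉ K → f x = 0) : IsTest S f := by
  refine ⟨contDiff_iff_contDiffAt.2 fun x => ?_, K, hK, hKS, h0⟩
  by_cases hx : x ∈ K
  · exact hf x hx
  · have : f =ᶠ[𝓝 x] fun _ => 0 := by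
      filter_upwards [hK.isClosed.isOpen_compl.mem_nhds hx] with y hy using h0 y hy
    exact contDiffAt_const.congr_of_eventuallyEq this

theorem IsTest.hasCompactSupport {S : Set E} {f : E → ℂ} (hf : IsTest S f) :
    HasCompactSupport f := by
  obtain ⟨_, K, hK, _, h0⟩ := hf
  exact HasCompactSupport.intro hK h0

theorem IsTest.continuous {S : Set E} {f : E → ℂ} (hf : IsTest S f) : Continuous f :=
  hf.1.continuous

theorem IsTest.integrable [MeasurableSpace E] [BorelSpace E] {μ : Measure E}
    [IsFiniteMeasureOnCompacts μ] {S : Set E} {f : E → ℂ} (hf : IsTest S f) : Integrable f μ :=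
  hf.continuous.integrable_of_hasCompactSupport hf.hasCompactSupport

theorem IsTest.mem {S : Set E} {f : E → ℂ} (hf : IsTest S f) {x : E} (hx : f x ≠ 0) : x ∈ S := by
  obtain ⟨_, K, _, hKS, h0⟩ := hf
  by_contra h
  exact hx (h0 x fun h' => h (hKS h'))

theorem IsTest.mono {S T : Set E} {f : E → ℂ} (hf : IsTest S f) (h : S ⊆ T) : IsTest T f := by
  obtain ⟨hf, K, hK, hKS, h0⟩ := hf
  exact ⟨hf, K, hK, hKS.trans h, h0⟩

theorem IsTest.of_tsupport {S : Set E} {f : E → ℂ} (hf : ContDiff ℝ (⊤ : ℕ∞) f)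
    (hc : HasCompactSupport f) (hS : tsupport f ⊆ S) : IsTest S f :=
  ⟨hf, tsupport f, hc, hS, fun _ hx => image_eq_zero_of_notMem_tsupport hx⟩

/-- Pullback along a map `m` with a left inverse `r` over `S`. -/
theorem IsTest.mul_comp {S : Set F} {T : Set E} {f : F → ℂ} (hf : IsTest S f) {w : E → ℂ}
    {m : E → F} (r : F → E) (C : Set F) (hC : IsClosed C) (hr : ContinuousOn r (S ∩ C))
    (hmC : ∀ x, m x ∈ S → m x ∈ C) (hrm : ∀ x, m x ∈ S → r (m x) = x)
    (hT : ∀ y ∈ S, y ∈ C → r y ∈ T)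
    (hm : ∀ x ∈ T, ContDiffAt ℝ (⊤ : ℕ∞) m x) (hw : ∀ x ∈ T, ContDiffAt ℝ (⊤ : ℕ∞) w x) :
    IsTest T fun x => w x * f (m x) := by
  obtain ⟨hf, K, hK, hKS, h0⟩ := hf
  have hsub : K ∩ C ⊆ S ∩ C := Set.inter_subset_inter_left _ hKS
  -- The pullback vanishes off `r '' (K ∩ C)`. The closed set `C` holds the equations satisfied by
  -- the values of `m` when `m` maps into a space of larger dimension; `r` need be continuous and
  -- `T`-valued only where they hold.
  refine IsTest.of_contDiffAt (K := r '' (K ∩ C))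
    ((hK.inter_right hC).image_of_continuousOn (hr.mono hsub)) ?_ ?_ ?_
  · rintro _ ⟨y, hy, rfl⟩
    exact hT y (hKS hy.1) hy.2
  · rintro _ ⟨y, hy, rfl⟩
    have hy' := hT y (hKS hy.1) hy.2
    exact (hw _ hy').mul (hf.contDiffAt.comp _ (hm _ hy'))
  · intro x hx
    rw [h0 (m x), mul_zero]
    intro hmx
    exact hx ⟨m x, ⟨hmx, hmC x (hKS hmx)⟩, hrm x (hKS hmx)⟩

theorem IsTest.mul_comp' {S : Set F} {T : Set E} {f : F → ℂ} (hf : IsTest S f) {w : E → ℂ}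
    {m : E → F} (r : F → E) (hr : ContinuousOn r S)
    (hrm : ∀ x, m x ∈ S → r (m x) = x) (hT : ∀ y ∈ S, r y ∈ T)
    (hm : ∀ x ∈ T, ContDiffAt ℝ (⊤ : ℕ∞) m x) (hw : ∀ x ∈ T, ContDiffAt ℝ (⊤ : ℕ∞) w x) :
    IsTest T fun x => w x * f (m x) :=
  hf.mul_comp r Set.univ isClosed_univ (by simpa using hr) (fun _ _ => trivial) hrm
    (fun y hy _ => hT y hy) hm hw

theorem IsTest.mul_left {S : Set E} {f w : E → ℂ} (hf : IsTest S f)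
    (hw : ∀ x ∈ S, ContDiffAt ℝ (⊤ : ℕ∞) w x) : IsTest S fun x => w x * f x :=
  hf.mul_comp' (m := id) id continuousOn_id (fun _ _ => rfl) (fun _ h => h)
    (fun _ _ => contDiffAt_id) hw

theorem IsTest.comp {S : Set F} {T : Set E} {f : F → ℂ} (hf : IsTest S f) {m : E → F} (r : F → E)
    (hr : ContinuousOn r S) (hrm : ∀ x, m x ∈ S → r (m x) = x) (hT : ∀ y ∈ S, r y ∈ T)
    (hm : ∀ x ∈ T, ContDiffAt ℝ (⊤ : ℕ∞) m x) : IsTest T fun x => f (m x) := by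
  simpa using hf.mul_comp' (w := fun _ => 1) r hr hrm hT hm (fun _ _ => contDiffAt_const)

/-- Partial integrals of smooth functions with compact support. -/
theorem IsTest.integral [FiniteDimensional ℝ F] [MeasurableSpace F] [BorelSpace F]
    {μ : Measure F} [μ.IsAddHaarMeasure]
    {S : Set (E × F)} {f : E × F → ℂ} (hf : IsTest S f) :
    IsTest (Prod.fst '' S) fun p => ∫ q, f (p, q) ∂μ := by
  obtain ⟨hf, K, hK, hKS, h0⟩ := hf
  refine ⟨?_, Prod.fst '' K, hK.image continuous_fst, Set.image_mono hKS, ?_⟩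
  -- The partial integral is the convolution of the constant `1` with `f (p, ·)`, evaluated at `0`;
  -- smooth dependence on `p` follows from that of convolutions with parameters.
  · have h := contDiffOn_convolution_right_with_param (𝕜 := ℝ) (μ := μ) (P := E) (G := F)
      (f := fun _ => (1 : ℝ)) (n := ⊤) (ContinuousLinearMap.lsmul ℝ ℝ)
      (g := fun p q => f (p, q)) (s := Set.univ) (k := Prod.snd '' K) isOpen_univ
      (hK.image continuous_snd) (fun p x _ hx => h0 _ fun h => hx ⟨_, h, rfl⟩)
      (locallyIntegrable_const _) (by simpa [Function.uncurry_def, HasUncurry.uncurry] using hf.contDiffOn)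
    rw [Set.univ_prod_univ, contDiffOn_univ] at h
    have h2 := h.comp (contDiff_id.prodMk (contDiff_const (c := (0 : F))))
    convert h2 using 1
    funext p
    simp only [Function.comp, convolution, ContinuousLinearMap.lsmul_apply, one_smul, id]
    exact (integral_sub_left_eq_self (fun q => f (p, q)) μ 0).symm
  · intro p hp
    have : (fun q => f (p, q)) = fun _ => 0 := by
      funext q
      exact h0 _ fun h => hp ⟨_, h, rfl⟩
    simp [this]

end IsTest

/-! ### Fourier inversion -/

/-- Fourier inversion at the origin. -/
theorem integral_integral_exp {k : ℕ} {g : (Fin k → ℝ) → ℂ} (hg : IsTest Set.univ g) :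
    ∫ l : Fin k → ℝ, ∫ x : Fin k → ℝ, Complex.exp (-(Complex.I * ∑ j, (l j : ℂ) * x j)) * g x =
      (2 * π : ℝ) ^ k * g 0 := by
  -- Fourier inversion needs an inner product space, so everything is transported along the
  -- volume-preserving identity from `EuclideanSpace`. Integrability of the transform is that of a
  -- Schwartz function.
  let e : EuclideanSpace ℝ (Fin k) → (Fin k → ℝ) := fun x => WithLp.ofLp x
  have he : MeasurePreserving e := PiLp.volume_preserving_ofLp (Fin k)
  have hem : MeasurableEmbedding e := (MeasurableEquiv.toLp 2 (Fin k → ℝ)).symm.measurableEmbedding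
  have hed : ContDiff ℝ (⊤ : ℕ∞) e := (PiLp.continuousLinearEquiv 2 ℝ fun _ : Fin k => ℝ).contDiff
  have hG : IsTest Set.univ fun x => g (e x) :=
    hg.comp (m := e) (fun y => WithLp.toLp 2 y)
      (PiLp.continuousLinearEquiv 2 ℝ fun _ : Fin k => ℝ).symm.continuous.continuousOn
      (fun _ _ => rfl) (fun _ _ => trivial) (fun _ _ => hed.contDiffAt)
  let G : SchwartzMap (EuclideanSpace ℝ (Fin k)) ℂ := hG.hasCompactSupport.toSchwartzMap hG.1
  have hGc : ∀ x, G x = g (e x) := fun _ => rfl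
  have hinv := hG.continuous.fourierInv_fourier_eq hG.integrable (by
    have := (FourierTransform.fourier G).integrable (μ := volume)
    rw [SchwartzMap.fourier_coe] at this
    exact this)
  have h0 := congrFun hinv 0
  rw [Real.fourierInv_eq'] at h0
  simp only [inner_zero_right, mul_zero, Complex.ofReal_zero, zero_mul, Complex.exp_zero,
    one_smul] at h0
  have hF : ∀ w : EuclideanSpace ℝ (Fin k), FourierTransform.fourier (fun x => g (e x)) w =
      ∫ x : Fin k → ℝ, Complex.exp (-(Complex.I * ∑ j, ((((2 * π) • e w) j : ℝ) : ℂ) * x j)) * g x := by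
    intro w
    rw [Real.fourier_eq', ← he.integral_comp hem]
    congr 1
    funext x
    rw [smul_eq_mul]
    congr 2
    have hin : inner ℝ x w = ∑ j, x j * w j := by
      simp [PiLp.inner_apply, mul_comm]
    simp only [hin, e, Pi.smul_apply, smul_eq_mul]
    push_cast
    rw [Finset.mul_sum, Finset.sum_mul, Finset.mul_sum, ← Finset.sum_neg_distrib]
    refine Finset.sum_congr rfl fun j _ => ?_
    ring
  simp_rw [hF] at h0
  -- The Fourier kernel has frequency `2π w`; rescaling `l = 2π w` in `k` dimensions produces the
  -- factor `(2π)^k`.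
  rw [he.integral_comp hem (fun w : Fin k → ℝ => ∫ x : Fin k → ℝ,
    Complex.exp (-(Complex.I * ∑ j, ((((2 * π) • w) j : ℝ) : ℂ) * x j)) * g x),
    Measure.integral_comp_smul volume (fun w : Fin k → ℝ => ∫ x : Fin k → ℝ,
    Complex.exp (-(Complex.I * ∑ j, ((w j : ℝ) : ℂ) * x j)) * g x) (2 * π)] at h0
  rw [show g 0 = g (e 0) from rfl, ← h0, Module.finrank_fin_fun, abs_of_pos (by positivity)]
  rw [Complex.real_smul]
  push_cast
  field_simp

/-! ### Logarithmic coordinates and Mellin inversion -/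

/-- The substitution `t = ρ e^s` turns a Mellin kernel into an exponential. The scales `ρ` are kept
free so that the ray through `ρ` becomes the diagonal in `s`. -/
theorem integral_positive_orthant {n : ℕ} (ρ : Fin n → ℝ) (hρ : ∀ j, 0 < ρ j)
    (F : (Fin n → ℝ) → ℂ) :
    ∫ t in {t : Fin n → ℝ | ∀ j, 0 < t j}, F t =
      ∫ s : Fin n → ℝ, (∏ j, ρ j * Real.exp (s j)) • F fun j => ρ j * Real.exp (s j) := by
  have himg : (fun (s : Fin n → ℝ) j => ρ j * Real.exp (s j)) '' Set.univ =
      {t : Fin n → ℝ | ∀ j, 0 < t j} := by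
    ext t
    simp only [Set.image_univ, Set.mem_range, Set.mem_ofPred_eq]
    constructor
    · rintro ⟨s, rfl⟩ j
      exact mul_pos (hρ j) (Real.exp_pos _)
    · intro ht
      refine ⟨fun j => Real.log (t j / ρ j), funext fun j => ?_⟩
      rw [Real.exp_log (div_pos (ht j) (hρ j))]
      have := (hρ j).ne'
      field_simp
  rw [← himg, integral_image_eq_integral_abs_det_fderiv_smul volume MeasurableSet.univ
    (f' := fun s => ContinuousLinearMap.pi fun j =>
      (ContinuousLinearMap.toSpanSingleton ℝ (ρ j * Real.exp (s j))).comp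
        (ContinuousLinearMap.proj j))]
  · rw [Measure.restrict_univ]
    congr 1
    funext s
    rw [ContinuousLinearMap.det_pi]
    congr 1
    rw [abs_of_nonneg]
    · refine Finset.prod_congr rfl fun j _ => ?_
      rw [ContinuousLinearMap.det_toSpanSingleton]
    · simp only [ContinuousLinearMap.det_toSpanSingleton]
      exact Finset.prod_nonneg fun j _ => (mul_pos (hρ j) (Real.exp_pos _)).le
  · intro s _
    rw [hasFDerivWithinAt_univ, hasFDerivAt_pi]
    intro j
    have h1 : HasFDerivAt (fun s : Fin n → ℝ => s j) (ContinuousLinearMap.proj j) s :=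
      (ContinuousLinearMap.proj (R := ℝ) (φ := fun _ : Fin n => ℝ) j).hasFDerivAt
    have h2 : HasDerivAt (fun x => ρ j * Real.exp x) (ρ j * Real.exp (s j)) (s j) :=
      (Real.hasDerivAt_exp _).const_mul _
    exact HasFDerivAt.comp (g := fun x => ρ j * Real.exp x) s h2.hasFDerivAt h1
  · intro s _ s' _ h
    funext j
    have := congrFun h j
    simpa [(hρ j).ne'] using this

theorem ofReal_cpow_eq_exp {r : ℝ} (hr : 0 < r) (w : ℂ) :
    (r : ℂ) ^ w = Complex.exp (Real.log r * w) := by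
  rw [Complex.cpow_def_of_ne_zero (by exact_mod_cast hr.ne'), Complex.ofReal_log hr.le]

theorem integral_snoc {k : ℕ} (G : (Fin (k + 1) → ℝ) → ℂ) (hG : Integrable G) :
    ∫ s, G s = ∫ a : ℝ, ∫ x : Fin k → ℝ, G (Fin.snoc (α := fun _ => ℝ) x a) := by
  have hm := (volume_preserving_piFinSuccAbove (fun _ : Fin (k + 1) => ℝ) (Fin.last k)).symm
  have hi : Integrable (fun p => G ((MeasurableEquiv.piFinSuccAbove (fun _ => ℝ)
      (Fin.last k)).symm p)) (volume.prod volume) :=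
    (hm.integrable_comp_emb (MeasurableEquiv.measurableEmbedding _)).2 hG
  rw [← hm.integral_comp', Measure.volume_eq_prod, integral_prod _ hi]
  congr 1
  funext a
  congr 1
  funext x
  congr 1
  simp [MeasurableEquiv.piFinSuccAbove, Fin.snocEquiv]

/-- Mellin inversion along the line `t = λ ρ`. -/
theorem deltaSum_mellin {k : ℕ} (c : Fin k → ℝ) (ρ : Fin (k + 1) → ℝ) (hρ : ∀ j, 0 < ρ j)
    {ψ : (Fin (k + 1) → ℝ) → ℂ} (hψ : IsTest {t | ∀ j, 0 < t j} ψ) :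
    deltaSum c (fun Δ => (∏ j, (ρ j : ℂ) ^ Δ j) *
      ∫ t in {t : Fin (k + 1) → ℝ | ∀ j, 0 < t j}, (∏ j, ((t j : ℝ) : ℂ) ^ (-Δ j - 1)) * ψ t) =
    (2 * π : ℝ) ^ (k + 1) * ∫ r in Set.Ioi (0 : ℝ), ((r ^ 3)⁻¹ : ℝ) * ψ fun j => ρ j * r := by
  let E : (Fin (k + 1) → ℝ) → (Fin (k + 1) → ℝ) := fun s j => ρ j * Real.exp (s j)
  have hE : ContDiff ℝ (⊤ : ℕ∞) E := by
    simp only [E]; fun_prop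
  have hlogc : ContinuousOn (fun (t : Fin (k + 1) → ℝ) j => Real.log (t j / ρ j))
      {t | ∀ j, 0 < t j} := by
    refine continuousOn_pi.2 fun j => ContinuousOn.log ?_ ?_
    · fun_prop
    · intro t ht
      exact (div_pos (ht j) (hρ j)).ne'
  have hlogE : ∀ s, (fun j => Real.log (E s j / ρ j)) = s := by
    intro s
    funext j
    have := (hρ j).ne'
    simp only [E]
    rw [mul_div_cancel_left₀ _ this, Real.log_exp]
  have hg : IsTest Set.univ fun s => ψ (E s) :=
    hψ.comp (m := E) (fun t j => Real.log (t j / ρ j)) hlogc (fun s _ => hlogE s)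
      (fun _ _ => trivial) (fun _ _ => hE.contDiffAt)
  -- On `∑ Δ = 2` the exponent `∑ Δ_j s_j` depends on the common shift `q` of all `s_j` only through
  -- `2 q`. The shear `s_j = x_j + q`, with last entry `q`, separates `q` from the variables `x`
  -- dual to `Im Δ`.
  let sh : (Fin k → ℝ) × ℝ → (Fin (k + 1) → ℝ) := fun p =>
    Fin.snoc (α := fun _ => ℝ) (fun j => p.1 j + p.2) p.2
  have hshd : ContDiff ℝ (⊤ : ℕ∞) sh := by
    rw [contDiff_pi]
    intro j
    refine Fin.lastCases ?_ (fun i => ?_) j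
    · simp only [sh, Fin.snoc_last]; fun_prop
    · simp only [sh, Fin.snoc_castSucc]; fun_prop
  have hg2 : IsTest Set.univ fun p => Complex.exp (-(2 * p.2 + ∑ j, (c j : ℂ) * p.1 j)) *
      ψ (E (sh p)) := by
    refine hg.mul_comp' (m := sh)
      (fun s => ((fun j : Fin k => s j.castSucc - s (Fin.last k)), s (Fin.last k)))
      (by fun_prop) (fun p _ => ?_) (fun _ _ => trivial) (fun _ _ => hshd.contDiffAt)
      (fun _ _ => ?_)
    · ext j <;> simp [sh]
    · apply ContDiff.contDiffAt
      have h1 : ContDiff ℝ (⊤ : ℕ∞) fun x : (Fin k → ℝ) × ℝ => (x.2 : ℂ) :=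
        Complex.ofRealCLM.contDiff.comp contDiff_snd
      have h2 : ∀ j, ContDiff ℝ (⊤ : ℕ∞) fun x : (Fin k → ℝ) × ℝ => (x.1 j : ℂ) := fun j =>
        Complex.ofRealCLM.contDiff.comp (by fun_prop)
      fun_prop
  have hh := hg2.integral (μ := volume)
  have hinv := integral_integral_exp (hh.mono (Set.subset_univ _))
  have hterm : ∀ (r s : ℝ) (w : ℂ), 0 < r →
      (r : ℂ) ^ w * (((r * Real.exp s : ℝ) : ℂ) * ((r * Real.exp s : ℝ) : ℂ) ^ (-w - 1)) =
        Complex.exp (-(w * s)) := by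
    intro r s w hr
    have hre := mul_pos hr (Real.exp_pos s)
    have h1 : ((r * Real.exp s : ℝ) : ℂ) ≠ 0 := by exact_mod_cast hre.ne'
    rw [Complex.cpow_sub _ _ h1, Complex.cpow_one, mul_div_cancel₀ _ h1,
      ofReal_cpow_eq_exp hr, ofReal_cpow_eq_exp hre, ← Complex.exp_add,
      Real.log_mul hr.ne' (Real.exp_pos s).ne', Real.log_exp]
    congr 1
    push_cast
    ring
  have hinner : ∀ Δ : Fin (k + 1) → ℂ, (∏ j, (ρ j : ℂ) ^ Δ j) *
      ∫ t in {t : Fin (k + 1) → ℝ | ∀ j, 0 < t j}, (∏ j, ((t j : ℝ) : ℂ) ^ (-Δ j - 1)) * ψ t =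
      ∫ s, Complex.exp (-∑ j, Δ j * s j) * ψ (E s) := by
    intro Δ
    rw [integral_positive_orthant ρ hρ, ← integral_const_mul]
    congr 1
    funext s
    rw [Complex.real_smul, Complex.ofReal_prod, ← Finset.sum_neg_distrib, Complex.exp_sum,
      ← mul_assoc, ← mul_assoc, ← Finset.prod_mul_distrib, ← Finset.prod_mul_distrib]
    congr 1
    refine Finset.prod_congr rfl fun j _ => ?_
    rw [← hterm (ρ j) (s j) (Δ j) (hρ j), mul_assoc]
  -- The contour `c` survives only as the weight `exp (-∑ c_j x_j)`, which is `1` at `x = 0`, where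
  -- Fourier inversion evaluates. Hence the result does not depend on `c`.
  have hmain : ∀ l : Fin k → ℝ, (∫ s, Complex.exp (-∑ j : Fin (k + 1),
      (Fin.snoc (α := fun _ => ℂ) (fun j => (c j : ℂ) + Complex.I * (l j : ℂ))
        (2 - ∑ j, ((c j : ℂ) + Complex.I * (l j : ℂ))) : Fin (k + 1) → ℂ) j * s j) * ψ (E s)) =
      ∫ x : Fin k → ℝ, Complex.exp (-(Complex.I * ∑ j, (l j : ℂ) * x j)) *
        ∫ q : ℝ, Complex.exp (-(2 * q + ∑ j, (c j : ℂ) * x j)) * ψ (E (sh (x, q))) := by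
    intro l
    have hwc : ∀ w : Fin (k + 1) → ℂ, ContDiff ℝ (⊤ : ℕ∞)
        fun s : Fin (k + 1) → ℝ => Complex.exp (-∑ j, w j * s j) := by
      intro w
      have h2 : ∀ j, ContDiff ℝ (⊤ : ℕ∞) fun x : Fin (k + 1) → ℝ => (x j : ℂ) := fun j =>
        Complex.ofRealCLM.contDiff.comp (by fun_prop)
      fun_prop
    rw [integral_snoc _ (hg.mul_left fun _ _ => (hwc _).contDiffAt).integrable]
    have h3 : IsTest Set.univ fun p : (Fin k → ℝ) × ℝ =>
        Complex.exp (-(Complex.I * ∑ j, (l j : ℂ) * p.1 j)) *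
        (Complex.exp (-(2 * p.2 + ∑ j, (c j : ℂ) * p.1 j)) * ψ (E (sh p))) := by
      refine hg2.mul_left fun _ _ => ContDiff.contDiffAt ?_
      have h2 : ∀ j, ContDiff ℝ (⊤ : ℕ∞) fun x : (Fin k → ℝ) × ℝ => (x.1 j : ℂ) := fun j =>
        Complex.ofRealCLM.contDiff.comp (by fun_prop)
      fun_prop
    simp_rw [← integral_const_mul]
    rw [integral_integral_swap (f := fun (x : Fin k → ℝ) (q : ℝ) =>
      Complex.exp (-(Complex.I * ∑ j, (l j : ℂ) * x j)) *
        (Complex.exp (-(2 * q + ∑ j, (c j : ℂ) * x j)) * ψ (E (sh (x, q)))))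
      (by exact h3.integrable (μ := volume.prod volume))]
    congr 1
    funext a
    rw [← integral_add_right_eq_self _ (fun _ : Fin k => a)]
    congr 1
    funext x
    rw [← mul_assoc, ← Complex.exp_add]
    congr 2
    rw [Fin.sum_univ_castSucc]
    simp only [Fin.snoc_castSucc, Fin.snoc_last, Pi.add_apply]
    push_cast
    have h5 : ∀ j, ((c j : ℂ) + Complex.I * l j) * ((x j : ℂ) + a) =
        c j * x j + Complex.I * (l j * x j) + (c j + Complex.I * l j) * a := fun j => by ring
    simp only [h5, Finset.sum_add_distrib, ← Finset.sum_mul, ← Finset.mul_sum]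
    ring
  unfold deltaSum
  simp_rw [hinner, hmain]
  -- With `r = e^q` the weight `e^{-2q} dq` becomes `r⁻³ dr`.
  rw [hinv, pow_succ' ((2 * π : ℝ) : ℂ) k, mul_assoc]
  congr 2
  rw [← Real.range_exp, ← Set.image_univ, integral_image_eq_integral_abs_deriv_smul
    MeasurableSet.univ (fun x _ => (Real.hasDerivAt_exp x).hasDerivWithinAt)
    Real.exp_injective.injOn, Measure.restrict_univ]
  congr 1
  funext q
  rw [abs_of_pos (Real.exp_pos q), Complex.real_smul, ← mul_assoc]
  congr 1
  · rw [← Complex.ofReal_mul, ← Real.exp_nat_mul, ← Real.exp_neg, ← Real.exp_add]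
    push_cast
    congr 1
    simp
    ring
  · congr 1
    funext j
    simp only [E, sh]
    congr 2
    refine Fin.lastCases ?_ (fun i => ?_) j <;> simp

/-! ### Box approximations -/

theorem setOf_forall_abs_lt_eq_ball {ι : Type} [Fintype ι] {r : ℝ} (hr : 0 < r) :
    {p : ι → ℝ | ∀ k, |p k| < r} = Metric.ball 0 r := by
  ext p
  simp [pi_norm_lt_iff hr]

/-- If the box integrals of `g` are box integrals of a continuous `h` in the space of values of
`f`, then the delta function evaluates `h` at the origin. -/
theorem isDeltaIntegral_of_eventually {E ι : Type} [MeasureSpace E] [Fintype ι]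
    {f : E → ι → ℝ} {g : E → ℂ} {h : (ι → ℝ) → ℂ} (hh : Continuous h)
    (heq : ∀ᶠ η : ℝ in 𝓝[>] 0, ∫ x in {x : E | ∀ k, |f x k| < η / 2}, g x =
      ∫ p in {p : ι → ℝ | ∀ k, |p k| < η / 2}, h p) :
    IsDeltaIntegral f g (h 0) := by
  unfold IsDeltaIntegral
  rw [Metric.tendsto_nhds]
  intro e he
  obtain ⟨δ, hδ, hδh⟩ := Metric.continuousAt_iff.1 (hh.continuousAt (x := 0)) (e / 2) (half_pos he)
  have hev : ∀ᶠ η : ℝ in 𝓝[>] 0, η ∈ Set.Ioo 0 (2 * δ) :=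
    Ioo_mem_nhdsGT (by positivity)
  filter_upwards [heq, hev] with η hη hη2
  obtain ⟨hη0, hη3⟩ := hη2
  rw [hη, setOf_forall_abs_lt_eq_ball (half_pos hη0)]
  have hvol : volume.real (Metric.ball (0 : ι → ℝ) (η / 2)) = η ^ Fintype.card ι := by
    rw [Measure.real, Real.volume_pi_ball _ (half_pos hη0), ENNReal.toReal_ofReal (by positivity)]
    congr 1
    ring
  have hint : IntegrableOn h (Metric.ball (0 : ι → ℝ) (η / 2)) :=
    (hh.locallyIntegrable.integrableOn_isCompact (isCompact_closedBall 0 (η / 2))).mono_set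
      Metric.ball_subset_closedBall
  have hpow : (η ^ Fintype.card ι : ℝ) ≠ 0 := by positivity
  have hdiff : ((η⁻¹ ^ Fintype.card ι : ℝ) : ℂ) * (∫ p in Metric.ball (0 : ι → ℝ) (η / 2), h p) -
      h 0 = ((η⁻¹ ^ Fintype.card ι : ℝ) : ℂ) *
        ∫ p in Metric.ball (0 : ι → ℝ) (η / 2), (h p - h 0) := by
    rw [integral_sub hint (integrableOn_const (by exact measure_ball_lt_top.ne)),
      setIntegral_const, hvol, Complex.real_smul, mul_sub, ← mul_assoc, ← Complex.ofReal_mul, inv_pow,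
      inv_mul_cancel₀ hpow]
    simp
  rw [dist_eq_norm, hdiff, norm_mul, Complex.norm_real, Real.norm_of_nonneg (by positivity)]
  have hb : ‖∫ p in Metric.ball (0 : ι → ℝ) (η / 2), (h p - h 0)‖ ≤
      e / 2 * volume.real (Metric.ball (0 : ι → ℝ) (η / 2)) := by
    refine norm_setIntegral_le_of_norm_le_const measure_ball_lt_top fun p hp => ?_
    have : dist p 0 < δ := lt_trans (Metric.mem_ball.1 hp) (by linarith)
    rw [← dist_eq_norm]
    exact (hδh this).le
  rw [hvol] at hb
  calc η⁻¹ ^ Fintype.card ι * _ ≤ η⁻¹ ^ Fintype.card ι * (e / 2 * η ^ Fintype.card ι) := by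
        gcongr
    _ = e / 2 := by rw [inv_pow]; field_simp
    _ < e := half_lt_self he

/-! ### Iterated integrals and linear substitutions -/

theorem integral_cons {n : ℕ} (G : (Fin (n + 1) → ℝ) → ℂ) (hG : Integrable G) :
    ∫ s, G s = ∫ a : ℝ, ∫ x : Fin n → ℝ, G (Fin.cons (α := fun _ => ℝ) a x) := by
  have hm := (volume_preserving_piFinSuccAbove (fun _ : Fin (n + 1) => ℝ) 0).symm
  have hi : Integrable (fun p => G ((MeasurableEquiv.piFinSuccAbove (fun _ => ℝ) 0).symm p))
      (volume.prod volume) :=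
    (hm.integrable_comp_emb (MeasurableEquiv.measurableEmbedding _)).2 hG
  rw [← hm.integral_comp', Measure.volume_eq_prod, integral_prod _ hi]
  congr 1
  funext a
  congr 1
  funext x
  congr 1
  simp [MeasurableEquiv.piFinSuccAbove, Fin.consEquiv]

theorem IsTest.cons {n : ℕ} {S : Set (Fin (n + 1) → ℝ)} {G : (Fin (n + 1) → ℝ) → ℂ}
    (hG : IsTest S G) (a : ℝ) :
    IsTest Set.univ fun x : Fin n → ℝ => G (Fin.cons (α := fun _ => ℝ) a x) := by
  refine hG.comp (fun y => fun j => y j.succ) (by fun_prop) (fun x _ => by simp)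
    (fun _ _ => trivial) (fun _ _ => ContDiff.contDiffAt ?_)
  rw [contDiff_pi]
  intro j
  refine Fin.cases ?_ (fun i => ?_) j
  · simp only [Fin.cons_zero]; fun_prop
  · simp only [Fin.cons_succ]; fun_prop

theorem integral_fin_one (G : (Fin 1 → ℝ) → ℂ) : ∫ s, G s = ∫ a : ℝ, G ![a] := by
  refine ((volume_preserving_funUnique (Fin 1) ℝ).symm.integral_comp' G).symm.trans ?_
  congr 1
  funext a
  congr 1
  funext j
  fin_cases j
  rfl

theorem IsTest.integral_fin_two {S : Set (Fin 2 → ℝ)} {G : (Fin 2 → ℝ) → ℂ} (hG : IsTest S G) :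
    ∫ s, G s = ∫ a : ℝ, ∫ b : ℝ, G ![a, b] := by
  rw [integral_cons G hG.integrable]
  simp_rw [integral_fin_one]
  rfl

theorem IsTest.integral_fin_three {S : Set (Fin 3 → ℝ)} {G : (Fin 3 → ℝ) → ℂ}
    (hG : IsTest S G) :
    ∫ s, G s = ∫ a : ℝ, ∫ b : ℝ, ∫ c : ℝ, G ![a, b, c] := by
  rw [integral_cons G hG.integrable]
  congr 1
  funext a
  rw [(hG.cons a).integral_fin_two]
  rfl

theorem IsTest.integral_fin_four {S : Set (Fin 4 → ℝ)} {G : (Fin 4 → ℝ) → ℂ}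
    (hG : IsTest S G) :
    ∫ s, G s = ∫ a : ℝ, ∫ b : ℝ, ∫ c : ℝ, ∫ d : ℝ, G ![a, b, c, d] := by
  rw [integral_cons G hG.integrable]
  congr 1
  funext a
  rw [(hG.cons a).integral_fin_three]
  rfl

theorem integral_comp_equiv {ι ι' : Type} [Fintype ι] [Fintype ι'] (e : ι ≃ ι')
    (G : (ι → ℝ) → ℂ) : ∫ s, G s = ∫ s : ι' → ℝ, G fun j => s (e j) := by
  have h := volume_measurePreserving_piCongrLeft (fun _ : ι' => ℝ) e
  rw [← h.integral_comp' (g := fun s : ι' → ℝ => G fun j => s (e j))]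
  congr 1
  funext s
  congr 1
  funext j
  exact (Equiv.piCongrLeft_apply_apply (P := fun _ => ℝ) e s j).symm

/-- The inverse is passed as an explicit map `W`; a left inverse suffices because `M` is
nonsingular. This lets the solved kinematics `energies` and `coords` be used directly. -/
theorem integral_matrix {ι : Type} [Fintype ι] [DecidableEq ι] (M : Matrix ι ι ℝ)
    (hM : M.det ≠ 0) (W : (ι → ℝ) → ι → ℝ) (hW : ∀ v, W (M.mulVec v) = v) (f : (ι → ℝ) → ℂ) :
    ∫ v, f v = |M.det⁻¹| • ∫ v, f (W v) := by
  have h := Real.map_matrix_volume_pi_eq_smul_volume_pi hM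
  have hemb : MeasurableEmbedding (Matrix.toLin' M) := by
    have h2 := (Matrix.toLinearEquiv' M
      (M.invertibleOfIsUnitDet (Ne.isUnit hM))).toContinuousLinearEquiv.toHomeomorph.measurableEmbedding
    exact h2
  have h3 : ∫ v, f (W v) ∂(Measure.map (Matrix.toLin' M) volume) = ∫ v, f v := by
    rw [hemb.integral_map]
    simp [Matrix.toLin'_apply, hW]
  rw [← h3, h, integral_smul_measure, ENNReal.toReal_ofReal (abs_nonneg _)]

theorem integral_affine (f : ℝ → ℂ) (a s : ℝ) (hs : s ≠ 0) :
    ∫ y, f y = |s| • ∫ x, f (a + s * x) := by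
  rw [Measure.integral_comp_mul_left (fun y => f (a + y)) s, integral_add_left_eq_self,
    smul_smul, abs_inv, mul_inv_cancel₀ (abs_ne_zero.2 hs), one_smul]

/-! ### Kinematics -/

/-- Profiles in energy space and in the region of the recursion. -/
def goodSet : Set ((Fin 4 → ℝ) × (Fin 4 → ℝ)) := {t | ∀ j, 0 < t j} ×ˢ region

theorem ne_of_injective {z : Fin 4 → ℝ} (hz : Injective z) {i j : Fin 4} (h : i ≠ j) :
    z i - z j ≠ 0 := sub_ne_zero.2 (hz.ne h)

theorem eps_ne_zero {ε : Fin 4 → ℝ} (hε : ∀ j, ε j = 1 ∨ ε j = -1) (j : Fin 4) : ε j ≠ 0 := by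
  rcases hε j with h | h <;> simp [h]

theorem eps_sq {ε : Fin 4 → ℝ} (hε : ∀ j, ε j = 1 ∨ ε j = -1) (j : Fin 4) : ε j ^ 2 = 1 := by
  rcases hε j with h | h <;> simp [h]

/-- The energies with prescribed energies of the particles 3 and 4 and prescribed components
`(0, 1)` and `(1, 1)` of the total momentum. -/
def energies (z ε w : Fin 4 → ℝ) : Fin 4 → ℝ :=
  ![(-w 0 + z 1 * w 1 - ε 2 * w 2 * (z 2 - z 1) - ε 3 * w 3 * (z 3 - z 1)) / (ε 0 * (z 0 - z 1)),
    (-w 0 + z 0 * w 1 - ε 2 * w 2 * (z 2 - z 0) - ε 3 * w 3 * (z 3 - z 0)) / (ε 1 * (z 1 - z 0)),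
    w 2, w 3]

/-- The coordinates `z̄` with prescribed `z̄₂`, `z̄₄` and prescribed components `(0, 0)` and
`(1, 0)` of the total momentum. -/
def coords (z ε t v : Fin 4 → ℝ) : Fin 4 → ℝ :=
  ![(-v 0 + z 2 * v 2 - ε 1 * t 1 * (z 1 - z 2) * v 1 - ε 3 * t 3 * (z 3 - z 2) * v 3) /
      (ε 0 * t 0 * (z 0 - z 2)),
    v 1,
    (-v 0 + z 0 * v 2 - ε 1 * t 1 * (z 1 - z 0) * v 1 - ε 3 * t 3 * (z 3 - z 0) * v 3) /
      (ε 2 * t 2 * (z 2 - z 0)),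
    v 3]

/-- The density of the amplitude on the momentum shell. -/
def density (κ : ℝ) (z ε t y : Fin 4 → ℝ) : ℝ :=
  (2 * π) ^ 4 * (κ / 2) * (ε 0 * ε 1) * (z 0 - z 1) ^ 7 /
    ((z 0 - z 2) * (z 0 - z 3) * (z 1 - z 2) * (z 1 - z 3) * (z 2 - z 3) ^ 2 *
      (|z 0 - z 1| * |z 0 - z 2|)) *
    (t 0 * t 1 ^ 2 * (y 0 - y 1) / (t 2 ^ 4 * t 3 ^ 3))

/-- The energies on the momentum shell, in the coordinates `(ω₃, ω₄, z̄₂, z̄₄)`. -/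
def shellT (z ε q : Fin 4 → ℝ) : Fin 4 → ℝ := energies z ε ![0, 0, q 0, q 1]

/-- The coordinates `z̄` on the momentum shell. -/
def shellZ (z ε q : Fin 4 → ℝ) : Fin 4 → ℝ := coords z ε (shellT z ε q) ![0, q 2, 0, q 3]

/-- The amplitude on the momentum shell, paired with `mellinTest φ`. -/
def shellIntegrand (κ : ℝ) (z ε : Fin 4 → ℝ) (φ : (Fin 4 → ℝ) × (Fin 4 → ℝ) → ℂ)
    (q : Fin 4 → ℝ) : ℂ :=
  density κ z ε (shellT z ε q) (shellZ z ε q) * φ (shellT z ε q, shellZ z ε q)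

theorem totalMomentum_zero_zero (z ε t y : Fin 4 → ℝ) (ht : ∀ j, 0 ≤ t j) :
    totalMomentum z ε (t, y) (0, 0) = -∑ i, ε i * t i * z i * y i := by
  simp only [totalMomentum, lam, lamTilde, ← Finset.sum_neg_distrib]
  refine Finset.sum_congr rfl fun i _ => ?_
  have := Real.mul_self_sqrt (ht i)
  simp
  linear_combination (ε i * z i * y i) * this

theorem totalMomentum_one_zero (z ε t y : Fin 4 → ℝ) (ht : ∀ j, 0 ≤ t j) :
    totalMomentum z ε (t, y) (1, 0) = -∑ i, ε i * t i * y i := by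
  simp only [totalMomentum, lam, lamTilde, ← Finset.sum_neg_distrib]
  refine Finset.sum_congr rfl fun i _ => ?_
  have := Real.mul_self_sqrt (ht i)
  simp
  linear_combination (ε i * y i) * this

theorem totalMomentum_zero_one (z ε t y : Fin 4 → ℝ) (ht : ∀ j, 0 ≤ t j) :
    totalMomentum z ε (t, y) (0, 1) = -∑ i, ε i * t i * z i := by
  simp only [totalMomentum, lam, lamTilde, ← Finset.sum_neg_distrib]
  refine Finset.sum_congr rfl fun i _ => ?_
  have := Real.mul_self_sqrt (ht i)
  simp
  linear_combination (ε i * z i) * this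

theorem totalMomentum_one_one (z ε t y : Fin 4 → ℝ) (ht : ∀ j, 0 ≤ t j) :
    totalMomentum z ε (t, y) (1, 1) = -∑ i, ε i * t i := by
  simp only [totalMomentum, lam, lamTilde, ← Finset.sum_neg_distrib]
  refine Finset.sum_congr rfl fun i _ => ?_
  have := Real.mul_self_sqrt (ht i)
  simp
  linear_combination (ε i) * this

/-- The energy matrix of the total momentum. -/
def energyMatrix (z ε : Fin 4 → ℝ) : Matrix (Fin 4) (Fin 4) ℝ :=
  !![-ε 0 * z 0, -ε 1 * z 1, -ε 2 * z 2, -ε 3 * z 3; -ε 0, -ε 1, -ε 2, -ε 3; 0, 0, 1, 0; 0, 0, 0, 1]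

/-- The `z̄` matrix of the total momentum. -/
def coordMatrix (z ε t : Fin 4 → ℝ) : Matrix (Fin 4) (Fin 4) ℝ :=
  !![-ε 0 * t 0 * z 0, -ε 1 * t 1 * z 1, -ε 2 * t 2 * z 2, -ε 3 * t 3 * z 3; 0, 1, 0, 0;
    -ε 0 * t 0, -ε 1 * t 1, -ε 2 * t 2, -ε 3 * t 3; 0, 0, 0, 1]

theorem energyMatrix_mulVec (z ε t : Fin 4 → ℝ) : (energyMatrix z ε).mulVec t =
    ![-∑ i, ε i * t i * z i, -∑ i, ε i * t i, t 2, t 3] := by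
  funext i
  fin_cases i <;> simp [energyMatrix, Matrix.mulVec, dotProduct, Fin.sum_univ_four] <;> ring

theorem coordMatrix_mulVec (z ε t y : Fin 4 → ℝ) : (coordMatrix z ε t).mulVec y =
    ![-∑ i, ε i * t i * z i * y i, y 1, -∑ i, ε i * t i * y i, y 3] := by
  funext i
  fin_cases i <;> simp [coordMatrix, Matrix.mulVec, dotProduct, Fin.sum_univ_four] <;> ring

theorem det_energyMatrix (z ε : Fin 4 → ℝ) :
    (energyMatrix z ε).det = ε 0 * ε 1 * (z 0 - z 1) := by
  simp [energyMatrix, Matrix.det_succ_row_zero, Fin.sum_univ_succ, Fin.succAbove]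
  ring

theorem det_coordMatrix (z ε t : Fin 4 → ℝ) :
    (coordMatrix z ε t).det = ε 0 * ε 2 * t 0 * t 2 * (z 0 - z 2) := by
  simp [coordMatrix, Matrix.det_succ_row_zero, Fin.sum_univ_succ, Fin.succAbove]
  ring

theorem energies_mulVec {z ε : Fin 4 → ℝ} (hz : Injective z) (hε : ∀ j, ε j ≠ 0)
    (t : Fin 4 → ℝ) : energies z ε ((energyMatrix z ε).mulVec t) = t := by
  have h1 := ne_of_injective hz (i := 0) (j := 1) (by decide)
  have h2 := ne_of_injective hz (i := 1) (j := 0) (by decide)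
  have h3 := hε 0
  have h4 := hε 1
  rw [energyMatrix_mulVec]
  funext i
  fin_cases i <;> simp [energies, Fin.sum_univ_four] <;> field_simp <;> ring

theorem coords_mulVec {z ε t : Fin 4 → ℝ} (hz : Injective z) (hε : ∀ j, ε j ≠ 0)
    (ht : ∀ j, 0 < t j) (y : Fin 4 → ℝ) : coords z ε t ((coordMatrix z ε t).mulVec y) = y := by
  have h1 := ne_of_injective hz (i := 0) (j := 2) (by decide)
  have h2 := ne_of_injective hz (i := 2) (j := 0) (by decide)
  have h3 := hε 0
  have h4 := hε 2
  have h5 := (ht 0).ne'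
  have h6 := (ht 2).ne'
  rw [coordMatrix_mulVec]
  funext i
  fin_cases i <;> simp [coords, Fin.sum_univ_four] <;> field_simp <;> ring

theorem mulVec_energies {z ε : Fin 4 → ℝ} (hz : Injective z) (hε : ∀ j, ε j ≠ 0)
    (w : Fin 4 → ℝ) : (energyMatrix z ε).mulVec (energies z ε w) = w := by
  have h1 := ne_of_injective hz (i := 0) (j := 1) (by decide)
  have h2 := ne_of_injective hz (i := 1) (j := 0) (by decide)
  have h3 := hε 0
  have h4 := hε 1
  rw [energyMatrix_mulVec]
  funext i
  fin_cases i <;> simp [energies, Fin.sum_univ_four] <;> field_simp <;> ring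

theorem mulVec_coords {z ε t : Fin 4 → ℝ} (hz : Injective z) (hε : ∀ j, ε j ≠ 0)
    (ht : ∀ j, 0 < t j) (v : Fin 4 → ℝ) : (coordMatrix z ε t).mulVec (coords z ε t v) = v := by
  have h1 := ne_of_injective hz (i := 0) (j := 2) (by decide)
  have h2 := ne_of_injective hz (i := 2) (j := 0) (by decide)
  have h3 := hε 0
  have h4 := hε 2
  have h5 := (ht 0).ne'
  have h6 := (ht 2).ne'
  rw [coordMatrix_mulVec]
  funext i
  fin_cases i <;> simp [coords, Fin.sum_univ_four] <;> field_simp <;> ring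

/-- Each bracket `⟨ij⟩` carries `ε_i ε_j √ω_i √ω_j` and `[12]` carries `√ω₁ √ω₂`. All square roots
occur to even powers, and of the signs only `(ε₁ ε₂)^7 = ε₁ ε₂` survives. -/
theorem treeAmplitude_eq {z ε : Fin 4 → ℝ} (hε : ∀ j, ε j = 1 ∨ ε j = -1) {t : Fin 4 → ℝ}
    (ht : ∀ j, 0 < t j) (y : Fin 4 → ℝ) :
    treeAmplitude z ε (t, y) = ε 0 * ε 1 * (t 0 ^ 3 * t 1 ^ 3 / (t 2 ^ 2 * t 3 ^ 2)) *
      ((z 0 - z 1) ^ 7 * (y 0 - y 1) /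
        ((z 0 - z 2) * (z 0 - z 3) * (z 1 - z 2) * (z 1 - z 3) * (z 2 - z 3) ^ 2)) := by
  have hs : ∀ j, ∃ s : ℝ, 0 < s ∧ t j = s ^ 2 := fun j =>
    ⟨√(t j), Real.sqrt_pos.2 (ht j), (Real.sq_sqrt (ht j).le).symm⟩
  choose s hs0 hs using hs
  have hsq : ∀ j, √(t j) = s j := fun j => by rw [hs, Real.sqrt_sq (hs0 j).le]
  have hb : ∀ i j, bracket (lam z ε t i) (lam z ε t j) =
      ε i * ε j * s i * s j * (z i - z j) := by
    intro i j
    simp [bracket, lam, hsq]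
    ring
  have hb2 : bracket (lamTilde y t 0) (lamTilde y t 1) = s 0 * s 1 * (y 0 - y 1) := by
    simp [bracket, lamTilde, hsq]
    ring
  have h0 := (hs0 0).ne'
  have h1 := (hs0 1).ne'
  have h2 := (hs0 2).ne'
  have h3 := (hs0 3).ne'
  have e : ∀ j, (ε j)⁻¹ = ε j := fun j => by rcases hε j with h | h <;> simp [h]
  simp only [treeAmplitude, hb, hb2, hs]
  have hD : ∀ A B C D E : ℝ, ε 0 * ε 2 * s 0 * s 2 * A * (ε 0 * ε 3 * s 0 * s 3 * B) *
      (ε 1 * ε 2 * s 1 * s 2 * C) * (ε 1 * ε 3 * s 1 * s 3 * D) *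
      (ε 2 * ε 3 * s 2 * s 3 * E) ^ 2 =
      (s 0 ^ 2 * s 1 ^ 2 * s 2 ^ 4 * s 3 ^ 4) * (A * B * C * D * E ^ 2) := by
    intro A B C D E
    linear_combination (exp := 1) (s 0 ^ 2 * s 1 ^ 2 * s 2 ^ 4 * s 3 ^ 4) * (A * B * C * D * E ^ 2) *
      ((ε 1 ^ 2 * ε 2 ^ 4 * ε 3 ^ 4) * eps_sq hε 0 + (ε 2 ^ 4 * ε 3 ^ 4) * eps_sq hε 1 +
        (ε 3 ^ 4 * (ε 2 ^ 2 + 1)) * eps_sq hε 2 + (ε 3 ^ 2 + 1) * eps_sq hε 3)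
  have hN : (ε 0 * ε 1 * s 0 * s 1 * (z 0 - z 1)) ^ 7 * (s 0 * s 1 * (y 0 - y 1)) =
      (ε 0 * ε 1) * (s 0 ^ 8 * s 1 ^ 8) * ((z 0 - z 1) ^ 7 * (y 0 - y 1)) := by
    have : (ε 0 * ε 1) ^ 7 = ε 0 * ε 1 := by
      rcases hε 0 with h | h <;> rcases hε 1 with h' | h' <;> simp [h, h'] <;> norm_num
    linear_combination (s 0 ^ 8 * s 1 ^ 8) * ((z 0 - z 1) ^ 7 * (y 0 - y 1)) * this
  rw [hD, hN, mul_div_mul_comm]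
  congr 1
  field_simp

/-! ### The amplitude in momentum space -/

theorem contDiff_energies (z ε : Fin 4 → ℝ) : ContDiff ℝ (⊤ : ℕ∞) (energies z ε) := by
  rw [contDiff_pi]
  intro j
  fin_cases j <;> simp [energies] <;> fun_prop

theorem contDiffAt_coords {z ε : Fin 4 → ℝ} (hz : Injective z) (hε : ∀ j, ε j ≠ 0)
    {p : (Fin 4 → ℝ) × (Fin 4 → ℝ)} (h0 : p.1 0 ≠ 0) (h2 : p.1 2 ≠ 0) :
    ContDiffAt ℝ (⊤ : ℕ∞) (fun p : (Fin 4 → ℝ) × (Fin 4 → ℝ) => coords z ε p.1 p.2) p := by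
  have h02 := ne_of_injective hz (i := 0) (j := 2) (by decide)
  have h20 := ne_of_injective hz (i := 2) (j := 0) (by decide)
  rw [contDiffAt_pi]
  intro j
  fin_cases j
  · refine ContDiffAt.div ?_ ?_ (mul_ne_zero (mul_ne_zero (hε 0) h0) h02) <;> fun_prop
  · simp [coords]; fun_prop
  · refine ContDiffAt.div ?_ ?_ (mul_ne_zero (mul_ne_zero (hε 2) h2) h20) <;> fun_prop
  · simp [coords]; fun_prop

theorem contDiffAt_density {κ : ℝ} {z ε : Fin 4 → ℝ} {p : (Fin 4 → ℝ) × (Fin 4 → ℝ)}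
    (h2 : p.1 2 ≠ 0) (h3 : p.1 3 ≠ 0) :
    ContDiffAt ℝ (⊤ : ℕ∞)
      (fun p : (Fin 4 → ℝ) × (Fin 4 → ℝ) => (density κ z ε p.1 p.2 : ℂ)) p := by
  have h : ContDiffAt ℝ (⊤ : ℕ∞)
      (fun p : (Fin 4 → ℝ) × (Fin 4 → ℝ) => density κ z ε p.1 p.2) p := by
    simp only [density]
    refine contDiffAt_const.mul (ContDiffAt.div ?_ ?_
      (mul_ne_zero (pow_ne_zero _ h2) (pow_ne_zero _ h3))) <;> fun_prop
  exact Complex.ofRealCLM.contDiff.contDiffAt.comp p h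

/-- The amplitude paired with `φ`, as a function of the total momentum and of
`(ω₃, ω₄, z̄₂, z̄₄)`. -/
def offShell (κ : ℝ) (z ε : Fin 4 → ℝ) (φ : (Fin 4 → ℝ) × (Fin 4 → ℝ) → ℂ)
    (p : (Fin 4 → ℝ) × (Fin 4 → ℝ)) : ℂ :=
  density κ z ε (energies z ε p.1) (coords z ε (energies z ε p.1) p.2) *
    φ (energies z ε p.1, coords z ε (energies z ε p.1) p.2)

/-- The substitution is undone in two stages, first `z̄` at fixed energies and then the energies,
because `coords` is regular only where the energies `t 0`, `t 2` are nonzero, which the support of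
`φ` guarantees. -/
theorem isTest_offShell (κ : ℝ) {z ε : Fin 4 → ℝ} (hz : Injective z) (hε : ∀ j, ε j ≠ 0)
    {φ : (Fin 4 → ℝ) × (Fin 4 → ℝ) → ℂ} (hφ : IsTest goodSet φ) :
    IsTest {p : (Fin 4 → ℝ) × (Fin 4 → ℝ) | ∀ j, 0 < energies z ε p.1 j}
      (offShell κ z ε φ) := by
  have h1 : ContDiff ℝ (⊤ : ℕ∞) fun p : (Fin 4 → ℝ) × (Fin 4 → ℝ) => energies z ε p.1 :=
    (contDiff_energies z ε).comp contDiff_fst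
  let m₁ : (Fin 4 → ℝ) × (Fin 4 → ℝ) → (Fin 4 → ℝ) × (Fin 4 → ℝ) := fun p =>
    (energies z ε p.1, p.2)
  have hm₁ : ContDiff ℝ (⊤ : ℕ∞) m₁ := h1.prodMk contDiff_snd
  let m₂ : (Fin 4 → ℝ) × (Fin 4 → ℝ) → (Fin 4 → ℝ) × (Fin 4 → ℝ) := fun p =>
    (p.1, coords z ε p.1 p.2)
  have hm₂ : ∀ p ∈ {p : (Fin 4 → ℝ) × (Fin 4 → ℝ) | ∀ j, 0 < p.1 j},
      ContDiffAt ℝ (⊤ : ℕ∞) m₂ p := fun p hp =>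
    contDiffAt_fst.prodMk (contDiffAt_coords hz hε (hp 0).ne' (hp 2).ne')
  have hφ₂ : IsTest {p : (Fin 4 → ℝ) × (Fin 4 → ℝ) | ∀ j, 0 < p.1 j}
      fun p => density κ z ε p.1 (coords z ε p.1 p.2) * φ (m₂ p) := by
    refine hφ.mul_comp' (fun p => (p.1, (coordMatrix z ε p.1).mulVec p.2)) ?_ ?_ ?_ hm₂ ?_
    · refine Continuous.continuousOn (continuous_fst.prodMk ?_)
      refine Continuous.matrix_mulVec (continuous_matrix fun i j => ?_) continuous_snd
      fin_cases i <;> fin_cases j <;> simp [coordMatrix] <;> fun_prop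
    · rintro p ⟨hp, _⟩
      exact Prod.ext rfl (mulVec_coords hz hε hp p.2)
    · rintro p ⟨hp, _⟩
      exact hp
    · intro p hp
      exact ContDiffAt.comp (g := fun p : (Fin 4 → ℝ) × (Fin 4 → ℝ) =>
        (density κ z ε p.1 p.2 : ℂ)) p
        (contDiffAt_density (p := m₂ p) (hp 2).ne' (hp 3).ne') (hm₂ p hp)
  refine hφ₂.comp (m := m₁) (fun p => ((energyMatrix z ε).mulVec p.1, p.2)) ?_ ?_ ?_
    fun p _ => hm₁.contDiffAt
  · exact Continuous.continuousOn
      ((Continuous.matrix_mulVec continuous_const continuous_fst).prodMk continuous_snd)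
  · intro p _
    exact Prod.ext (mulVec_energies hz hε p.1) rfl
  · rintro p hp j
    simp only [energies_mulVec hz hε]
    exact hp j

/-- This is `offShell` restricted to zero momentum. The slice has smaller dimension, so the pullback
uses the closed conditions that the two momentum components of `p.1` vanish. -/
theorem isTest_shellIntegrand (κ : ℝ) {z ε : Fin 4 → ℝ} (hz : Injective z) (hε : ∀ j, ε j ≠ 0)
    {φ : (Fin 4 → ℝ) × (Fin 4 → ℝ) → ℂ} (hφ : IsTest goodSet φ) :
    IsTest {q : Fin 4 → ℝ | ∀ j, 0 < shellT z ε q j} (shellIntegrand κ z ε φ) := by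
  let m : (Fin 4 → ℝ) → (Fin 4 → ℝ) × (Fin 4 → ℝ) := fun q =>
    (![0, 0, q 0, q 1], ![0, q 2, 0, q 3])
  have hm : ContDiff ℝ (⊤ : ℕ∞) m := by
    refine ContDiff.prodMk ?_ ?_ <;>
    · rw [contDiff_pi]
      intro j
      fin_cases j <;> simp <;> fun_prop
  let r : (Fin 4 → ℝ) × (Fin 4 → ℝ) → Fin 4 → ℝ := fun p => ![p.1 2, p.1 3, p.2 1, p.2 3]
  have hr : Continuous r := by
    refine continuous_pi fun j => ?_
    fin_cases j <;> simp [r] <;> fun_prop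
  have hrm : ∀ q, r (m q) = q := by
    intro q
    ext j
    fin_cases j <;> simp [r, m]
  have heq : shellIntegrand κ z ε φ = fun q => 1 * offShell κ z ε φ (m q) := by
    funext q
    rw [one_mul]
    rfl
  rw [heq]
  refine (isTest_offShell κ hz hε hφ).mul_comp r {p | p.1 0 = 0 ∧ p.1 1 = 0} ?_ hr.continuousOn
    (fun q _ => ?_) (fun q _ => hrm q) ?_ (fun _ _ => hm.contDiffAt) fun _ _ => contDiffAt_const
  · exact (isClosed_eq (by fun_prop) (by fun_prop)).inter
      (isClosed_eq (by fun_prop) (by fun_prop))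
  · simp [m]
  · intro p hp hp2 j
    have : ![0, 0, r p 0, r p 1] = p.1 := by
      ext j
      fin_cases j <;> simp [r, hp2.1, hp2.2]
    rw [shellT, this]
    exact hp j

theorem integral_reindex (G : (Fin 4 → ℝ) × (Fin 4 → ℝ) → ℂ) :
    ∫ x, G x = ∫ x : (Fin 2 × Fin 2 → ℝ) × (Fin 4 → ℝ),
      G (![x.1 (0, 1), x.1 (1, 1), x.2 0, x.2 1], ![x.1 (0, 0), x.2 2, x.1 (1, 0), x.2 3]) := by
  let e : Fin 4 ⊕ Fin 4 → (Fin 2 × Fin 2) ⊕ Fin 4 :=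
    Sum.elim ![Sum.inl (0, 1), Sum.inl (1, 1), Sum.inr 0, Sum.inr 1]
      ![Sum.inl (0, 0), Sum.inr 2, Sum.inl (1, 0), Sum.inr 3]
  have he : Bijective e := by
    rw [Fintype.bijective_iff_injective_and_card]
    exact ⟨by decide, by decide⟩
  have h1 := (volume_measurePreserving_sumPiEquivProdPi
    (fun _ : Fin 4 ⊕ Fin 4 => ℝ)).integral_comp' G
  have h2 := (volume_measurePreserving_sumPiEquivProdPi_symm
    (fun _ : (Fin 2 × Fin 2) ⊕ Fin 4 => ℝ)).integral_comp' (f := (MeasurableEquiv.sumPiEquivProdPi _).symm)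
      (fun s => G (MeasurableEquiv.sumPiEquivProdPi (fun _ : Fin 4 ⊕ Fin 4 => ℝ)
        fun j => s (e j)))
  rw [← h1, integral_comp_equiv (Equiv.ofBijective e he)]
  simp only [Equiv.ofBijective_apply]
  rw [← h2]
  congr 1
  funext x
  congr 1
  ext j <;> fin_cases j <;> rfl

theorem continuous_totalMomentum (z ε : Fin 4 → ℝ) (k : Fin 2 × Fin 2) :
    Continuous fun p => totalMomentum z ε p k := by
  simp only [totalMomentum, lam, lamTilde, Pi.smul_apply, smul_eq_mul]
  have : ∀ (i j : Fin 2) (a : (Fin 4 → ℝ) × (Fin 4 → ℝ) → ℝ), Continuous a →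
      Continuous fun p => (![a p, 1] : Fin 2 → ℝ) j := by
    intro i j a ha
    fin_cases j
    · simpa using ha
    · simpa using continuous_const
  refine continuous_finsetSum _ fun i _ => Continuous.mul (by fun_prop)
    (Continuous.mul (by fun_prop) (this k.1 k.2 _ (by fun_prop)))

/-- `density` is defined as the integrand divided by the Jacobian of the momentum in `(ω₁, ω₂; z̄₁,
z̄₃)`. That Jacobian is split here into the energy part `|z 0 - z 1|` and the `z̄` part at fixed
energies, to be cancelled one after the other. -/
theorem momentumIntegrand_eq (κ : ℝ) {z ε : Fin 4 → ℝ} (hz : Injective z)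
    (hε : ∀ j, ε j = 1 ∨ ε j = -1) (φ : (Fin 4 → ℝ) × (Fin 4 → ℝ) → ℂ) {t : Fin 4 → ℝ}
    (ht : ∀ j, 0 < t j) (y : Fin 4 → ℝ) :
    momentumIntegrand κ z ε φ (t, y) =
      ((|z 0 - z 1| * |(coordMatrix z ε t).det| : ℝ) : ℂ) * (density κ z ε t y * φ (t, y)) := by
  have h01 := abs_ne_zero.2 (ne_of_injective hz (i := 0) (j := 1) (by decide))
  have h02 := abs_ne_zero.2 (ne_of_injective hz (i := 0) (j := 2) (by decide))
  have h02' := (ne_of_injective hz (i := 0) (j := 2) (by decide))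
  have h03 := (ne_of_injective hz (i := 0) (j := 3) (by decide))
  have h12 := (ne_of_injective hz (i := 1) (j := 2) (by decide))
  have h13 := (ne_of_injective hz (i := 1) (j := 3) (by decide))
  have h23 := (ne_of_injective hz (i := 2) (j := 3) (by decide))
  have habs : ∀ j, |ε j| = 1 := fun j => by rcases hε j with h | h <;> simp [h]
  rw [momentumIntegrand, ← mul_assoc, ← Complex.ofReal_mul, det_coordMatrix, treeAmplitude_eq hε ht]
  congr 2
  simp only [abs_mul, habs, abs_of_pos (ht 0), abs_of_pos (ht 2), density, Fin.prod_univ_four]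
  have t0 := (ht 0).ne'
  have t1 := (ht 1).ne'
  have t2 := (ht 2).ne'
  have t3 := (ht 3).ne'
  field_simp

theorem isTest_momentumIntegrand (κ : ℝ) {z ε : Fin 4 → ℝ} (hz : Injective z)
    (hε : ∀ j, ε j = 1 ∨ ε j = -1) {φ : (Fin 4 → ℝ) × (Fin 4 → ℝ) → ℂ} (hφ : IsTest goodSet φ) :
    IsTest goodSet (momentumIntegrand κ z ε φ) := by
  have heq : momentumIntegrand κ z ε φ = fun p =>
      (((|z 0 - z 1| * (|z 0 - z 2| * p.1 0 * p.1 2) : ℝ) : ℂ) * density κ z ε p.1 p.2) * φ p := by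
    funext ⟨t, y⟩
    by_cases h : φ (t, y) = 0
    · simp [momentumIntegrand, h]
    · have ht : ∀ j, 0 < t j := (hφ.mem h).1
      have habs : ∀ j, |ε j| = 1 := fun j => by rcases hε j with h | h <;> simp [h]
      rw [momentumIntegrand_eq κ hz hε φ ht, det_coordMatrix, ← mul_assoc]
      congr 3
      simp only [abs_mul, habs, abs_of_pos (ht 0), abs_of_pos (ht 2)]
      ring
  rw [heq]
  refine hφ.mul_left fun p hp => ContDiffAt.mul ?_
    (contDiffAt_density (hp.1 2).ne' (hp.1 3).ne')
  have h : ContDiff ℝ (⊤ : ℕ∞) fun p : (Fin 4 → ℝ) × (Fin 4 → ℝ) =>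
      |z 0 - z 1| * (|z 0 - z 2| * p.1 0 * p.1 2) := by fun_prop
  exact (Complex.ofRealCLM.contDiff.comp h).contDiffAt

/-- The total momentum is in the box. -/
def boxSet (η : ℝ) : Set ((Fin 4 → ℝ) × (Fin 4 → ℝ)) :=
  {p | |p.1 0| < η / 2 ∧ |p.1 1| < η / 2 ∧ |p.2 0| < η / 2 ∧ |p.2 2| < η / 2}

theorem measurableSet_boxSet (η : ℝ) : MeasurableSet (boxSet η) := by
  have h : ∀ f : (Fin 4 → ℝ) × (Fin 4 → ℝ) → ℝ, Continuous f →
      IsOpen {p | |f p| < η / 2} := fun f hf => isOpen_lt (by fun_prop) continuous_const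
  refine IsOpen.measurableSet ((h _ (by fun_prop)).inter ((h _ ?_).inter
    ((h _ ?_).inter (h _ ?_)))) <;> fun_prop

theorem mem_boxSet_iff {z ε t : Fin 4 → ℝ} (ht : ∀ j, 0 < t j) (y : Fin 4 → ℝ) (η : ℝ) :
    (∀ k, |totalMomentum z ε (t, y) k| < η / 2) ↔
      ((energyMatrix z ε).mulVec t, (coordMatrix z ε t).mulVec y) ∈ boxSet η := by
  have h0 := fun j => (ht j).le
  simp only [Prod.forall, Fin.forall_fin_two, totalMomentum_zero_zero z ε t y h0,
    totalMomentum_zero_one z ε t y h0, totalMomentum_one_zero z ε t y h0,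
    totalMomentum_one_one z ε t y h0, energyMatrix_mulVec, coordMatrix_mulVec, boxSet,
    Set.mem_ofPred_eq]
  simp
  tauto

/-- The profile off the momentum shell, at given energies. -/
def offShellAt (κ : ℝ) (z ε : Fin 4 → ℝ) (φ : (Fin 4 → ℝ) × (Fin 4 → ℝ) → ℂ)
    (t v : Fin 4 → ℝ) : ℂ :=
  density κ z ε t (coords z ε t v) * φ (t, coords z ε t v)

-- Fubini with the `z̄` integral inside: at fixed energies the momentum components `(0, 0)`, `(1,
-- 0)` replace `z̄₁, z̄₃`, and then the components `(0, 1)`, `(1, 1)` replace `ω₁, ω₂`. The two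
-- determinants cancel the prefactor of `momentumIntegrand_eq`, exactly and for every `η`.
open scoped Classical in
theorem setIntegral_momentumIntegrand (κ : ℝ) {z ε : Fin 4 → ℝ} (hz : Injective z)
    (hε : ∀ j, ε j = 1 ∨ ε j = -1) {φ : (Fin 4 → ℝ) × (Fin 4 → ℝ) → ℂ} (hφ : IsTest goodSet φ)
    (η : ℝ) :
    ∫ x in {x | ∀ k, |totalMomentum z ε x k| < η / 2}, momentumIntegrand κ z ε φ x =
      ∫ x in boxSet η, offShell κ z ε φ x := by
  have hε' := eps_ne_zero hε
  have h01 := ne_of_injective hz (i := 0) (j := 1) (by decide)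
  have h02 := ne_of_injective hz (i := 0) (j := 2) (by decide)
  have hS : MeasurableSet {x | ∀ k, |totalMomentum z ε x k| < η / 2} := by
    rw [Set.ofPred_forall]
    exact MeasurableSet.iInter fun k => (isOpen_lt
      (continuous_totalMomentum z ε k).abs continuous_const).measurableSet
  have hg := isTest_momentumIntegrand κ hz hε hφ
  have ho := isTest_offShell κ hz hε' hφ
  have hdet : (energyMatrix z ε).det ≠ 0 := by
    rw [det_energyMatrix]
    exact mul_ne_zero (mul_ne_zero (hε' 0) (hε' 1)) h01
  have hdetabs : |(energyMatrix z ε).det| = |z 0 - z 1| := by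
    have habs : ∀ j, |ε j| = 1 := fun j => by rcases hε j with h | h <;> simp [h]
    simp [det_energyMatrix, abs_mul, habs]
  rw [← integral_indicator hS, ← integral_indicator (measurableSet_boxSet η),
    Measure.volume_eq_prod, integral_prod _ (hg.integrable.indicator hS),
    integral_prod _ (ho.integrable.indicator (measurableSet_boxSet η))]
  have hslice : ∀ t : Fin 4 → ℝ, ∫ y, Set.indicator
      {x | ∀ k, |totalMomentum z ε x k| < η / 2} (momentumIntegrand κ z ε φ) (t, y) =
      |z 0 - z 1| • ∫ v, if ((energyMatrix z ε).mulVec t, v) ∈ boxSet η then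
        offShellAt κ z ε φ t v else 0 := by
    intro t
    by_cases ht : ∀ j, 0 < t j
    · have hd : (coordMatrix z ε t).det ≠ 0 := by
        rw [det_coordMatrix]
        exact mul_ne_zero (mul_ne_zero (mul_ne_zero (mul_ne_zero (hε' 0) (hε' 2)) (ht 0).ne')
          (ht 2).ne') h02
      rw [integral_matrix _ hd (coords z ε t) (coords_mulVec hz hε' ht), ← integral_smul,
        ← integral_smul]
      congr 1
      funext v
      have hmem : (t, coords z ε t v) ∈ {x | ∀ k, |totalMomentum z ε x k| < η / 2} ↔
          ((energyMatrix z ε).mulVec t, v) ∈ boxSet η := by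
        rw [Set.mem_ofPred_eq, mem_boxSet_iff ht, mulVec_coords hz hε' ht]
      rw [Set.indicator_apply]
      simp only [hmem]
      split_ifs
      · rw [momentumIntegrand_eq κ hz hε φ ht, Complex.real_smul, Complex.real_smul, ← mul_assoc,
          ← Complex.ofReal_mul, offShellAt, abs_inv]
        congr 2
        field_simp
      · simp
    · have h0 : ∀ y, φ (t, y) = 0 := fun y => by
        by_contra h
        exact ht (hφ.mem h).1
      simp [Set.indicator_apply, momentumIntegrand, offShellAt, h0]
  simp_rw [hslice]
  rw [integral_matrix _ hdet (energies z ε) (energies_mulVec hz hε'), ← integral_smul]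
  congr 1
  funext w
  rw [smul_smul, abs_inv, hdetabs, inv_mul_cancel₀ (abs_ne_zero.2 h01), one_smul]
  congr 1
  funext v
  rw [mulVec_energies hz hε', Set.indicator_apply]
  rfl

/-- The box integrals are box integrals in momentum space of `P ↦ ∫ offShell` over the four free
variables. This is continuous since `offShell` is a test function, and its value at `P = 0` is the
shell integral. -/
theorem isDeltaIntegral_momentum (κ : ℝ) {z ε : Fin 4 → ℝ} (hz : Injective z)
    (hε : ∀ j, ε j = 1 ∨ ε j = -1) {φ : (Fin 4 → ℝ) × (Fin 4 → ℝ) → ℂ} (hφ : IsTest goodSet φ) :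
    IsDeltaIntegral (totalMomentum z ε) (momentumIntegrand κ z ε φ)
      (∫ q, shellIntegrand κ z ε φ q) := by
  have ho := isTest_offShell κ hz (eps_ne_zero hε) hφ
  let e : (Fin 2 × Fin 2 → ℝ) × (Fin 4 → ℝ) → (Fin 4 → ℝ) × (Fin 4 → ℝ) := fun x =>
    (![x.1 (0, 1), x.1 (1, 1), x.2 0, x.2 1], ![x.1 (0, 0), x.2 2, x.1 (1, 0), x.2 3])
  let r : (Fin 4 → ℝ) × (Fin 4 → ℝ) → (Fin 2 × Fin 2 → ℝ) × (Fin 4 → ℝ) := fun p =>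
    (fun k => !![p.2 0, p.1 0; p.2 2, p.1 1] k.1 k.2, ![p.1 2, p.1 3, p.2 1, p.2 3])
  have he : ContDiff ℝ (⊤ : ℕ∞) e := by
    refine ContDiff.prodMk ?_ ?_ <;>
    · rw [contDiff_pi]
      intro j
      fin_cases j <;> simp <;> fun_prop
  have hr : Continuous r := by
    refine Continuous.prodMk (continuous_pi fun k => ?_) (continuous_pi fun j => ?_)
    · obtain ⟨i, j⟩ := k
      fin_cases i <;> fin_cases j <;> simp <;> fun_prop
    · fin_cases j <;> simp <;> fun_prop
  have hre : ∀ x, r (e x) = x := by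
    intro x
    refine Prod.ext (funext fun k => ?_) (funext fun j => ?_)
    · obtain ⟨i, j⟩ := k
      fin_cases i <;> fin_cases j <;> simp [r, e]
    · fin_cases j <;> simp [r, e]
  have hoe : IsTest Set.univ fun x => offShell κ z ε φ (e x) :=
    ho.comp r hr.continuousOn (fun x _ => hre x) (fun _ _ => trivial) fun _ _ => he.contDiffAt
  have hcont := (hoe.integral (μ := volume)).continuous
  refine isDeltaIntegral_of_eventually hcont (Eventually.of_forall fun η => ?_)
  rw [setIntegral_momentumIntegrand κ hz hε hφ, ← integral_indicator (measurableSet_boxSet η),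
    integral_reindex]
  have hB : MeasurableSet {p : Fin 2 × Fin 2 → ℝ | ∀ k, |p k| < η / 2} := by
    rw [Set.ofPred_forall]
    exact MeasurableSet.iInter fun k => (isOpen_lt (by fun_prop) continuous_const).measurableSet
  have hind : ∀ x : (Fin 2 × Fin 2 → ℝ) × (Fin 4 → ℝ),
      (boxSet η).indicator (offShell κ z ε φ) (e x) =
      ({p : Fin 2 × Fin 2 → ℝ | ∀ k, |p k| < η / 2} ×ˢ Set.univ).indicator
        (fun x => offShell κ z ε φ (e x)) x := by
    intro x
    have : e x ∈ boxSet η ↔ x ∈ {p : Fin 2 × Fin 2 → ℝ | ∀ k, |p k| < η / 2} ×ˢ Set.univ := by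
      simp [boxSet, e, Fin.forall_fin_two]
      tauto
    classical
    simp only [Set.indicator_apply, this]
  refine (integral_congr_ae (Eventually.of_forall hind)).trans ?_
  rw [integral_indicator (hB.prod MeasurableSet.univ), Measure.volume_eq_prod,
    setIntegral_prod _ hoe.integrable.integrableOn]
  simp

/-! ### The recursion at three points -/

/-- `α₁ ω₁ / ω₄`. -/
def slope₁ (z ε : Fin 4 → ℝ) : ℝ := ε 3 * (z 2 - z 3) / (ε 0 * (z 2 - z 0))

/-- `α₃ ω₃ / ω₄`. -/
def slope₃ (z ε : Fin 4 → ℝ) : ℝ := ε 3 * (z 0 - z 3) / (ε 2 * (z 0 - z 2))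

theorem slope₁_ne_zero {z ε : Fin 4 → ℝ} (hz : Injective z) (hε : ∀ j, ε j ≠ 0) :
    slope₁ z ε ≠ 0 :=
  div_ne_zero (mul_ne_zero (hε 3) (ne_of_injective hz (by decide)))
    (mul_ne_zero (hε 0) (ne_of_injective hz (by decide)))

theorem slope₃_ne_zero {z ε : Fin 4 → ℝ} (hz : Injective z) (hε : ∀ j, ε j ≠ 0) :
    slope₃ z ε ≠ 0 :=
  div_ne_zero (mul_ne_zero (hε 3) (ne_of_injective hz (by decide)))
    (mul_ne_zero (hε 2) (ne_of_injective hz (by decide)))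

theorem alphaI_eq (z ε : Fin 4 → ℝ) (ω τ : ℝ) :
    alphaI (m := 1) z ε 0 ω τ = slope₁ z ε * ω / τ := by
  have : alphaI (m := 1) z ε 0 ω τ =
      ε 3 * ω * (z 2 - z 3) / (ε 0 * (z 2 - z 0)) / τ := rfl
  rw [this, slope₁]
  ring

theorem alphaN_eq (z ε : Fin 4 → ℝ) (ω τ : ℝ) :
    alphaN (m := 1) z ε 0 ω τ = slope₃ z ε * ω / τ := by
  have : alphaN (m := 1) z ε 0 ω τ =
      ε 3 * ω * (z 0 - z 3) / (ε 2 * (z 0 - z 2)) / τ := rfl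
  rw [this, slope₃]
  ring

/-- The energies before the boost. -/
def unshift (z ε p : Fin 4 → ℝ) (ω : ℝ) : Fin 4 → ℝ :=
  ![p 0 - slope₁ z ε * ω, p 1, p 2 - slope₃ z ε * ω, p 3]

/-- The coordinates `z̄` before the boost, if they are equal to `x` after it. -/
def boostCoords (α₁ α₃ x s : ℝ) : Fin 4 → ℝ :=
  ![(1 + α₁) * x - α₁ * s, x, (1 + α₃) * x - α₃ * s, s]

theorem unboost_const (α₁ α₃ x s : ℝ) :
    unboost (m := 1) 0 α₁ α₃ s (fun _ => x) = boostCoords α₁ α₃ x s := by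
  funext j
  fin_cases j <;> rfl

/-- The profile of the summand of the recursion, in the boosted energies `p` and in
`u = (ω, x, s)`, where `x` is the common value of `z̄₁, z̄₂, z̄₃` after the boost. -/
def boosted (z ε : Fin 4 → ℝ) (φ : (Fin 4 → ℝ) × (Fin 4 → ℝ) → ℂ)
    (P : (Fin 4 → ℝ) × (Fin 3 → ℝ)) : ℂ :=
  let t := unshift z ε P.1 (P.2 0)
  let α₁ := slope₁ z ε * P.2 0 / t 0
  let α₃ := slope₃ z ε * P.2 0 / t 2
  (((P.2 2 - P.2 1) * (1 + α₁) * (z 1 - z 0) / ((z 3 - z 0) * (z 1 - z 3)) / α₁ *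
    (1 + α₃) ^ 4 : ℝ) : ℂ) * φ (t, boostCoords α₁ α₃ (P.2 1) (P.2 2))

/-- Since `z̄₂ = x` is not moved, `z̄₁₄ / z̄₂₄ = 1 + α₁` and `z̄₃₄ / z̄₂₄ = 1 + α₃`, while `z̄₁₂ =
α₁ (x - s)`. So the region is exactly what makes the recursion regular. -/
theorem mem_region_boostCoords {α₁ α₃ x s : ℝ} (h : boostCoords α₁ α₃ x s ∈ region) :
    x - s ≠ 0 ∧ α₁ ≠ 0 ∧ 0 < 1 + α₁ ∧ 0 < 1 + α₃ := by
  obtain ⟨h1, h2, h3⟩ := h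
  simp only [boostCoords, Matrix.cons_val] at h1 h2 h3
  have hxs : x - s ≠ 0 := by
    intro h0
    rw [h0, div_zero] at h2
    exact lt_irrefl _ h2
  refine ⟨hxs, ?_, ?_, ?_⟩
  · rintro rfl
    apply h1
    ring
  · rwa [show (1 + α₁) * x - α₁ * s - s = (1 + α₁) * (x - s) by ring,
      mul_div_cancel_right₀ _ hxs] at h2
  · rwa [show (1 + α₃) * x - α₃ * s - s = (1 + α₃) * (x - s) by ring,
      mul_div_cancel_right₀ _ hxs] at h3

/-- Where `boosted` is smooth. -/
def boostedSet (z ε : Fin 4 → ℝ) : Set ((Fin 4 → ℝ) × (Fin 3 → ℝ)) :=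
  {P | (∀ j, 0 < P.1 j) ∧ P.2 0 ≠ 0 ∧ ∀ j, 0 < unshift z ε P.1 (P.2 0) j}

/-- The seven variables `(p, ω, x, s)` map into a hypersurface of the eight-dimensional space of
`(t, z̄)`. Both `t₁ z̄₁₂ = slope₁ ω z̄₂₄` and `t₃ z̄₃₂ = slope₃ ω z̄₂₄` determine `ω`; their
compatibility is the closed condition, and the first one gives the inverse map. -/
theorem isTest_boosted {z ε : Fin 4 → ℝ} (hz : Injective z) (hε : ∀ j, ε j ≠ 0)
    {φ : (Fin 4 → ℝ) × (Fin 4 → ℝ) → ℂ} (hφ : IsTest goodSet φ) :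
    IsTest (boostedSet z ε) (boosted z ε φ) := by
  have ha := slope₁_ne_zero hz hε
  have hb := slope₃_ne_zero hz hε
  set a := slope₁ z ε with ha'
  set b := slope₃ z ε with hb'
  have hT : ContDiff ℝ (⊤ : ℕ∞)
      fun P : (Fin 4 → ℝ) × (Fin 3 → ℝ) => unshift z ε P.1 (P.2 0) := by
    rw [contDiff_pi]
    intro j
    fin_cases j <;> simp [unshift] <;> fun_prop
  have hα₁ : ∀ P ∈ boostedSet z ε, ContDiffAt ℝ (⊤ : ℕ∞)
      (fun P : (Fin 4 → ℝ) × (Fin 3 → ℝ) => a * P.2 0 / unshift z ε P.1 (P.2 0) 0) P := by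
    rintro P ⟨_, _, hP⟩
    refine ContDiffAt.div (by fun_prop) ?_ (hP 0).ne'
    simp only [unshift, Matrix.cons_val]; fun_prop
  have hα₃ : ∀ P ∈ boostedSet z ε, ContDiffAt ℝ (⊤ : ℕ∞)
      (fun P : (Fin 4 → ℝ) × (Fin 3 → ℝ) => b * P.2 0 / unshift z ε P.1 (P.2 0) 2) P := by
    rintro P ⟨_, _, hP⟩
    refine ContDiffAt.div (by fun_prop) ?_ (hP 2).ne'
    simp only [unshift, Matrix.cons_val]; fun_prop
  refine hφ.mul_comp (m := fun P : (Fin 4 → ℝ) × (Fin 3 → ℝ) => (unshift z ε P.1 (P.2 0),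
      boostCoords (a * P.2 0 / unshift z ε P.1 (P.2 0) 0)
        (b * P.2 0 / unshift z ε P.1 (P.2 0) 2) (P.2 1) (P.2 2)))
    (fun y : (Fin 4 → ℝ) × (Fin 4 → ℝ) => (![y.1 0 + a * (y.1 0 * (y.2 0 - y.2 1) / (a * (y.2 1 - y.2 3))), y.1 1,
      y.1 2 + b * (y.1 0 * (y.2 0 - y.2 1) / (a * (y.2 1 - y.2 3))), y.1 3],
      ![y.1 0 * (y.2 0 - y.2 1) / (a * (y.2 1 - y.2 3)), y.2 1, y.2 3]))
    {y : (Fin 4 → ℝ) × (Fin 4 → ℝ) |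
      b * (y.1 0 * (y.2 0 - y.2 1)) = a * (y.1 2 * (y.2 2 - y.2 1))}
    (isClosed_eq (by fun_prop) (by fun_prop)) ?_ ?_ ?_ ?_ ?_ ?_
  · have h13 : ∀ y ∈ goodSet ∩ {y | b * (y.1 0 * (y.2 0 - y.2 1)) =
        a * (y.1 2 * (y.2 2 - y.2 1))}, a * (y.2 1 - y.2 3) ≠ 0 := by
      rintro y ⟨⟨_, _, h, _⟩, _⟩
      refine mul_ne_zero ha fun h0 => ?_
      rw [h0, div_zero] at h
      exact lt_irrefl _ h
    have hd : ContinuousOn (fun y : (Fin 4 → ℝ) × (Fin 4 → ℝ) =>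
        y.1 0 * (y.2 0 - y.2 1) / (a * (y.2 1 - y.2 3))) (goodSet ∩ {y |
        b * (y.1 0 * (y.2 0 - y.2 1)) = a * (y.1 2 * (y.2 2 - y.2 1))}) :=
      ContinuousOn.div (by fun_prop) (by fun_prop) h13
    refine ContinuousOn.prodMk (continuousOn_pi.2 fun j => ?_) (continuousOn_pi.2 fun j => ?_)
    · fin_cases j
      · exact ContinuousOn.add (by fun_prop) (continuousOn_const.mul hd)
      · simp; fun_prop
      · exact ContinuousOn.add (by fun_prop) (continuousOn_const.mul hd)
      · simp; fun_prop
    · fin_cases j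
      · exact hd
      · simp; fun_prop
      · simp; fun_prop
  · rintro P ⟨hP, hP2⟩
    have h0 := (hP 0).ne'
    have h2 := (hP 2).ne'
    simp only [Set.mem_ofPred_eq, boostCoords, Matrix.cons_val]
    simp only at h0 h2
    field_simp
    ring
  · rintro P ⟨hP, hP2⟩
    obtain ⟨hxs, _⟩ := mem_region_boostCoords hP2
    have h0 := (hP 0).ne'
    simp only at h0
    have key : unshift z ε P.1 (P.2 0) 0 *
        (boostCoords (a * P.2 0 / unshift z ε P.1 (P.2 0) 0)
        (b * P.2 0 / unshift z ε P.1 (P.2 0) 2) (P.2 1) (P.2 2) 0 - P.2 1) /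
        (a * (P.2 1 - P.2 2)) = P.2 0 := by
      simp only [boostCoords, Matrix.cons_val]
      field_simp
      ring
    refine Prod.ext (funext fun j => ?_) (funext fun j => ?_)
    · fin_cases j
      · change unshift z ε P.1 (P.2 0) 0 + a * _ = P.1 0
        erw [key]
        simp [unshift, ha']
      · rfl
      · change unshift z ε P.1 (P.2 0) 2 + b * _ = P.1 2
        erw [key]
        simp [unshift, hb']
      · rfl
    · fin_cases j
      · exact key
      · rfl
      · rfl
  · rintro ⟨t, y⟩ ⟨ht, hy1, hy2, hy3⟩ hC
    simp only [Set.mem_ofPred_eq] at hC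
    simp only at ht hy1 hy2 hy3
    have h13 : y 1 - y 3 ≠ 0 := by
      intro h0
      rw [h0, div_zero] at hy2
      exact lt_irrefl _ hy2
    -- The boosted energies are `t₁ z̄₁₄ / z̄₂₄` and `t₃ z̄₃₄ / z̄₂₄`, positive by the definition of
    -- the region; the second expression needs the compatibility condition `hC`.
    have e0 : t 0 + a * (t 0 * (y 0 - y 1) / (a * (y 1 - y 3))) =
        t 0 * ((y 0 - y 3) / (y 1 - y 3)) := by
      field_simp
      ring
    have e2 : t 2 + b * (t 0 * (y 0 - y 1) / (a * (y 1 - y 3))) =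
        t 2 * ((y 2 - y 3) / (y 1 - y 3)) := by
      field_simp
      linear_combination hC
    refine ⟨fun j => ?_, ?_, fun j => ?_⟩
    · fin_cases j
      · simp only [Fin.zero_eta, Matrix.cons_val, e0]
        exact mul_pos (ht 0) hy2
      · exact ht 1
      · simp only [Fin.reduceFinMk, Matrix.cons_val, e2]
        exact mul_pos (ht 2) hy3
      · exact ht 3
    · exact div_ne_zero (mul_ne_zero (ht 0).ne' hy1) (mul_ne_zero ha h13)
    · have : unshift z ε ![t 0 + a * (t 0 * (y 0 - y 1) / (a * (y 1 - y 3))), t 1,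
        t 2 + b * (t 0 * (y 0 - y 1) / (a * (y 1 - y 3))), t 3]
        (t 0 * (y 0 - y 1) / (a * (y 1 - y 3))) = t := by
        funext j
        fin_cases j <;> simp [unshift, ← ha', ← hb']
      simp only [Matrix.cons_val, this]
      exact ht j
  · intro P hP
    refine hT.contDiffAt.prodMk ?_
    have h1 := hα₁ P hP
    have h3 := hα₃ P hP
    rw [contDiffAt_pi]
    intro j
    fin_cases j
    · exact ((contDiffAt_const.add h1).mul (by fun_prop)).sub (h1.mul (by fun_prop))
    · simp [boostCoords]; fun_prop
    · exact ((contDiffAt_const.add h3).mul (by fun_prop)).sub (h3.mul (by fun_prop))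
    · simp [boostCoords]; fun_prop
  · intro P hP
    have h1 := hα₁ P hP
    have h3 := hα₃ P hP
    have hne : a * P.2 0 / unshift z ε P.1 (P.2 0) 0 ≠ 0 :=
      div_ne_zero (mul_ne_zero ha hP.2.1) (hP.2.2 0).ne'
    have h4 : ContDiffAt ℝ (⊤ : ℕ∞) (fun P : (Fin 4 → ℝ) × (Fin 3 → ℝ) => P.2 2 - P.2 1) P := by
      fun_prop
    exact ContDiffAt.comp (g := Complex.ofReal) P Complex.ofRealCLM.contDiff.contDiffAt
      (((((h4.mul (contDiffAt_const.add h1)).mul contDiffAt_const).div_const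
      ((z 3 - z 0) * (z 1 - z 3))).div h1 hne).mul ((contDiffAt_const.add h3).pow 4))

theorem contDiffAt_ofReal_cpow {t : ℝ} (ht : 0 < t) (w : ℂ) :
    ContDiffAt ℝ (⊤ : ℕ∞) (fun t : ℝ => (t : ℂ) ^ w) t := by
  have h : (fun t : ℝ => (t : ℂ) ^ w) =ᶠ[𝓝 t] fun t => Complex.exp (Real.log t * w) := by
    filter_upwards [lt_mem_nhds ht] with r hr using ofReal_cpow_eq_exp hr w
  refine ContDiffAt.congr_of_eventuallyEq ?_ h
  have h2 : ContDiffAt ℝ (⊤ : ℕ∞) (fun t : ℝ => (Real.log t : ℂ)) t :=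
    Complex.ofRealCLM.contDiff.contDiffAt.comp t (Real.contDiffAt_log.2 ht.ne')
  exact (h2.mul contDiffAt_const).cexp

-- Since `p₁ = t₁ (1 + α₁)` and `p₃ = t₃ (1 + α₃)`, the Mellin kernel in `p` absorbs `(1 +
-- α₁)^{-Δ₁-1}` and `(1 + α₃)^{-Δ₃-1}`. With `J₁ = -2` and the Jacobian nothing else is left over
-- for particle 1, apart from the factor in `z̄_{s1} = (s - x)(1 + α₁)`; with `J₃ = 2` a fourth
-- power of `1 + α₃` remains. The cutoff `α > -1` is automatic on the support of `φ`.
open scoped Classical in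
theorem boostTranspose_eq_boosted (z ε : Fin 4 → ℝ) {φ : (Fin 4 → ℝ) × (Fin 4 → ℝ) → ℂ}
    (hφ : IsTest goodSet φ) (p : Fin 4 → ℝ) (ω x s : ℝ) (Δ : Fin 3 → ℂ) (Δs : ℂ) :
    (if ∀ j, 0 < unshift z ε p ω j then
      (∏ j, ((unshift z ε p ω j : ℝ) : ℂ) ^
        (-(Fin.snoc (α := fun _ => ℂ) Δ Δs : Fin 4 → ℂ) j - 1)) *
      boostTranspose (m := 1) z ![-2, -2, 2] 0
        (alphaI (m := 1) z ε 0 ω (unshift z ε p ω (hard (m := 1) 0).castSucc))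
        (alphaN (m := 1) z ε 0 ω (unshift z ε p ω (lastHard 1).castSucc)) s
        (fun y => φ (unshift z ε p ω, y)) Δ (fun _ => x) else 0) =
    (∏ j, ((p j : ℝ) : ℂ) ^ (-(Fin.snoc (α := fun _ => ℂ) Δ Δs : Fin 4 → ℂ) j - 1)) *
      boosted z ε φ (p, ![ω, x, s]) := by
  rw [alphaI_eq, alphaN_eq]
  have e0 : (hard (m := 1) 0).castSucc = 0 := rfl
  have e2 : (lastHard 1).castSucc = 2 := rfl
  have eB : boosted z ε φ (p, ![ω, x, s]) =
    (((s - x) * (1 + slope₁ z ε * ω / unshift z ε p ω 0) * (z 1 - z 0) /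
      ((z 3 - z 0) * (z 1 - z 3)) / (slope₁ z ε * ω / unshift z ε p ω 0) *
    (1 + slope₃ z ε * ω / unshift z ε p ω 2) ^ 4 : ℝ) : ℂ) *
    φ (unshift z ε p ω, boostCoords (slope₁ z ε * ω / unshift z ε p ω 0)
      (slope₃ z ε * ω / unshift z ε p ω 2) x s) := rfl
  rw [e0, e2, eB, boostTranspose, unboost_const]
  set t := unshift z ε p ω with ht
  set α₁ := slope₁ z ε * ω / t 0 with hα₁
  set α₃ := slope₃ z ε * ω / t 2 with hα₃
  by_cases h : φ (t, boostCoords α₁ α₃ x s) = 0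
  · simp [h]
  obtain ⟨htp, hreg⟩ := hφ.mem h
  obtain ⟨hxs, hα0, h1, h3⟩ := mem_region_boostCoords hreg
  have htp' : ∀ j, 0 < t j := htp
  rw [if_pos htp', if_pos ⟨h1, h3⟩]
  have hp0 : p 0 = t 0 * (1 + α₁) := by
    have := (htp' 0).ne'
    rw [hα₁]
    field_simp
    simp [ht, unshift]
  have hp2 : p 2 = t 2 * (1 + α₃) := by
    have := (htp' 2).ne'
    rw [hα₃]
    field_simp
    simp [ht, unshift]
  have hp1 : p 1 = t 1 := rfl
  have hp3 : p 3 = t 3 := rfl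
  have hs0 : (Fin.snoc (α := fun _ => ℂ) Δ Δs : Fin 4 → ℂ) 0 = Δ 0 := rfl
  have hs1 : (Fin.snoc (α := fun _ => ℂ) Δ Δs : Fin 4 → ℂ) 1 = Δ 1 := rfl
  have hs2 : (Fin.snoc (α := fun _ => ℂ) Δ Δs : Fin 4 → ℂ) 2 = Δ 2 := rfl
  have hs3 : (Fin.snoc (α := fun _ => ℂ) Δ Δs : Fin 4 → ℂ) 3 = Δs := rfl
  have eh : hard (m := 1) 0 = 0 := rfl
  have el : lastHard 1 = 2 := rfl
  have ep : (prevHard 1).castSucc = 1 := rfl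
  have es : soft 1 = 3 := rfl
  have ec : ((0 : Fin (1 + 2)).castSucc : Fin 4) = 0 := rfl
  have eb0 : boostCoords α₁ α₃ x s 0 = (1 + α₁) * x - α₁ * s := rfl
  have eJ0 : (((![-2, -2, 2] : Fin 3 → ℝ) 0 : ℝ) : ℂ) = -2 := by simp
  have eJ2 : (((![-2, -2, 2] : Fin 3 → ℝ) 2 : ℝ) : ℂ) = 2 := by simp
  simp only [Fin.prod_univ_four, hs0, hs1, hs2, hs3, hp0, hp1, hp2, hp3, eh, el, ep, es, ec, eb0]
  rw [show (((![-2, -2, 2] : Fin (1 + 2) → ℝ) 0 : ℝ) : ℂ) = -2 from eJ0,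
    show (((![-2, -2, 2] : Fin (1 + 2) → ℝ) 2 : ℝ) : ℂ) = 2 from eJ2]
  rw [Complex.ofReal_mul (t 0), Complex.ofReal_mul (t 2),
    Complex.mul_cpow_ofReal_nonneg (htp' 0).le h1.le, Complex.mul_cpow_ofReal_nonneg (htp' 2).le h3.le]
  have c1 : ((1 + α₁ : ℝ) : ℂ) ≠ 0 := by exact_mod_cast h1.ne'
  have c3 : ((1 + α₃ : ℝ) : ℂ) ≠ 0 := by exact_mod_cast h3.ne'
  have f1 : ((1 + α₁ : ℝ) : ℂ) ^ (-(Δ 0 - -2)) * ((1 + α₁ : ℝ) : ℂ) =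
      ((1 + α₁ : ℝ) : ℂ) ^ (-Δ 0 - 1) := by
    rw [show -Δ 0 - 1 = -(Δ 0 - -2) + 1 by ring, Complex.cpow_add _ _ c1, Complex.cpow_one]
  have f3 : ((1 + α₃ : ℝ) : ℂ) ^ (-(Δ 2 - 2)) * ((1 + α₃ : ℝ) : ℂ) =
      ((1 + α₃ : ℝ) : ℂ) ^ (-Δ 2 - 1) * ((1 + α₃ : ℝ) : ℂ) ^ 4 := by
    rw [show -(Δ 2 - 2) = (-Δ 2 - 1) + (3 : ℕ) by push_cast; ring, Complex.cpow_add _ _ c3,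
      Complex.cpow_natCast]
    ring
  rw [← f1]
  have g1 : s - ((1 + α₁) * x - α₁ * s) = (s - x) * (1 + α₁) := by ring
  rw [g1, Complex.ofReal_mul _ ((1 + α₁) * (1 + α₃)), Complex.ofReal_mul (1 + α₁) (1 + α₃),
    Complex.ofReal_mul _ ((1 + α₃) ^ 4), Complex.ofReal_pow]
  linear_combination (((t 0 : ℝ) : ℂ) ^ (-Δ 0 - 1) * ((t 1 : ℝ) : ℂ) ^ (-Δ 1 - 1) *
    ((t 2 : ℝ) : ℂ) ^ (-Δ 2 - 1) * ((t 3 : ℝ) : ℂ) ^ (-Δs - 1) *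
    (((s - x) * (1 + α₁) * (z 1 - z 0) / ((z 3 - z 0) * (z 1 - z 3)) / α₁ : ℝ) : ℂ) *
    ((1 + α₁ : ℝ) : ℂ) ^ (-(Δ 0 - -2)) * ((1 + α₁ : ℝ) : ℂ) *
    φ (t, boostCoords α₁ α₃ x s)) * f3

theorem isTest_mellin_boosted {z ε : Fin 4 → ℝ} (hz : Injective z) (hε : ∀ j, ε j ≠ 0)
    {φ : (Fin 4 → ℝ) × (Fin 4 → ℝ) → ℂ} (hφ : IsTest goodSet φ) (ω x s : ℝ) (Δs : ℂ) :
    IsTest {P : (Fin 3 → ℝ) × ℝ | (∀ j, 0 < P.1 j) ∧ 0 < P.2} fun P =>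
      (P.2 : ℂ) ^ (-Δs - 1) *
        boosted z ε φ (Fin.snoc (α := fun _ => ℝ) P.1 P.2, ![ω, x, s]) := by
  refine (isTest_boosted hz hε hφ).mul_comp (m := fun P : (Fin 3 → ℝ) × ℝ =>
    ((Fin.snoc (α := fun _ => ℝ) P.1 P.2 : Fin 4 → ℝ), ![ω, x, s]))
    (fun P => (fun j => P.1 j.castSucc, P.1 3)) Set.univ isClosed_univ (by fun_prop)
    (fun _ _ => trivial) (fun P _ => ?_) (fun P hP _ => ?_) (fun P _ => ?_) (fun P hP => ?_)
  · refine Prod.ext (funext fun j => ?_) ?_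
    · simp
    · change (Fin.snoc (α := fun _ => ℝ) P.1 P.2 : Fin 4 → ℝ) (Fin.last 3) = P.2
      rw [Fin.snoc_last]
  · exact ⟨fun j => hP.1 _, hP.1 3⟩
  · refine ContDiffAt.prodMk ?_ contDiffAt_const
    rw [contDiffAt_pi]
    intro j
    refine Fin.lastCases ?_ (fun i => ?_) j
    · simp only [Fin.snoc_last]; fun_prop
    · simp only [Fin.snoc_castSucc]; fun_prop
  · exact (contDiffAt_ofReal_cpow hP.2 (-Δs - 1)).comp P contDiffAt_snd

/-- The summand of the recursion as a Mellin transform in the boosted energies. -/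
theorem summandTranspose_eq {z ε : Fin 4 → ℝ} (hz : Injective z) (hε : ∀ j, ε j ≠ 0)
    {φ : (Fin 4 → ℝ) × (Fin 4 → ℝ) → ℂ} (hφ : IsTest goodSet φ) (ω x s : ℝ) (Δ : Fin 3 → ℂ)
    (Δs : ℂ) :
    summandTranspose (m := 1) z ε ![-2, -2, 2] 0 ω Δs s φ Δ (fun _ => x) =
      ∫ p in {p : Fin 3 → ℝ | ∀ j, 0 < p j}, (∏ j, ((p j : ℝ) : ℂ) ^ (-Δ j - 1)) *
        ∫ t : ℝ, (t : ℂ) ^ (-Δs - 1) *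
          boosted z ε φ (Fin.snoc (α := fun _ => ℝ) p t, ![ω, x, s]) := by
  have hM := isTest_mellin_boosted hz hε hφ ω x s Δs
  have hmeas : MeasurableSet {t : Fin 4 → ℝ | ∀ j, 0 < t j} := by
    rw [Set.ofPred_forall]
    exact MeasurableSet.iInter fun j => (isOpen_lt continuous_const (by fun_prop)).measurableSet
  classical
  -- Passing from `t` to the boosted energies is a translation at fixed `ω`, hence without Jacobian;
  -- the domain `t > 0` moves into an indicator, which the support of `boosted` makes redundant.
  rw [summandTranspose, ← integral_indicator hmeas,
    ← integral_sub_right_eq_self _ (![slope₁ z ε * ω, 0, slope₃ z ε * ω, 0] : Fin 4 → ℝ)]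
  have hsub : ∀ p : Fin 4 → ℝ, p - (![slope₁ z ε * ω, 0, slope₃ z ε * ω, 0] : Fin 4 → ℝ) =
      unshift z ε p ω := by
    intro p
    funext j
    fin_cases j <;> simp [unshift]
  simp_rw [hsub, Set.indicator_apply]
  have hpt := fun p => boostTranspose_eq_boosted z ε hφ p ω x s Δ Δs
  simp only [Set.mem_ofPred_eq]
  refine (integral_congr_ae (Eventually.of_forall hpt)).trans ?_
  have hB : IsTest Set.univ fun p : Fin 4 → ℝ =>
      (∏ j, ((p j : ℝ) : ℂ) ^ (-(Fin.snoc (α := fun _ => ℂ) Δ Δs : Fin 4 → ℂ) j - 1)) *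
      boosted z ε φ (p, ![ω, x, s]) := by
    refine IsTest.mono (S := {p : Fin 4 → ℝ | ∀ j, 0 < p j}) ?_ (Set.subset_univ _)
    refine (isTest_boosted hz hε hφ).mul_comp' (m := fun p : Fin 4 → ℝ => (p, ![ω, x, s]))
      Prod.fst (by fun_prop) (fun _ _ => rfl) (fun P hP => hP.1)
      (fun _ _ => contDiffAt_id.prodMk contDiffAt_const) (fun p hp => ?_)
    refine contDiffAt_prod (𝕜 := ℝ) (𝔸' := ℂ) fun j _ => ?_
    exact ContDiffAt.comp (g := fun t : ℝ => (t : ℂ) ^ _) (f := fun p : Fin 4 → ℝ => p j) p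
      (contDiffAt_ofReal_cpow (hp j) _) (by fun_prop)
  rw [integral_snoc _ hB.integrable]
  have hM2 : IsTest Set.univ fun P : (Fin 3 → ℝ) × ℝ =>
      (∏ j, ((P.1 j : ℝ) : ℂ) ^ (-Δ j - 1)) * ((P.2 : ℂ) ^ (-Δs - 1) *
        boosted z ε φ (Fin.snoc (α := fun _ => ℝ) P.1 P.2, ![ω, x, s])) := by
    refine IsTest.mono (hM.mul_left fun P hP => ?_) (Set.subset_univ _)
    refine contDiffAt_prod (𝕜 := ℝ) (𝔸' := ℂ) fun j _ => ?_
    exact ContDiffAt.comp (g := fun t : ℝ => (t : ℂ) ^ _)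
      (f := fun P : (Fin 3 → ℝ) × ℝ => P.1 j) P (contDiffAt_ofReal_cpow (hP.1 j) _) (by fun_prop)
  rw [setIntegral_eq_integral_of_forall_compl_eq_zero]
  · simp_rw [← integral_const_mul]
    refine Eq.trans ?_ (integral_integral_swap
      (by exact hM2.integrable (μ := volume.prod volume))).symm
    congr 1
    funext a
    congr 1
    funext p
    rw [Fin.prod_univ_castSucc]
    simp only [Fin.snoc_castSucc, Fin.snoc_last]
    ring
  · intro p hp
    have : ∀ t : ℝ, (t : ℂ) ^ (-Δs - 1) *
          boosted z ε φ (Fin.snoc (α := fun _ => ℝ) p t, ![ω, x, s]) = 0 := by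
      intro t
      by_contra h
      exact hp (hM.mem (x := (p, t)) h).1
    simp [this]

/-- `ε₃ z₂₃ / (ε₁ z₁₂)`. -/
def base₁ (z ε : Fin 4 → ℝ) : ℝ := ε 2 * (z 1 - z 2) / (ε 0 * (z 0 - z 1))

/-- `ε₃ z₃₁ / (ε₂ z₁₂)`. -/
def base₂ (z ε : Fin 4 → ℝ) : ℝ := ε 2 * (z 2 - z 0) / (ε 1 * (z 0 - z 1))

/-- The vector `(base₁, base₂, 1)` solves three-particle energy conservation. Adding particle 4 and
undoing the boost preserves conservation, so the unboosted ray lands on the four-particle shell. -/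
theorem shellT_eq {z ε : Fin 4 → ℝ} (hz : Injective z) (hε : ∀ j, ε j ≠ 0) (r ω x s : ℝ) :
    shellT z ε ![r - slope₃ z ε * ω, ω, x, s] =
      unshift z ε ![base₁ z ε * r, base₂ z ε * r, r, ω] ω := by
  have h01 := ne_of_injective hz (i := 0) (j := 1) (by decide)
  have h10 := ne_of_injective hz (i := 1) (j := 0) (by decide)
  have h02 := ne_of_injective hz (i := 0) (j := 2) (by decide)
  have h20 := ne_of_injective hz (i := 2) (j := 0) (by decide)
  have e0 := hε 0
  have e1 := hε 1
  have e2 := hε 2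
  funext j
  fin_cases j
  · simp [shellT, energies, unshift, base₁, slope₁, slope₃]
    field_simp
    ring
  · simp [shellT, energies, unshift, base₂, slope₃]
    field_simp
    ring
  · simp [shellT, energies, unshift]
  · simp [shellT, energies, unshift]

/-- After the boost all `z̄` equal `x`, and the boost transfers the momentum of particle 4 to
particles 1 and 3. Momentum conservation therefore gives the same `z̄₁, z̄₃` as inverting the boost.
-/
theorem shellZ_eq {z ε : Fin 4 → ℝ} (hz : Injective z) (hε : ∀ j, ε j ≠ 0) (r ω x s : ℝ)
    {t : Fin 4 → ℝ} (ht : t = unshift z ε ![base₁ z ε * r, base₂ z ε * r, r, ω] ω)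
    (h0 : t 0 ≠ 0) (h2 : t 2 ≠ 0) :
    shellZ z ε ![r - slope₃ z ε * ω, ω, x, s] =
      boostCoords (slope₁ z ε * ω / t 0) (slope₃ z ε * ω / t 2) x s := by
  have h01 := ne_of_injective hz (i := 0) (j := 1) (by decide)
  have h10 := ne_of_injective hz (i := 1) (j := 0) (by decide)
  have h02 := ne_of_injective hz (i := 0) (j := 2) (by decide)
  have h20 := ne_of_injective hz (i := 2) (j := 0) (by decide)
  have e0 := hε 0
  have e1 := hε 1
  have e2 := hε 2
  have t0 : t 0 = base₁ z ε * r - slope₁ z ε * ω := by rw [ht]; rfl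
  have t1 : t 1 = base₂ z ε * r := by rw [ht]; rfl
  have t2 : t 2 = r - slope₃ z ε * ω := by rw [ht]; rfl
  have t3 : t 3 = ω := by rw [ht]; rfl
  rw [shellZ, shellT_eq hz hε, ← ht]
  funext j
  fin_cases j
  · simp [coords, boostCoords, t3, t1]
    have : (1 + slope₁ z ε * ω / t 0) = base₁ z ε * r / t 0 := by
      field_simp
      rw [t0]
      ring
    rw [this, div_eq_iff (by positivity)]
    field_simp
    simp only [base₁, base₂, slope₁]
    field_simp
    ring
  · rfl
  · simp [coords, boostCoords, t3, t1]
    have : (1 + slope₃ z ε * ω / t 2) = r / t 2 := by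
      field_simp
      rw [t2]
      ring
    rw [this, div_eq_iff (by positivity)]
    field_simp
    simp only [base₂, slope₃]
    field_simp
    ring
  · rfl

/-- The coefficient of the three-point amplitude. -/
def threePointCoeff (z : Fin 4 → ℝ) : ℝ :=
  Real.sign ((z 1 - z 2) * (z 2 - z 0)) * (z 0 - z 1) ^ 6 / ((z 1 - z 2) ^ 3 * (z 2 - z 0) ^ 3)

theorem sign_mul_abs {x : ℝ} : Real.sign x * |x| = x := by
  rcases lt_trichotomy x 0 with h | h | h
  · rw [Real.sign_of_neg h, abs_of_neg h]; ring
  · simp [h]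
  · rw [Real.sign_of_pos h, abs_of_pos h]; ring

/-- On the support the sign of `z₂₃` is that of `ε₁ ε₃ z₁₂`. So the sign in the three-point
amplitude supplies the absolute values `|z₁₂| |z₁₃|` of the momentum Jacobian. -/
theorem sign_eq_of_base₁_pos {z ε : Fin 4 → ℝ} (hz : Injective z)
    (hε : ∀ j, ε j = 1 ∨ ε j = -1) (hA : 0 < base₁ z ε) :
    Real.sign ((z 1 - z 2) * (z 2 - z 0)) =
      ε 0 * ε 2 * (z 0 - z 1) * (z 2 - z 0) / (|z 0 - z 1| * |z 0 - z 2|) := by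
  have h01 := ne_of_injective hz (i := 0) (j := 1) (by decide)
  have h02 := ne_of_injective hz (i := 0) (j := 2) (by decide)
  have h20 := ne_of_injective hz (i := 2) (j := 0) (by decide)
  have hs : Real.sign (z 1 - z 2) = ε 0 * ε 2 * Real.sign (z 0 - z 1) := by
    have h0 : base₁ z ε = ε 0 * ε 2 * ((z 1 - z 2) / (z 0 - z 1)) := by
      rw [base₁]
      rcases hε 0 with h | h <;> rw [h] <;> field_simp
    rw [h0] at hA
    have hd : (ε 0 * ε 2 = 1) ∨ (ε 0 * ε 2 = -1) := by
      rcases hε 0 with h | h <;> rcases hε 2 with h' | h' <;> simp [h, h']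
    rcases hd with h | h
    · rw [h, one_mul] at hA
      rw [h, one_mul]
      rcases div_pos_iff.1 hA with ⟨h1, h2⟩ | ⟨h1, h2⟩
      · rw [Real.sign_of_pos h1, Real.sign_of_pos h2]
      · rw [Real.sign_of_neg h1, Real.sign_of_neg h2]
    · rw [h, neg_one_mul, neg_pos] at hA
      rw [h, neg_one_mul]
      rcases div_neg_iff.1 hA with ⟨h1, h2⟩ | ⟨h1, h2⟩
      · rw [Real.sign_of_pos h1, Real.sign_of_neg h2, neg_neg]
      · rw [Real.sign_of_neg h1, Real.sign_of_pos h2]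
  have hmul : Real.sign ((z 1 - z 2) * (z 2 - z 0)) =
      Real.sign (z 1 - z 2) * Real.sign (z 2 - z 0) := by
    have h12 := abs_ne_zero.2 (ne_of_injective hz (i := 1) (j := 2) (by decide))
    have h20' := abs_ne_zero.2 h20
    have h1 := sign_mul_abs (x := (z 1 - z 2) * (z 2 - z 0))
    rw [abs_mul] at h1
    refine mul_right_cancel₀ (mul_ne_zero h12 h20') ?_
    linear_combination h1 - (Real.sign (z 1 - z 2) * |z 1 - z 2|) *
      sign_mul_abs (x := z 2 - z 0) - (z 2 - z 0) * sign_mul_abs (x := z 1 - z 2)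
  rw [hmul, hs, eq_div_iff (mul_ne_zero (abs_ne_zero.2 h01) (abs_ne_zero.2 h02)),
    abs_sub_comm (z 0) (z 2)]
  linear_combination (ε 0 * ε 2 * Real.sign (z 2 - z 0) * |z 2 - z 0|) *
    sign_mul_abs (x := z 0 - z 1) + (ε 0 * ε 2 * (z 0 - z 1)) * sign_mul_abs (x := z 2 - z 0)

/-- The recursion coefficient agrees with the density on the momentum shell. -/
theorem boosted_eq_shellIntegrand (κ : ℝ) {z ε : Fin 4 → ℝ} (hz : Injective z)
    (hε : ∀ j, ε j = 1 ∨ ε j = -1) (hA : 0 < base₁ z ε)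
    {φ : (Fin 4 → ℝ) × (Fin 4 → ℝ) → ℂ} (hφ : IsTest goodSet φ) (r ω x s : ℝ) (hω : 0 < ω) :
    (((2 * π) ^ 4 * (κ / 2) * (threePointCoeff z * (base₁ z ε * base₂ z ε)) *
      (ω⁻¹ * (r ^ 3)⁻¹) : ℝ) : ℂ) *
      boosted z ε φ (![base₁ z ε * r, base₂ z ε * r, r, ω], ![ω, x, s]) =
    shellIntegrand κ z ε φ ![r - slope₃ z ε * ω, ω, x, s] := by
  have hε' := eps_ne_zero hε
  rw [shellIntegrand, shellT_eq hz hε']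
  obtain ⟨t, ht⟩ : ∃ t, t = unshift z ε ![base₁ z ε * r, base₂ z ε * r, r, ω] ω := ⟨_, rfl⟩
  have eB : boosted z ε φ (![base₁ z ε * r, base₂ z ε * r, r, ω], ![ω, x, s]) =
    (((s - x) * (1 + slope₁ z ε * ω / t 0) * (z 1 - z 0) /
      ((z 3 - z 0) * (z 1 - z 3)) / (slope₁ z ε * ω / t 0) *
    (1 + slope₃ z ε * ω / t 2) ^ 4 : ℝ) : ℂ) *
    φ (t, boostCoords (slope₁ z ε * ω / t 0) (slope₃ z ε * ω / t 2) x s) := by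
    rw [ht]; rfl
  rw [eB, ← ht]
  by_cases h0 : ∀ j, 0 < t j
  swap
  · have : ∀ y, φ (t, y) = 0 := fun y => by
      by_contra h
      exact h0 (hφ.mem h).1
    simp [this]
  have p0 := (h0 0).ne'
  have p1 := (h0 1).ne'
  have p2 := (h0 2).ne'
  rw [shellZ_eq hz hε' r ω x s ht p0 p2]
  by_cases hf : φ (t, boostCoords (slope₁ z ε * ω / t 0) (slope₃ z ε * ω / t 2) x s) = 0
  · simp [hf]
  obtain ⟨hxs, hα0, h1, h3⟩ := mem_region_boostCoords (hφ.mem hf).2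
  rw [← mul_assoc, ← Complex.ofReal_mul]
  congr 2
  have t0 : t 0 = base₁ z ε * r - slope₁ z ε * ω := by rw [ht]; rfl
  have t1 : t 1 = base₂ z ε * r := by rw [ht]; rfl
  have t2 : t 2 = r - slope₃ z ε * ω := by rw [ht]; rfl
  have t3 : t 3 = ω := by rw [ht]; rfl
  have e1 : 1 + slope₁ z ε * ω / t 0 = base₁ z ε * r / t 0 := by
    field_simp
    rw [t0]
    ring
  have e3 : 1 + slope₃ z ε * ω / t 2 = r / t 2 := by
    field_simp
    rw [t2]
    ring
  have y01 : boostCoords (slope₁ z ε * ω / t 0) (slope₃ z ε * ω / t 2) x s 0 -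
      boostCoords (slope₁ z ε * ω / t 0) (slope₃ z ε * ω / t 2) x s 1 =
      slope₁ z ε * ω / t 0 * (x - s) := by
    simp [boostCoords]
    ring
  rw [e1, e3, density, y01, t1, t3, threePointCoeff, sign_eq_of_base₁_pos hz hε hA]
  have ha := slope₁_ne_zero hz hε'
  have hr : r ≠ 0 := by
    rintro rfl
    rw [mul_zero] at t1
    exact p1 t1
  have h01 := ne_of_injective hz (i := 0) (j := 1) (by decide)
  have h02 := ne_of_injective hz (i := 0) (j := 2) (by decide)
  have h20 := ne_of_injective hz (i := 2) (j := 0) (by decide)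
  have h03 := ne_of_injective hz (i := 0) (j := 3) (by decide)
  have h30 := ne_of_injective hz (i := 3) (j := 0) (by decide)
  have h12 := ne_of_injective hz (i := 1) (j := 2) (by decide)
  have h13 := ne_of_injective hz (i := 1) (j := 3) (by decide)
  have h23 := ne_of_injective hz (i := 2) (j := 3) (by decide)
  have a01 := abs_ne_zero.2 h01
  have a02 := abs_ne_zero.2 h02
  have q0 := hε' 0
  have q1 := hε' 1
  have q2 := hε' 2
  have q3 := hε' 3
  have hA2 : base₁ z ε ^ 2 * (z 0 - z 1) ^ 2 = (z 1 - z 2) ^ 2 := by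
    rw [base₁]
    field_simp
    rw [eps_sq hε, eps_sq hε]
  have hB1 : base₂ z ε = ε 1 * ε 2 * (z 2 - z 0) / (z 0 - z 1) := by
    rw [base₂]
    field_simp
    rw [eps_sq hε]
  have ha2 : slope₁ z ε ^ 2 * (z 2 - z 0) ^ 2 = (z 2 - z 3) ^ 2 := by
    rw [slope₁]
    field_simp
    rw [eps_sq hε, eps_sq hε]
  -- The squares of `base₁` and `slope₁` contain no signs. Writing the quotient as a multiple of
  -- `slope₁` matches the linear factor `z̄₁₂ = α₁ (x - s)` of `density`, to be compared with the
  -- `α₁⁻¹` of the recursion.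
  have key : base₁ z ε ^ 2 / slope₁ z ε = slope₁ z ε * ((z 1 - z 2) ^ 2 * (z 2 - z 0) ^ 2 /
      ((z 0 - z 1) ^ 2 * (z 2 - z 3) ^ 2)) := by
    rw [← hA2, ← ha2]
    field_simp
  have hsplit : (2 * π) ^ 4 * (κ / 2) *
      (ε 0 * ε 2 * (z 0 - z 1) * (z 2 - z 0) / (|z 0 - z 1| * |z 0 - z 2|) * (z 0 - z 1) ^ 6 /
        ((z 1 - z 2) ^ 3 * (z 2 - z 0) ^ 3) * (base₁ z ε * base₂ z ε)) * (ω⁻¹ * (r ^ 3)⁻¹) *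
      ((s - x) * (base₁ z ε * r / t 0) * (z 1 - z 0) / ((z 3 - z 0) * (z 1 - z 3)) /
        (slope₁ z ε * ω / t 0) * (r / t 2) ^ 4) =
      (base₁ z ε ^ 2 / slope₁ z ε) * ((2 * π) ^ 4 * (κ / 2) *
      (ε 0 * ε 2 * (z 0 - z 1) * (z 2 - z 0) / (|z 0 - z 1| * |z 0 - z 2|) * (z 0 - z 1) ^ 6 /
        ((z 1 - z 2) ^ 3 * (z 2 - z 0) ^ 3) * base₂ z ε) *
      ((s - x) * (z 1 - z 0) / ((z 3 - z 0) * (z 1 - z 3)) * (r ^ 2 / (ω ^ 2 * t 2 ^ 4)))) := by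
    field_simp
  rw [hsplit, key, hB1]
  have hneg1 : z 3 - z 0 = -(z 0 - z 3) := by ring
  have hneg2 : z 2 - z 0 = -(z 0 - z 2) := by ring
  have hneg3 : z 1 - z 0 = -(z 0 - z 1) := by ring
  have hneg4 : s - x = -(x - s) := by ring
  rw [hneg1, hneg2, hneg3, hneg4]
  field_simp
  rw [eps_sq hε, mul_one]

/-! ### Mellin inversion in the recursion -/

/-- A cut through the complement of the support does not spoil smoothness. It is applied to `ω > 0`,
as `boosted` is supported away from `ω = 0`. -/
theorem IsTest.indicator {E : Type*} [NormedAddCommGroup E] [NormedSpace ℝ E] {S U V : Set E}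
    {f : E → ℂ} (hf : IsTest S f) (hU : IsOpen U) (hV : IsOpen V) (hUV : Disjoint U V)
    (hS : S ⊆ U ∪ V) : IsTest (S ∩ U) (U.indicator f) := by
  classical
  obtain ⟨hfc, K, hK, hKS, h0⟩ := hf
  refine IsTest.of_contDiffAt (K := K \ V) (hK.diff hV) ?_ ?_ ?_
  · rintro x ⟨hx, hxV⟩
    exact ⟨hKS hx, (hS (hKS hx)).resolve_right hxV⟩
  · rintro x ⟨hx, hxV⟩
    have hxU : x ∈ U := (hS (hKS hx)).resolve_right hxV
    refine hfc.contDiffAt.congr_of_eventuallyEq ?_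
    filter_upwards [hU.mem_nhds hxU] with y hy
    rw [Set.indicator_of_mem hy]
  · intro x hx
    by_cases hxU : x ∈ U
    · rw [Set.indicator_of_mem hxU]
      exact h0 x fun h => hx ⟨h, fun hV' => Set.disjoint_left.1 hUV hxU hV'⟩
    · rw [Set.indicator_of_notMem hxU]

/-- `boosted` for `ω > 0`, in the coordinates `(ω₄, ω; x, r)` after Mellin inversion. -/
def reduced (z ε : Fin 4 → ℝ) (φ : (Fin 4 → ℝ) × (Fin 4 → ℝ) → ℂ) (s : ℝ)
    (P : (Fin 2 → ℝ) × (Fin 2 → ℝ)) : ℂ :=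
  (((P.2 1 ^ 3)⁻¹ : ℝ) : ℂ) *
    {Q : (Fin 4 → ℝ) × (Fin 3 → ℝ) | 0 < Q.2 0}.indicator (boosted z ε φ)
    (![base₁ z ε * P.2 1, base₂ z ε * P.2 1, P.2 1, P.1 0], ![P.1 1, P.2 0, s])

theorem isTest_reduced {z ε : Fin 4 → ℝ} (hz : Injective z) (hε : ∀ j, ε j ≠ 0)
    {φ : (Fin 4 → ℝ) × (Fin 4 → ℝ) → ℂ} (hφ : IsTest goodSet φ) (s : ℝ) :
    IsTest {P : (Fin 2 → ℝ) × (Fin 2 → ℝ) | (∀ j, 0 < P.1 j) ∧ 0 < P.2 1}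
      (reduced z ε φ s) := by
  have hB := (isTest_boosted hz hε hφ).indicator
    (U := {Q : (Fin 4 → ℝ) × (Fin 3 → ℝ) | 0 < Q.2 0})
    (V := {Q : (Fin 4 → ℝ) × (Fin 3 → ℝ) | Q.2 0 < 0})
    (isOpen_lt continuous_const (by fun_prop)) (isOpen_lt (by fun_prop) continuous_const)
    (Set.disjoint_left.2 fun Q h1 h2 => lt_asymm (show 0 < Q.2 0 from h1) h2)
    (fun Q hQ => (lt_or_gt_of_ne hQ.2.1).symm)
  refine hB.mul_comp' (m := fun P : (Fin 2 → ℝ) × (Fin 2 → ℝ) =>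
    ((![base₁ z ε * P.2 1, base₂ z ε * P.2 1, P.2 1, P.1 0] : Fin 4 → ℝ),
      (![P.1 1, P.2 0, s] : Fin 3 → ℝ)))
    (fun Q => (![Q.1 3, Q.2 0], ![Q.2 1, Q.1 2])) ?_ ?_ ?_ ?_ ?_
  · refine Continuous.continuousOn (Continuous.prodMk (continuous_pi fun j => ?_)
      (continuous_pi fun j => ?_)) <;> fin_cases j <;> simp <;> fun_prop
  · intro P _
    refine Prod.ext (funext fun j => ?_) (funext fun j => ?_) <;> fin_cases j <;> rfl
  · rintro Q ⟨⟨h1, h2, h3⟩, h4⟩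
    refine ⟨fun j => ?_, h1 2⟩
    fin_cases j
    · exact h1 3
    · exact h4
  · intro P _
    refine ContDiff.contDiffAt (ContDiff.prodMk ?_ ?_) <;>
    · rw [contDiff_pi]
      intro j
      fin_cases j <;> simp <;> fun_prop
  · rintro P ⟨_, hP⟩
    have h1 : ContDiffAt ℝ (⊤ : ℕ∞) (fun P : (Fin 2 → ℝ) × (Fin 2 → ℝ) => (P.2 1 ^ 3)⁻¹) P :=
      ContDiffAt.inv (by fun_prop) (pow_ne_zero 3 hP.ne')
    exact ContDiffAt.comp (g := Complex.ofReal) P Complex.ofRealCLM.contDiff.contDiffAt h1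

theorem isTest_integral_reduced {z ε : Fin 4 → ℝ} (hz : Injective z) (hε : ∀ j, ε j ≠ 0)
    {φ : (Fin 4 → ℝ) × (Fin 4 → ℝ) → ℂ} (hφ : IsTest goodSet φ) (s : ℝ) :
    IsTest {u : Fin 2 → ℝ | ∀ j, 0 < u j} fun u => ∫ v : Fin 2 → ℝ, reduced z ε φ s (u, v) := by
  refine ((isTest_reduced hz hε hφ s).integral (μ := volume)).mono ?_
  rintro _ ⟨P, hP, rfl⟩
  exact hP.1

/-- The three-point powers are `ρ^Δ` for `ρ = (base₁, base₂, 1)`, up to the constant `base₁ base₂`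
from the exponents `Δ + 1`. Mellin inversion thus restricts the boosted energies to a ray, with
parameter `r` the energy of particle 3. -/
theorem threePoint_summandTranspose {z ε : Fin 4 → ℝ} (hz : Injective z) (hε : ∀ j, ε j ≠ 0)
    (hA : 0 < base₁ z ε) (hB : 0 < base₂ z ε) (d : Fin 2 → ℝ)
    {φ : (Fin 4 → ℝ) × (Fin 4 → ℝ) → ℂ} (hφ : IsTest goodSet φ) (ω s : ℝ) (hω : 0 < ω) (Δs : ℂ) :
    threePoint (z ∘ Fin.castSucc) (ε ∘ Fin.castSucc) d
      (summandTranspose (m := 1) z ε ![-2, -2, 2] 0 ω Δs s φ) =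
    ((threePointCoeff z * (base₁ z ε * base₂ z ε) * (2 * π) ^ 3 : ℝ) : ℂ) *
      ∫ t : ℝ, (t : ℂ) ^ (-Δs - 1) * ∫ v : Fin 2 → ℝ, reduced z ε φ s (![t, ω], v) := by
  have hdelta : ∀ x : ℝ, (deltaSum d fun Δ => ((base₁ z ε : ℝ) : ℂ) ^ (Δ 0 + 1) *
      ((base₂ z ε : ℝ) : ℂ) ^ (Δ 1 + 1) *
      summandTranspose (m := 1) z ε ![-2, -2, 2] 0 ω Δs s φ Δ fun _ => x) =
      ((base₁ z ε * base₂ z ε * (2 * π) ^ 3 : ℝ) : ℂ) * ∫ r : ℝ, ∫ t : ℝ,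
        (t : ℂ) ^ (-Δs - 1) * reduced z ε φ s (![t, ω], ![x, r]) := by
    intro x
    have hψ : IsTest {p : Fin 3 → ℝ | ∀ j, 0 < p j} fun p => ((base₁ z ε * base₂ z ε : ℝ) : ℂ) *
        ∫ t : ℝ, (t : ℂ) ^ (-Δs - 1) *
          boosted z ε φ (Fin.snoc (α := fun _ => ℝ) p t, ![ω, x, s]) := by
      refine (((isTest_mellin_boosted hz hε hφ ω x s Δs).integral (μ := volume)).mono
        ?_).mul_left fun _ _ => contDiffAt_const
      rintro _ ⟨P, hP, rfl⟩
      exact hP.1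
    have hmel := deltaSum_mellin d ![base₁ z ε, base₂ z ε, 1]
      (by intro j; fin_cases j <;> simp [hA, hB]) hψ
    have hF : (fun Δ : Fin 3 → ℂ => ((base₁ z ε : ℝ) : ℂ) ^ (Δ 0 + 1) *
      ((base₂ z ε : ℝ) : ℂ) ^ (Δ 1 + 1) *
      summandTranspose (m := 1) z ε ![-2, -2, 2] 0 ω Δs s φ Δ fun _ => x) = fun Δ =>
      (∏ j, (((![base₁ z ε, base₂ z ε, 1] : Fin 3 → ℝ) j : ℝ) : ℂ) ^ Δ j) *
      ∫ t in {t : Fin 3 → ℝ | ∀ j, 0 < t j}, (∏ j, ((t j : ℝ) : ℂ) ^ (-Δ j - 1)) *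
        (((base₁ z ε * base₂ z ε : ℝ) : ℂ) * ∫ a : ℝ, (a : ℂ) ^ (-Δs - 1) *
          boosted z ε φ (Fin.snoc (α := fun _ => ℝ) t a, ![ω, x, s])) := by
      funext Δ
      rw [summandTranspose_eq hz hε hφ]
      have h1 : ((base₁ z ε : ℝ) : ℂ) ≠ 0 := by exact_mod_cast hA.ne'
      have h2 : ((base₂ z ε : ℝ) : ℂ) ≠ 0 := by exact_mod_cast hB.ne'
      rw [Complex.cpow_add _ _ h1, Complex.cpow_add _ _ h2, Complex.cpow_one, Complex.cpow_one,
        ← integral_const_mul, ← integral_const_mul]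
      congr 1
      funext p
      simp only [Fin.prod_univ_three, Matrix.cons_val, Complex.ofReal_one, Complex.one_cpow]
      push_cast
      ring
    rw [hF, hmel]
    rw [setIntegral_eq_integral_of_forall_compl_eq_zero, ← integral_const_mul,
      ← integral_const_mul]
    · congr 1
      funext r
      have harg : ∀ t : ℝ, (Fin.snoc (α := fun _ => ℝ)
          (fun j : Fin 3 => (![base₁ z ε, base₂ z ε, 1] : Fin 3 → ℝ) j * r) t : Fin 4 → ℝ) =
          ![base₁ z ε * r, base₂ z ε * r, r, t] := by
        intro t
        funext j
        refine Fin.lastCases ?_ (fun i => ?_) j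
        · rw [Fin.snoc_last]; rfl
        · rw [Fin.snoc_castSucc]
          fin_cases i <;> simp
      have hred : ∀ t : ℝ, reduced z ε φ s (![t, ω], ![x, r]) = (((r ^ 3)⁻¹ : ℝ) : ℂ) *
          boosted z ε φ (![base₁ z ε * r, base₂ z ε * r, r, t], ![ω, x, s]) := by
        intro t
        simp only [reduced, Matrix.cons_val]
        rw [Set.indicator_of_mem (by simpa using hω)]
      simp_rw [harg, hred]
      rw [← mul_assoc, ← mul_assoc, ← integral_const_mul, ← integral_const_mul]
      congr 1
      funext t
      push_cast
      ring
    · intro r hr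
      have : ∀ t : ℝ, boosted z ε φ (Fin.snoc (α := fun _ => ℝ)
          (fun j : Fin 3 => (![base₁ z ε, base₂ z ε, 1] : Fin 3 → ℝ) j * r) t, ![ω, x, s]) = 0 := by
        intro t
        by_contra h
        have h2 : 0 < 1 * r := ((isTest_boosted hz hε hφ).mem h).1 2
        rw [one_mul] at h2
        exact hr h2
      simp [this]
  have hf : IsTest Set.univ fun Q : (Fin 2 → ℝ) × ℝ =>
      (Q.2 : ℂ) ^ (-Δs - 1) * reduced z ε φ s (![Q.2, ω], Q.1) := by
    refine IsTest.mono (S := {Q : (Fin 2 → ℝ) × ℝ | 0 < Q.2}) ?_ (Set.subset_univ _)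
    refine (isTest_reduced hz hε hφ s).mul_comp' (m := fun Q : (Fin 2 → ℝ) × ℝ =>
      ((![Q.2, ω] : Fin 2 → ℝ), Q.1)) (fun P => (P.2, P.1 0)) (by fun_prop) (fun _ _ => rfl)
      (fun P hP => hP.1 0) (fun Q _ => ?_) (fun Q hQ => ?_)
    · refine ContDiff.contDiffAt (ContDiff.prodMk ?_ contDiff_fst)
      rw [contDiff_pi]
      intro j
      fin_cases j <;> simp <;> fun_prop
    · exact (contDiffAt_ofReal_cpow hQ _).comp Q contDiffAt_snd
  have hthree : threePoint (z ∘ Fin.castSucc) (ε ∘ Fin.castSucc) d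
      (summandTranspose (m := 1) z ε ![-2, -2, 2] 0 ω Δs s φ) = ((threePointCoeff z : ℝ) : ℂ) *
      ∫ x : ℝ, deltaSum d fun Δ => ((base₁ z ε : ℝ) : ℂ) ^ (Δ 0 + 1) *
      ((base₂ z ε : ℝ) : ℂ) ^ (Δ 1 + 1) *
      summandTranspose (m := 1) z ε ![-2, -2, 2] 0 ω Δs s φ Δ fun _ => x := by
    rw [threePoint]
    exact if_pos ⟨hA, hB⟩
  rw [hthree]
  simp_rw [hdelta]
  rw [integral_const_mul, ← mul_assoc, ← Complex.ofReal_mul]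
  congr 1
  · congr 1
    ring
  · simp_rw [← integral_const_mul]
    rw [← (hf.integral (μ := volume)).integral_fin_two]
    exact integral_integral_swap (by exact hf.integrable (μ := volume.prod volume))

/-- Mellin inversion in the energy of the soft particle. -/
theorem integral_integral_cpow (c : ℝ) {Ψ : (Fin 2 → ℝ) → ℂ}
    (hΨ : IsTest {u : Fin 2 → ℝ | ∀ j, 0 < u j} Ψ) :
    ∫ l : ℝ, ∫ ω in Set.Ioi (0 : ℝ), (ω : ℂ) ^ (((c : ℂ) + Complex.I * (l : ℂ)) - 1) *
      ∫ t : ℝ, (t : ℂ) ^ (-((c : ℂ) + Complex.I * (l : ℂ)) - 1) * Ψ ![t, ω] =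
    (2 * π : ℝ) * ∫ r in Set.Ioi (0 : ℝ), ((r⁻¹ : ℝ) : ℂ) * Ψ ![r, r] := by
  -- The pair of weights `(Δ, 2 - Δ)` sums to `2`, so two-particle inversion applies. The second
  -- kernel is `u₁^{Δ-3}`; the factor `u₁²` corrects it to the wanted `ω^{Δ-1}`, and later changes
  -- `r⁻³` into `r⁻¹`.
  have hψ : IsTest {u : Fin 2 → ℝ | ∀ j, 0 < u j} fun u => ((u 1 ^ 2 : ℝ) : ℂ) * Ψ u := by
    refine hΨ.mul_left fun u _ => ?_
    have h : ContDiff ℝ (⊤ : ℕ∞) fun u : Fin 2 → ℝ => u 1 ^ 2 := by fun_prop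
    exact (Complex.ofRealCLM.contDiff.comp h).contDiffAt
  have hmel := deltaSum_mellin ![c] ![1, 1] (by intro j; fin_cases j <;> simp) hψ
  rw [deltaSum, integral_fin_one, pow_two, mul_assoc] at hmel
  have h2 := mul_left_cancel₀ (by
    rw [Complex.ofReal_ne_zero]
    positivity) hmel
  have hR : ∫ r in Set.Ioi (0 : ℝ), (((r ^ 3)⁻¹ : ℝ) : ℂ) *
      (((((fun j : Fin 2 => (![1, 1] : Fin 2 → ℝ) j * r) 1) ^ 2 : ℝ) : ℂ) *
        Ψ fun j : Fin 2 => (![1, 1] : Fin 2 → ℝ) j * r) =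
      ∫ r in Set.Ioi (0 : ℝ), ((r⁻¹ : ℝ) : ℂ) * Ψ ![r, r] := by
    refine setIntegral_congr_fun measurableSet_Ioi fun r hr => ?_
    have hr' : r ≠ 0 := ne_of_gt hr
    have : (fun j : Fin 2 => (![1, 1] : Fin 2 → ℝ) j * r) = ![r, r] := by
      funext j
      fin_cases j <;> simp
    simp only [this]
    rw [← mul_assoc, ← Complex.ofReal_mul]
    congr 2
    simp
    field_simp
  refine Eq.trans ?_ (h2.trans (congrArg _ hR))
  congr 1
  funext l
  set Δ : ℂ := (c : ℂ) + Complex.I * (l : ℂ) with hΔ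
  have hpos : ∀ u : Fin 2 → ℝ, u ∉ {u : Fin 2 → ℝ | ∀ j, 0 < u j} → Ψ u = 0 := fun u hu => by
    by_contra h
    exact hu (hΨ.mem h)
  have hG : IsTest {u : Fin 2 → ℝ | ∀ j, 0 < u j} fun u =>
      ((u 0 : ℂ) ^ (-Δ - 1) * (u 1 : ℂ) ^ (Δ - 1)) * Ψ u := by
    refine hΨ.mul_left fun u hu => ContDiffAt.mul ?_ ?_
    · exact ContDiffAt.comp (g := fun t : ℝ => (t : ℂ) ^ _) (f := fun p : Fin 2 → ℝ => p 0) u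
        (contDiffAt_ofReal_cpow (hu 0) _) (by fun_prop)
    · exact ContDiffAt.comp (g := fun t : ℝ => (t : ℂ) ^ _) (f := fun p : Fin 2 → ℝ => p 1) u
        (contDiffAt_ofReal_cpow (hu 1) _) (by fun_prop)
  have hL : ∫ ω in Set.Ioi (0 : ℝ), (ω : ℂ) ^ (Δ - 1) *
      ∫ t : ℝ, (t : ℂ) ^ (-Δ - 1) * Ψ ![t, ω] = ∫ u : Fin 2 → ℝ,
        ((u 0 : ℂ) ^ (-Δ - 1) * (u 1 : ℂ) ^ (Δ - 1)) * Ψ u := by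
    have hG2 : IsTest Set.univ fun Q : ℝ × ℝ =>
        ((Q.1 : ℂ) ^ (-Δ - 1) * (Q.2 : ℂ) ^ (Δ - 1)) * Ψ ![Q.1, Q.2] := by
      refine hG.comp (m := fun Q : ℝ × ℝ => ![Q.1, Q.2]) (fun u => (u 0, u 1)) (by fun_prop)
        (fun _ _ => rfl) (fun _ _ => trivial) (fun Q _ => ?_)
      rw [contDiffAt_pi]
      intro j
      fin_cases j <;> simp <;> fun_prop
    rw [hG.integral_fin_two]
    simp only [Matrix.cons_val_zero, Matrix.cons_val_one]
    rw [integral_integral_swap (by exact hG2.integrable (μ := volume.prod volume)),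
      setIntegral_eq_integral_of_forall_compl_eq_zero]
    · congr 1
      funext ω
      rw [← integral_const_mul]
      congr 1
      funext t
      ring
    · intro ω hω
      have : ∀ t, Ψ ![t, ω] = 0 := fun t => hpos _ fun h => hω (by simpa using h 1)
      simp [this]
  rw [hL, setIntegral_eq_integral_of_forall_compl_eq_zero]
  · rw [← integral_const_mul]
    congr 1
    funext u
    by_cases hu : u ∈ {u : Fin 2 → ℝ | ∀ j, 0 < u j}
    · have hu1 : ((u 1 : ℝ) : ℂ) ≠ 0 := by exact_mod_cast (hu 1).ne'
      have s0 : (Fin.snoc (α := fun _ => ℂ) (fun j : Fin 1 => ((![c] j : ℝ) : ℂ) +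
          Complex.I * ((![l] j : ℝ) : ℂ)) (2 - ∑ j : Fin 1, (((![c] j : ℝ) : ℂ) +
          Complex.I * ((![l] j : ℝ) : ℂ))) : Fin 2 → ℂ) 0 = Δ := rfl
      have s1 : (Fin.snoc (α := fun _ => ℂ) (fun j : Fin 1 => ((![c] j : ℝ) : ℂ) +
          Complex.I * ((![l] j : ℝ) : ℂ)) (2 - ∑ j : Fin 1, (((![c] j : ℝ) : ℂ) +
          Complex.I * ((![l] j : ℝ) : ℂ))) : Fin 2 → ℂ) 1 = 2 - Δ := by
        change 2 - ∑ j : Fin 1, (((![c] j : ℝ) : ℂ) + Complex.I * ((![l] j : ℝ) : ℂ)) = _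
        simp [hΔ]
      have hp : ∀ f : Fin (1 + 1) → ℂ, ∏ j, f j = f 0 * f 1 := Fin.prod_univ_two
      simp only [hp]
      erw [s0, s1]
      simp only [Matrix.cons_val_zero, Matrix.cons_val_one,
        Complex.ofReal_one, Complex.one_cpow, one_mul]
      have h3 : ((u 1 : ℝ) : ℂ) ^ (Δ - 1) =
          ((u 1 : ℝ) : ℂ) ^ (-(2 - Δ) - 1) * ((u 1 ^ 2 : ℝ) : ℂ) := by
        rw [show Δ - 1 = (-(2 - Δ) - 1) + (2 : ℕ) by push_cast; ring, Complex.cpow_add _ _ hu1,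
          Complex.cpow_natCast, Complex.ofReal_pow]
      rw [h3]
      ring
    · simp [hpos u hu]
  · intro u hu
    simp [hpos u hu]

/-- On the shell `base₁ r`, `base₂ r` and `r` are the boosted energies, all positive in the region.
Hence the shell integral vanishes whenever the three-point amplitude does. -/
theorem base_pos_of_shellIntegrand_ne_zero {κ : ℝ} {z ε : Fin 4 → ℝ} (hz : Injective z)
    (hε : ∀ j, ε j ≠ 0) {φ : (Fin 4 → ℝ) × (Fin 4 → ℝ) → ℂ} (hφ : IsTest goodSet φ)
    {q : Fin 4 → ℝ} (hq : shellIntegrand κ z ε φ q ≠ 0) : 0 < base₁ z ε ∧ 0 < base₂ z ε := by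
  obtain ⟨r, ω, x, s, rfl⟩ : ∃ r ω x s, q = ![r - slope₃ z ε * ω, ω, x, s] := by
    refine ⟨q 0 + slope₃ z ε * q 1, q 1, q 2, q 3, ?_⟩
    funext j
    fin_cases j <;> simp
  obtain ⟨t, ht⟩ : ∃ t, t = unshift z ε ![base₁ z ε * r, base₂ z ε * r, r, ω] ω := ⟨_, rfl⟩
  rw [shellIntegrand, shellT_eq hz hε, ← ht] at hq
  obtain ⟨h0, hreg⟩ := hφ.mem (right_ne_zero_of_mul hq)
  have h0' : ∀ j, 0 < t j := h0
  have hreg' : shellZ z ε ![r - slope₃ z ε * ω, ω, x, s] ∈ region := hreg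
  rw [shellZ_eq hz hε r ω x s ht (h0' 0).ne' (h0' 2).ne'] at hreg'
  obtain ⟨_, _, h1, h3⟩ := mem_region_boostCoords hreg'
  have t0 : t 0 = base₁ z ε * r - slope₁ z ε * ω := by rw [ht]; rfl
  have t1 : t 1 = base₂ z ε * r := by rw [ht]; rfl
  have t2 : t 2 = r - slope₃ z ε * ω := by rw [ht]; rfl
  have e1 : t 0 * (1 + slope₁ z ε * ω / t 0) = base₁ z ε * r := by
    have := (h0' 0).ne'
    field_simp
    rw [t0]
    ring
  have e3 : t 2 * (1 + slope₃ z ε * ω / t 2) = r := by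
    have := (h0' 2).ne'
    field_simp
    rw [t2]
    ring
  have hr : 0 < r := e3 ▸ mul_pos (h0' 2) h3
  exact ⟨pos_of_mul_pos_left (e1 ▸ mul_pos (h0' 0) h1) hr.le,
    pos_of_mul_pos_left (t1 ▸ h0' 1) hr.le⟩

/-- The order of integration of the recursion. -/
theorem IsTest.integral_fin_four' {S : Set (Fin 4 → ℝ)} {G : (Fin 4 → ℝ) → ℂ}
    (hG : IsTest S G) (e : Fin 4 ≃ Fin 4) :
    ∫ q, G q = ∫ a : ℝ, ∫ b : ℝ, ∫ c : ℝ, ∫ d : ℝ,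
      G (fun j => (![a, b, c, d] : Fin 4 → ℝ) (e j)) := by
  rw [integral_comp_equiv e]
  have : IsTest Set.univ fun s : Fin 4 → ℝ => G fun j => s (e j) := by
    refine hG.comp (fun y j => y (e.symm j)) (by fun_prop) (fun x _ => by simp)
      (fun _ _ => trivial) (fun _ _ => ContDiff.contDiffAt (by fun_prop))
  rw [this.integral_fin_four]

/-- The three-point inversion gives `(2π)³` and the soft inversion a further `2π`, together the
Parseval factor of `density`. The remaining variables `(s, ω, x, r)` are shell coordinates up to the
shift `ω₃ = r - slope₃ ω`. -/
theorem recursion_eq_integral (κ : ℝ) {z ε : Fin 4 → ℝ} (hz : Injective z)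
    (hε : ∀ j, ε j = 1 ∨ ε j = -1) {φ : (Fin 4 → ℝ) × (Fin 4 → ℝ) → ℂ} (hφ : IsTest goodSet φ)
    (d : Fin 2 → ℝ) (c₄ : ℝ) :
    recursion (m := 1) κ z ε ![-2, -2, 2] c₄
      (threePoint (z ∘ Fin.castSucc) (ε ∘ Fin.castSucc) d) φ =
    ∫ q, shellIntegrand κ z ε φ q := by
  have hε' := eps_ne_zero hε
  have hS := isTest_shellIntegrand κ hz hε' hφ
  by_cases hAB : 0 < base₁ z ε ∧ 0 < base₂ z ε
  swap
  · have h0 : ∀ Φ, threePoint (z ∘ Fin.castSucc) (ε ∘ Fin.castSucc) d Φ = 0 := by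
      intro Φ
      rw [threePoint]
      exact if_neg hAB
    have h1 : ∀ q, shellIntegrand κ z ε φ q = 0 := by
      intro q
      by_contra h
      exact hAB (base_pos_of_shellIntegrand_ne_zero hz hε' hφ h)
    simp [recursion, h0, h1]
  obtain ⟨hA, hB⟩ := hAB
  -- The shell integral is put in the order of the recursion, from outside to inside `z̄₄, ω₄, z̄₂,
  -- ω₃`.
  let e : Fin 4 ≃ Fin 4 := ⟨![3, 1, 2, 0], ![3, 1, 2, 0], by decide, by decide⟩
  have harg : ∀ a b c d : ℝ, (fun j => (![a, b, c, d] : Fin 4 → ℝ) (e j)) = ![d, b, c, a] := by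
    intro a b c d
    funext j
    fin_cases j <;> rfl
  rw [hS.integral_fin_four' e]
  simp_rw [harg]
  unfold recursion
  rw [Fin.sum_univ_one, ← integral_const_mul]
  congr 1
  funext s
  have hred := isTest_integral_reduced hz hε' hφ s
  have hinner : ∀ l : ℝ, ∫ ω in Set.Ioi (0 : ℝ), (ω : ℂ) ^ (((c₄ : ℂ) + Complex.I * (l : ℂ)) - 1) *
      threePoint (z ∘ Fin.castSucc) (ε ∘ Fin.castSucc) d
        (summandTranspose (m := 1) z ε ![-2, -2, 2] 0 ω ((c₄ : ℂ) + Complex.I * (l : ℂ)) s φ) =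
      ((threePointCoeff z * (base₁ z ε * base₂ z ε) * (2 * π) ^ 3 : ℝ) : ℂ) *
      ∫ ω in Set.Ioi (0 : ℝ), (ω : ℂ) ^ (((c₄ : ℂ) + Complex.I * (l : ℂ)) - 1) *
      ∫ t : ℝ, (t : ℂ) ^ (-((c₄ : ℂ) + Complex.I * (l : ℂ)) - 1) *
        ∫ v : Fin 2 → ℝ, reduced z ε φ s (![t, ω], v) := by
    intro l
    rw [← integral_const_mul]
    refine setIntegral_congr_fun measurableSet_Ioi fun ω hω => ?_
    rw [threePoint_summandTranspose hz hε' hA hB d hφ ω s hω]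
    ring
  refine (congrArg (fun X => ((κ / 2 : ℝ) : ℂ) * X)
    (integral_congr_ae (Eventually.of_forall hinner))).trans ?_
  rw [integral_const_mul, integral_integral_cpow c₄ hred, ← mul_assoc, ← mul_assoc,
    ← Complex.ofReal_mul, ← Complex.ofReal_mul, ← integral_const_mul,
    setIntegral_eq_integral_of_forall_compl_eq_zero]
  swap
  · intro ω hω
    have : (∫ v : Fin 2 → ℝ, reduced z ε φ s (![ω, ω], v)) = 0 := by
      by_contra h
      exact hω (by simpa using hred.mem (x := ![ω, ω]) h 0)
    simp [this]
  congr 1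
  funext ω
  have hslice : IsTest Set.univ fun v : Fin 2 → ℝ => reduced z ε φ s (![ω, ω], v) :=
    (isTest_reduced hz hε' hφ s).comp (m := fun v : Fin 2 → ℝ => ((![ω, ω] : Fin 2 → ℝ), v))
      Prod.snd (by fun_prop) (fun _ _ => rfl) (fun _ _ => trivial)
      (fun _ _ => contDiffAt_const.prodMk contDiffAt_id)
  rw [hslice.integral_fin_two, ← integral_const_mul, ← integral_const_mul]
  congr 1
  funext x
  rw [← integral_const_mul, ← integral_const_mul,
    ← integral_sub_right_eq_self (fun t => shellIntegrand κ z ε φ ![t, ω, x, s])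
      (slope₃ z ε * ω)]
  congr 1
  funext r
  by_cases hω : 0 < ω
  · rw [← boosted_eq_shellIntegrand κ hz hε hA hφ r ω x s hω]
    simp only [reduced, Matrix.cons_val]
    rw [Set.indicator_of_mem (by simpa using hω)]
    rw [← mul_assoc, ← mul_assoc, ← Complex.ofReal_mul, ← Complex.ofReal_mul]
    congr 2
    ring
  · have h1 : shellIntegrand κ z ε φ ![r - slope₃ z ε * ω, ω, x, s] = 0 := by
      by_contra h
      have : 0 < ω := hS.mem h 3
      exact hω this
    rw [h1]
    simp only [reduced, Matrix.cons_val]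
    rw [Set.indicator_of_notMem (by simpa using hω)]
    simp

/-! ### The four-point formula -/

theorem region_ne {y : Fin 4 → ℝ} (hy : y ∈ region) :
    y 0 - y 1 ≠ 0 ∧ y 0 - y 3 ≠ 0 ∧ y 1 - y 3 ≠ 0 ∧ y 2 - y 3 ≠ 0 := by
  obtain ⟨h1, h2, h3⟩ := hy
  refine ⟨h1, ?_, ?_, ?_⟩
  · intro h; simp [h] at h2
  · intro h; simp [h] at h2
  · intro h; simp [h] at h3

/-- The product of the two terms of `cross`. -/
def crossProd (z y : Fin 4 → ℝ) : ℝ :=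
  ((z 0 - z 1) * (z 2 - z 3) * (y 0 - y 2) * (y 1 - y 3)) *
    ((z 0 - z 2) * (z 1 - z 3) * (y 0 - y 1) * (y 2 - y 3))

/-- On `cross = 0` the two terms coincide, so their product is the square of the second, which is
nonzero in the region. -/
theorem crossProd_pos {z y : Fin 4 → ℝ} (hz : Injective z) (hy : y ∈ region)
    (h : cross z y = 0) : 0 < crossProd z y := by
  obtain ⟨h1, h2, h3, h4⟩ := region_ne hy
  have hV : (z 0 - z 2) * (z 1 - z 3) * (y 0 - y 1) * (y 2 - y 3) ≠ 0 :=
    mul_ne_zero (mul_ne_zero (mul_ne_zero (ne_of_injective hz (by decide))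
      (ne_of_injective hz (by decide))) h1) h4
  rw [crossProd, sub_eq_zero.1 h]
  exact mul_self_pos.2 hV

/-- Modulo factors that are positive in the region, `ratio₁` and `ratio₂` are `base₁` and `base₂`,
and `ratio₄` is `base₁` times the third support quantity times the quotient of the two terms of
`cross`. Only the positivity of that quotient is used, an open condition, so the equivalence
persists near the zero set. -/
theorem inSupport_iff {z ε y : Fin 4 → ℝ} (hz : Injective z) (hε : ∀ j, ε j ≠ 0)
    (hy : y ∈ region) (h : 0 < crossProd z y) :
    InSupport z ε y ↔ 0 < ratio₁ z ε y ∧ 0 < ratio₂ z ε y ∧ 0 < ratio₄ z ε y := by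
  obtain ⟨h1, h2, h3, h4⟩ := region_ne hy
  obtain ⟨_, p1, p2⟩ := hy
  have h01 := ne_of_injective hz (i := 0) (j := 1) (by decide)
  have h02 := ne_of_injective hz (i := 0) (j := 2) (by decide)
  have h20 := ne_of_injective hz (i := 2) (j := 0) (by decide)
  have h31 := ne_of_injective hz (i := 3) (j := 1) (by decide)
  have h13 := ne_of_injective hz (i := 1) (j := 3) (by decide)
  have h23 := ne_of_injective hz (i := 2) (j := 3) (by decide)
  have h31' : y 3 - y 1 ≠ 0 := by rw [← neg_sub]; exact neg_ne_zero.2 h3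
  have e0 := hε 0
  have e1 := hε 1
  have e2 := hε 2
  have e3 := hε 3
  have r1 : ratio₁ z ε y = base₁ z ε * ((y 2 - y 3) / (y 1 - y 3) / ((y 0 - y 3) / (y 1 - y 3))) := by
    rw [ratio₁, base₁]
    field_simp
  have r2 : ratio₂ z ε y = base₂ z ε * ((y 2 - y 3) / (y 1 - y 3)) := by
    rw [ratio₂, base₂]
    field_simp
    ring
  have q1 : 0 < ratio₁ z ε y ↔ 0 < base₁ z ε := by
    rw [r1]
    exact mul_pos_iff_of_pos_right (div_pos p2 p1)
  have q2 : 0 < ratio₂ z ε y ↔ 0 < base₂ z ε := by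
    rw [r2]
    exact mul_pos_iff_of_pos_right p2
  have hc : crossProd z y ≠ 0 := h.ne'
  have h02' : y 0 - y 2 ≠ 0 := by
    intro h0
    apply hc
    rw [crossProd, h0]
    ring
  have r4 : ratio₄ z ε y = base₁ z ε * ((y 0 - y 1) * ε 0 * (z 2 - z 0) /
      ((y 1 - y 3) * ε 3 * (z 2 - z 3))) * ((y 2 - y 3) / (y 1 - y 3) / ((y 0 - y 3) / (y 1 - y 3)) *
      (crossProd z y / ((z 0 - z 2) * (z 1 - z 3) * (y 0 - y 1) * (y 2 - y 3)) ^ 2)) := by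
    rw [ratio₄, base₁, crossProd]
    field_simp
    ring
  have hpos : 0 < (y 2 - y 3) / (y 1 - y 3) / ((y 0 - y 3) / (y 1 - y 3)) *
      (crossProd z y / ((z 0 - z 2) * (z 1 - z 3) * (y 0 - y 1) * (y 2 - y 3)) ^ 2) := by
    have : (z 0 - z 2) * (z 1 - z 3) * (y 0 - y 1) * (y 2 - y 3) ≠ 0 :=
      mul_ne_zero (mul_ne_zero (mul_ne_zero h02 h13) h1) h4
    have := pow_pos (sq_pos_of_ne_zero this) 1
    rw [pow_one] at this
    exact mul_pos (div_pos p2 p1) (div_pos h this)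
  have q4 : 0 < ratio₄ z ε y ↔ 0 < base₁ z ε * ((y 0 - y 1) * ε 0 * (z 2 - z 0) /
      ((y 1 - y 3) * ε 3 * (z 2 - z 3))) := by
    rw [r4]
    exact mul_pos_iff_of_pos_right hpos
  rw [q1, q2, q4]
  change (0 < base₁ z ε ∧ 0 < base₂ z ε ∧ _) ↔ _
  constructor
  · rintro ⟨a, b, c⟩
    exact ⟨a, b, mul_pos a c⟩
  · rintro ⟨a, b, c⟩
    exact ⟨a, b, (mul_pos_iff_of_pos_left a).1 c⟩

/-- The coefficient of the four-point amplitude. -/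
def fourPointCoeff (κ : ℝ) (z ε y : Fin 4 → ℝ) : ℝ :=
  -(κ / 2) * (ε 0 * ε 1) * ((z 0 - z 1) ^ 7 * (y 0 - y 1) /
    ((z 1 - z 2) * (z 3 - z 0) * (z 3 - z 1) * (z 2 - z 0) * (z 2 - z 3) ^ 2))

/-- The directions of the energies. -/
def ratios (z ε y : Fin 4 → ℝ) : Fin 4 → ℝ := ![ratio₁ z ε y, ratio₂ z ε y, 1, ratio₄ z ε y]

/-- The four-point amplitude after Mellin inversion, before the integral over the energy `τ` of
the particle 3. -/
def rayIntegrand (κ : ℝ) (z ε : Fin 4 → ℝ) (φ : (Fin 4 → ℝ) × (Fin 4 → ℝ) → ℂ)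
    (P : (Fin 4 → ℝ) × ℝ) : ℂ :=
  (((2 * π) ^ 4 * fourPointCoeff κ z ε P.1 *
    (ratio₁ z ε P.1 ^ 2 * ratio₂ z ε P.1 ^ 2 / ratio₄ z ε P.1 ^ 3) / P.2 ^ 3 : ℝ) : ℂ) *
    φ (fun j => ratios z ε P.1 j * P.2, P.1)

/-- The third direction is `1`, so `τ` is recovered as the energy of particle 3. The closed
condition is the equation `t₄ = ratio₄ τ` cleared of denominators; with `t₄ > 0` it excludes `z̄₁₃ =
0`, where `ratio₄` vanishes and the inverse power is singular. -/
theorem isTest_rayIntegrand (κ : ℝ) {z ε : Fin 4 → ℝ} (hz : Injective z) (hε : ∀ j, ε j ≠ 0)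
    {φ : (Fin 4 → ℝ) × (Fin 4 → ℝ) → ℂ} (hφ : IsTest goodSet φ) :
    IsTest {P : (Fin 4 → ℝ) × ℝ | P.1 ∈ region ∧ P.1 0 - P.1 2 ≠ 0 ∧ 0 < P.2}
      (rayIntegrand κ z ε φ) := by
  have h01 := ne_of_injective hz (i := 0) (j := 1) (by decide)
  have h12 := ne_of_injective hz (i := 1) (j := 2) (by decide)
  have h31 := ne_of_injective hz (i := 3) (j := 1) (by decide)
  have d1 : ∀ P ∈ {P : (Fin 4 → ℝ) × ℝ | P.1 ∈ region ∧ P.1 0 - P.1 2 ≠ 0 ∧ 0 < P.2},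
      ContDiffAt ℝ (⊤ : ℕ∞) (fun P : (Fin 4 → ℝ) × ℝ => ratio₁ z ε P.1) P := by
    intro P hP
    refine contDiffAt_const.mul (ContDiffAt.div (by fun_prop) (by fun_prop) ?_)
    exact mul_ne_zero h01 (region_ne hP.1).2.1
  have d2 : ∀ P ∈ {P : (Fin 4 → ℝ) × ℝ | P.1 ∈ region ∧ P.1 0 - P.1 2 ≠ 0 ∧ 0 < P.2},
      ContDiffAt ℝ (⊤ : ℕ∞) (fun P : (Fin 4 → ℝ) × ℝ => ratio₂ z ε P.1) P := by
    intro P hP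
    refine contDiffAt_const.mul (ContDiffAt.div (by fun_prop) (by fun_prop) ?_)
    refine mul_ne_zero h01 ?_
    rw [← neg_sub]
    exact neg_ne_zero.2 (region_ne hP.1).2.2.1
  have d4 : ∀ P ∈ {P : (Fin 4 → ℝ) × ℝ | P.1 ∈ region ∧ P.1 0 - P.1 2 ≠ 0 ∧ 0 < P.2},
      ContDiffAt ℝ (⊤ : ℕ∞) (fun P : (Fin 4 → ℝ) × ℝ => ratio₄ z ε P.1) P := by
    intro P hP
    refine contDiffAt_const.mul (ContDiffAt.div (by fun_prop) (by fun_prop) ?_)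
    exact mul_ne_zero h31 (region_ne hP.1).2.1
  refine hφ.mul_comp (m := fun P : (Fin 4 → ℝ) × ℝ =>
      ((fun j => ratios z ε P.1 j * P.2 : Fin 4 → ℝ), P.1)) (fun p => (p.2, p.1 2))
    {p | p.1 3 * (ε 3 * ((z 3 - z 1) * (p.2 0 - p.2 3))) =
      ε 2 * ((z 1 - z 2) * (p.2 0 - p.2 2)) * p.1 2}
    (isClosed_eq (by fun_prop) (by fun_prop)) (by fun_prop) ?_ ?_ ?_ ?_ ?_
  · rintro P ⟨_, hP⟩
    have h3 := (region_ne hP).2.1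
    have e3 := hε 3
    simp only at h3
    simp only [Set.mem_ofPred_eq, ratios, Matrix.cons_val, ratio₄]
    field_simp
  · rintro P _
    simp [ratios]
  · rintro ⟨t, y⟩ ⟨ht, hy⟩ hC
    refine ⟨hy, ?_, ht 2⟩
    intro h0
    simp only [Set.mem_ofPred_eq] at hC
    simp only at h0
    rw [h0, mul_zero, mul_zero, zero_mul] at hC
    exact mul_ne_zero (ht 3).ne' (mul_ne_zero (hε 3) (mul_ne_zero h31 (region_ne hy).2.1)) hC
  · intro P hP
    refine ContDiffAt.prodMk ?_ contDiffAt_fst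
    rw [contDiffAt_pi]
    intro j
    fin_cases j
    · exact (d1 P hP).mul contDiffAt_snd
    · exact (d2 P hP).mul contDiffAt_snd
    · exact contDiffAt_const.mul contDiffAt_snd
    · exact (d4 P hP).mul contDiffAt_snd
  · intro P hP
    have hc : ContDiffAt ℝ (⊤ : ℕ∞) (fun P : (Fin 4 → ℝ) × ℝ => fourPointCoeff κ z ε P.1) P := by
      simp only [fourPointCoeff]
      fun_prop
    have hne : ratio₄ z ε P.1 ≠ 0 := mul_ne_zero (div_ne_zero (hε 2) (hε 3))
      (div_ne_zero (mul_ne_zero h12 hP.2.1) (mul_ne_zero h31 (region_ne hP.1).2.1))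
    exact ContDiffAt.comp (g := Complex.ofReal) P Complex.ofRealCLM.contDiff.contDiffAt
      (((contDiffAt_const.mul hc).mul ((((d1 P hP).pow 2).mul ((d2 P hP).pow 2)).div
        ((d4 P hP).pow 3) (pow_ne_zero 3 hne))).div (contDiffAt_snd.pow 3)
          (pow_ne_zero 3 hP.2.2.ne'))

theorem fourPoint_of_forall_eq_zero (κ : ℝ) (z ε : Fin 4 → ℝ) (c : Fin 3 → ℝ)
    {φ : (Fin 4 → ℝ) × (Fin 4 → ℝ) → ℂ} {y : Fin 4 → ℝ} (h : ∀ t, φ (t, y) = 0) :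
    fourPoint κ z ε c φ y = ∫ τ : ℝ, rayIntegrand κ z ε φ (y, τ) := by
  have h1 : ∀ Δ, mellinTest φ Δ y = 0 := fun Δ => by simp [mellinTest, h]
  simp [fourPoint, rayIntegrand, h, h1, deltaSum]

theorem fourPoint_eq_integral (κ : ℝ) {z ε : Fin 4 → ℝ} (hz : Injective z) (hε : ∀ j, ε j ≠ 0)
    (c : Fin 3 → ℝ) {φ : (Fin 4 → ℝ) × (Fin 4 → ℝ) → ℂ} (hφ : IsTest goodSet φ) {y : Fin 4 → ℝ}
    (hy : y ∈ region) (hcp : 0 < crossProd z y) :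
    fourPoint κ z ε c φ y = ∫ τ : ℝ, rayIntegrand κ z ε φ (y, τ) := by
  have hiff := inSupport_iff hz hε hy hcp
  have hN := isTest_rayIntegrand κ hz hε hφ
  by_cases hs : InSupport z ε y
  · obtain ⟨p1, p2, p4⟩ := hiff.1 hs
    have hψ : IsTest {t : Fin 4 → ℝ | ∀ j, 0 < t j} fun t =>
        ((ratio₁ z ε y ^ 2 * ratio₂ z ε y ^ 2 / ratio₄ z ε y ^ 3 : ℝ) : ℂ) * φ (t, y) :=
      hφ.mul_comp' Prod.fst (by fun_prop) (fun _ _ => rfl) (fun P hP => hP.1)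
        (fun _ _ => contDiffAt_id.prodMk contDiffAt_const) (fun _ _ => contDiffAt_const)
    have hmel := deltaSum_mellin c (ratios z ε y)
      (by intro j; fin_cases j <;> simp [ratios, p1, p2, p4]) hψ
    have hF : (fun Δ : Fin 4 → ℂ => (ratio₁ z ε y : ℂ) ^ (Δ 0 + 2) *
        (ratio₂ z ε y : ℂ) ^ (Δ 1 + 2) * (ratio₄ z ε y : ℂ) ^ (Δ 3 - 3) * mellinTest φ Δ y) =
        fun Δ => (∏ j, ((ratios z ε y j : ℝ) : ℂ) ^ Δ j) *
          ∫ t in {t : Fin 4 → ℝ | ∀ j, 0 < t j}, (∏ j, ((t j : ℝ) : ℂ) ^ (-Δ j - 1)) *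
          (((ratio₁ z ε y ^ 2 * ratio₂ z ε y ^ 2 / ratio₄ z ε y ^ 3 : ℝ) : ℂ) * φ (t, y)) := by
      funext Δ
      have c1 : ((ratio₁ z ε y : ℝ) : ℂ) ≠ 0 := by exact_mod_cast p1.ne'
      have c2 : ((ratio₂ z ε y : ℝ) : ℂ) ≠ 0 := by exact_mod_cast p2.ne'
      have c4 : ((ratio₄ z ε y : ℝ) : ℂ) ≠ 0 := by exact_mod_cast p4.ne'
      have t2 : (2 : ℂ) = (2 : ℕ) := by norm_num
      have t3 : (3 : ℂ) = (3 : ℕ) := by norm_num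
      rw [mellinTest, t2, t3, Complex.cpow_add _ _ c1, Complex.cpow_add _ _ c2,
        Complex.cpow_sub _ _ c4, Complex.cpow_natCast, Complex.cpow_natCast, Complex.cpow_natCast,
        ← integral_const_mul, ← integral_const_mul]
      congr 1
      funext p
      simp only [ratios, Fin.prod_univ_four, Matrix.cons_val, Complex.ofReal_one, Complex.one_cpow]
      push_cast
      field_simp
    rw [fourPoint, if_pos hs, hF, hmel]
    rw [setIntegral_eq_integral_of_forall_compl_eq_zero, ← integral_const_mul,
      ← integral_const_mul]
    · congr 1
      funext τ
      rw [rayIntegrand, fourPointCoeff]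
      push_cast
      ring
    · intro τ hτ
      have : φ (fun j => ratios z ε y j * τ, y) = 0 := by
        by_contra h
        have h2 : 0 < ratios z ε y 2 * τ := (hφ.mem h).1 2
        simp only [ratios, Matrix.cons_val, one_mul] at h2
        exact hτ h2
      rw [this]
      simp
  · rw [fourPoint, if_neg hs]
    -- Off the support some ratio is not positive, so no point of the ray with `τ > 0` has all
    -- energies positive, and `φ` vanishes along it.
    have : ∀ τ, rayIntegrand κ z ε φ (y, τ) = 0 := by
      intro τ
      by_contra h
      have hτ : 0 < τ := (hN.mem h).2.2
      have h3 := (hφ.mem (right_ne_zero_of_mul h)).1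
      refine hs (hiff.2 ⟨?_, ?_, ?_⟩)
      · exact pos_of_mul_pos_left (h3 0) hτ.le
      · exact pos_of_mul_pos_left (h3 1) hτ.le
      · exact pos_of_mul_pos_left (h3 3) hτ.le
    simp [this]

/-- The slope of `cross` in `z̄₁`. -/
def crossSlope (z y : Fin 4 → ℝ) : ℝ :=
  (z 0 - z 1) * (z 2 - z 3) * (y 1 - y 3) - (z 0 - z 2) * (z 1 - z 3) * (y 2 - y 3)

/-- If the slope vanishes together with `cross`, then `cross` vanishes for every `z̄₁`, in
particular at `z̄₁ = z̄₂`, which forces `z̄₂ = z̄₃`. The Plücker identity then makes the slope `-z₁₄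
z₂₃ z̄₂₄`, which is nonzero. -/
theorem crossSlope_ne_zero {z y : Fin 4 → ℝ} (hz : Injective z) (hy : y ∈ region)
    (h : cross z y = 0) : crossSlope z y ≠ 0 := by
  obtain ⟨h1, h2, h3, h4⟩ := region_ne hy
  have h01 := ne_of_injective hz (i := 0) (j := 1) (by decide)
  have h03 := ne_of_injective hz (i := 0) (j := 3) (by decide)
  have h12 := ne_of_injective hz (i := 1) (j := 2) (by decide)
  have h23 := ne_of_injective hz (i := 2) (j := 3) (by decide)
  intro h0
  have h5 : (z 0 - z 1) * (z 2 - z 3) * (y 1 - y 3) * (y 1 - y 2) = 0 := by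
    rw [cross] at h
    rw [crossSlope] at h0
    linear_combination h - (y 0 - y 1) * h0
  have h6 : y 1 - y 2 = 0 := (mul_eq_zero.1 h5).resolve_left
    (mul_ne_zero (mul_ne_zero h01 h23) h3)
  have h7 : (z 0 - z 3) * (z 1 - z 2) * (y 1 - y 3) = 0 := by
    rw [crossSlope] at h0
    linear_combination -h0 + (z 0 - z 2) * (z 1 - z 3) * h6
  exact mul_ne_zero (mul_ne_zero h03 h12) h3 h7

/-- The bad points of `K` form a compact set disjoint from `cross = 0`, so `|cross|` has a positive
minimum on it. -/
theorem exists_cross_bound {z : Fin 4 → ℝ} (hz : Injective z) {K : Set (Fin 4 → ℝ)}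
    (hK : IsCompact K) (hKr : K ⊆ region) :
    ∃ δ > 0, ∀ y ∈ K, |cross z y| < δ → 0 < crossProd z y ∧ crossSlope z y ≠ 0 := by
  have hc : Continuous (cross z) := by unfold cross; fun_prop
  have hp : Continuous (crossProd z) := by unfold crossProd; fun_prop
  have hs : Continuous (crossSlope z) := by unfold crossSlope; fun_prop
  have hK2 : IsCompact (K ∩ {y | crossProd z y ≤ 0 ∨ crossSlope z y = 0}) :=
    hK.inter_right ((isClosed_le hp continuous_const).union (isClosed_eq hs continuous_const))
  rcases Set.eq_empty_or_nonempty (K ∩ {y | crossProd z y ≤ 0 ∨ crossSlope z y = 0}) with he | hne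
  · refine ⟨1, one_pos, fun y hy _ => ?_⟩
    have : y ∉ {y | crossProd z y ≤ 0 ∨ crossSlope z y = 0} := fun h => by
      have : y ∈ K ∩ {y | crossProd z y ≤ 0 ∨ crossSlope z y = 0} := ⟨hy, h⟩
      rw [he] at this
      exact this
    simpa using this
  · obtain ⟨y₀, hy₀, hmin⟩ := hK2.exists_isMinOn hne hc.abs.continuousOn
    refine ⟨|cross z y₀|, abs_pos.2 fun h0 => ?_, fun y hy hlt => ?_⟩
    · rcases hy₀.2 with h | h
      · exact absurd (crossProd_pos hz (hKr hy₀.1) h0) (not_lt.2 h)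
      · exact crossSlope_ne_zero hz (hKr hy₀.1) h0 h
    · have : y ∉ {y | crossProd z y ≤ 0 ∨ crossSlope z y = 0} := fun h =>
        absurd (hmin ⟨hy, h⟩) (not_le.2 hlt)
      simpa using this

/-! ### The delta function of the cross ratio -/

/-- The value of `cross` at `z̄₁ = 0`. -/
def crossConst (z y : Fin 4 → ℝ) : ℝ :=
  (z 0 - z 2) * (z 1 - z 3) * y 1 * (y 2 - y 3) - (z 0 - z 1) * (z 2 - z 3) * y 2 * (y 1 - y 3)

theorem cross_eq (z y : Fin 4 → ℝ) : cross z y = crossSlope z y * y 0 + crossConst z y := by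
  rw [cross, crossSlope, crossConst]
  ring

/-- The solution of `cross z y = c` with given `z̄₂, z̄₃, z̄₄`. -/
def crossSolve (z : Fin 4 → ℝ) (c : ℝ) (w : Fin 3 → ℝ) : Fin 4 → ℝ :=
  ![(c - crossConst z ![0, w 0, w 1, w 2]) / crossSlope z ![0, w 0, w 1, w 2], w 0, w 1, w 2]

theorem cons_eq (a : ℝ) (w : Fin 3 → ℝ) :
    Fin.cons (α := fun _ => ℝ) a w = ![a, w 0, w 1, w 2] := by
  funext j
  fin_cases j <;> rfl

theorem integral_cons_symm {n : ℕ} (G : (Fin (n + 1) → ℝ) → ℂ) (hG : Integrable G) :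
    ∫ s, G s = ∫ x : Fin n → ℝ, ∫ a : ℝ, G (Fin.cons (α := fun _ => ℝ) a x) := by
  have hm := (volume_preserving_piFinSuccAbove (fun _ : Fin (n + 1) => ℝ) 0).symm
  have hi : Integrable (fun p => G ((MeasurableEquiv.piFinSuccAbove (fun _ => ℝ) 0).symm p))
      (volume.prod volume) :=
    (hm.integrable_comp_emb (MeasurableEquiv.measurableEmbedding _)).2 hG
  rw [← hm.integral_comp', Measure.volume_eq_prod, integral_prod_symm _ hi]
  congr 1
  funext a
  congr 1
  funext x
  congr 1
  simp [MeasurableEquiv.piFinSuccAbove, Fin.consEquiv]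

/-- A test function times the Jacobian, in the coordinates `(c, w)` with `cross = c`. -/
def crossPull (z : Fin 4 → ℝ) (G : (Fin 4 → ℝ) → ℂ) (p : ℝ × (Fin 3 → ℝ)) : ℂ :=
  ((|(crossSlope z ![0, p.2 0, p.2 1, p.2 2])⁻¹| : ℝ) : ℂ) * G (crossSolve z p.1 p.2)

theorem contDiffAt_crossSolve {z : Fin 4 → ℝ} {p : ℝ × (Fin 3 → ℝ)}
    (hp : crossSlope z ![0, p.2 0, p.2 1, p.2 2] ≠ 0) :
    ContDiffAt ℝ (⊤ : ℕ∞) (fun p : ℝ × (Fin 3 → ℝ) => crossSolve z p.1 p.2) p := by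
  rw [contDiffAt_pi]
  intro j
  fin_cases j
  · refine ContDiffAt.div ?_ ?_ hp
    · simp only [crossConst, Matrix.cons_val]; fun_prop
    · simp only [crossSlope, Matrix.cons_val]; fun_prop
  · simp [crossSolve]; fun_prop
  · simp [crossSolve]; fun_prop
  · simp [crossSolve]; fun_prop

theorem crossSlope_crossSolve (z : Fin 4 → ℝ) (c : ℝ) (w : Fin 3 → ℝ) :
    crossSlope z (crossSolve z c w) = crossSlope z ![0, w 0, w 1, w 2] := rfl

theorem crossConst_crossSolve (z : Fin 4 → ℝ) (c : ℝ) (w : Fin 3 → ℝ) :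
    crossConst z (crossSolve z c w) = crossConst z ![0, w 0, w 1, w 2] := rfl

theorem cross_crossSolve {z : Fin 4 → ℝ} {c : ℝ} {w : Fin 3 → ℝ}
    (h : crossSlope z ![0, w 0, w 1, w 2] ≠ 0) : cross z (crossSolve z c w) = c := by
  rw [cross_eq, crossSlope_crossSolve, crossConst_crossSolve]
  simp only [crossSolve, Matrix.cons_val]
  field_simp
  ring

theorem isTest_crossPull {z : Fin 4 → ℝ} {G : (Fin 4 → ℝ) → ℂ}
    (hG : IsTest {y | crossSlope z y ≠ 0} G) :
    IsTest {p : ℝ × (Fin 3 → ℝ) | crossSlope z ![0, p.2 0, p.2 1, p.2 2] ≠ 0}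
      (crossPull z G) := by
  refine hG.mul_comp' (m := fun p : ℝ × (Fin 3 → ℝ) => crossSolve z p.1 p.2)
    (fun y => (cross z y, ![y 1, y 2, y 3])) ?_ ?_ ?_ ?_ ?_
  · refine Continuous.continuousOn (Continuous.prodMk ?_ ?_)
    · unfold cross; fun_prop
    · refine continuous_pi fun j => ?_
      fin_cases j <;> simp <;> fun_prop
  · intro p hp
    refine Prod.ext (cross_crossSolve hp) ?_
    funext j
    fin_cases j <;> rfl
  · intro y hy
    exact hy
  · intro p hp
    exact contDiffAt_crossSolve hp
  · intro p hp
    have h1 : ContDiffAt ℝ (⊤ : ℕ∞)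
        (fun p : ℝ × (Fin 3 → ℝ) => (crossSlope z ![0, p.2 0, p.2 1, p.2 2])⁻¹) p := by
      refine ContDiffAt.inv ?_ hp
      simp only [crossSlope, Matrix.cons_val]; fun_prop
    exact ContDiffAt.comp (g := Complex.ofReal) p Complex.ofRealCLM.contDiff.contDiffAt
      (h1.abs (inv_ne_zero hp))

/-- For fixed `z̄₂, z̄₃, z̄₄` the function `cross` is affine in `z̄₁`, so it replaces `z̄₁` as a
variable, with Jacobian the inverse slope. -/
theorem setIntegral_cross {z : Fin 4 → ℝ} {G : (Fin 4 → ℝ) → ℂ}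
    (hG : IsTest {y | crossSlope z y ≠ 0} G) (r : ℝ) :
    ∫ y in {y | |cross z y| < r}, G y =
      ∫ c in {c : ℝ | |c| < r}, ∫ w, crossPull z G (c, w) := by
  have hcr : Continuous (cross z) := by unfold cross; fun_prop
  have hA : MeasurableSet {y | |cross z y| < r} :=
    (isOpen_lt hcr.abs continuous_const).measurableSet
  have hB : MeasurableSet {c : ℝ | |c| < r} :=
    (isOpen_lt continuous_abs continuous_const).measurableSet
  have hB' : MeasurableSet {p : ℝ × (Fin 3 → ℝ) | |p.1| < r} :=
    (isOpen_lt (continuous_abs.comp continuous_fst) continuous_const).measurableSet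
  have hP := (isTest_crossPull hG).integrable (μ := volume.prod volume)
  rw [← integral_indicator hA, ← integral_indicator hB,
    integral_cons_symm _ (hG.integrable.indicator hA)]
  have h1 : ∀ w : Fin 3 → ℝ, ∫ a : ℝ, {y | |cross z y| < r}.indicator G
      (Fin.cons (α := fun _ => ℝ) a w) =
      ∫ c : ℝ, {p : ℝ × (Fin 3 → ℝ) | |p.1| < r}.indicator (crossPull z G) (c, w) := by
    intro w
    by_cases hs : crossSlope z ![0, w 0, w 1, w 2] = 0
    · have e1 : ∀ a, G (Fin.cons (α := fun _ => ℝ) a w) = 0 := by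
        intro a
        by_contra h
        exact hG.mem h hs
      have e2 : ∀ c, crossPull z G (c, w) = 0 := by
        intro c
        by_contra h
        exact (isTest_crossPull hG).mem h hs
      simp [Set.indicator_apply, e1, e2]
    · rw [integral_affine _ (-crossConst z ![0, w 0, w 1, w 2] /
        crossSlope z ![0, w 0, w 1, w 2]) _ (inv_ne_zero hs), ← integral_smul]
      congr 1
      funext c
      have e : Fin.cons (α := fun _ => ℝ) (-crossConst z ![0, w 0, w 1, w 2] /
          crossSlope z ![0, w 0, w 1, w 2] + (crossSlope z ![0, w 0, w 1, w 2])⁻¹ * c) w =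
          crossSolve z c w := by
        rw [cons_eq, crossSolve]
        congr 1
        field_simp
        ring
      rw [e]
      by_cases hc : |c| < r
      · rw [Set.indicator_of_mem (by simpa [cross_crossSolve hs] using hc),
          Set.indicator_of_mem (by simpa using hc), crossPull, Complex.real_smul]
      · rw [Set.indicator_of_notMem (by simpa [cross_crossSolve hs] using hc),
          Set.indicator_of_notMem (by simpa using hc), smul_zero]
  simp_rw [h1]
  rw [integral_integral_swap (f := fun (w : Fin 3 → ℝ) (c : ℝ) =>
    {p : ℝ × (Fin 3 → ℝ) | |p.1| < r}.indicator (crossPull z G) (c, w)) (hP.indicator hB').swap]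
  congr 1
  funext c
  by_cases hc : |c| < r
  · rw [Set.indicator_of_mem (by exact hc)]
    congr 1
    funext w
    exact Set.indicator_of_mem (by exact hc) _
  · rw [Set.indicator_of_notMem (by exact hc), ← integral_zero (Fin 3 → ℝ) ℂ]
    congr 1
    funext w
    exact Set.indicator_of_notMem (by exact hc) _

theorem setIntegral_unit (h : ℝ → ℂ) (r : ℝ) :
    ∫ p in {p : Unit → ℝ | ∀ k, |p k| < r}, h (p ()) = ∫ c in {c : ℝ | |c| < r}, h c := by
  have hm := volume_preserving_funUnique Unit ℝ
  rw [← hm.setIntegral_preimage_emb (MeasurableEquiv.measurableEmbedding _) h]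
  have : {p : Unit → ℝ | ∀ k, |p k| < r} =
      (MeasurableEquiv.funUnique Unit ℝ) ⁻¹' {c : ℝ | |c| < r} := by
    ext p
    exact ⟨fun h => h (), fun h _ => h⟩
  rw [this]
  rfl

/-- The delta function of `cross` on functions which are smooth near the zero set. -/
theorem isDeltaIntegral_cross {z : Fin 4 → ℝ} {F G : (Fin 4 → ℝ) → ℂ}
    (hG : IsTest {y | crossSlope z y ≠ 0} G) {r : ℝ} (hr : 0 < r)
    (hFG : ∀ y, |cross z y| < r → F y = G y) :
    IsDeltaIntegral (fun y (_ : Unit) => cross z y) F (∫ w, crossPull z G (0, w)) := by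
  have hcr : Continuous (cross z) := by unfold cross; fun_prop
  have hcont : Continuous fun c : ℝ => ∫ w, crossPull z G (c, w) :=
    ((isTest_crossPull hG).integral (μ := volume)).continuous
  refine isDeltaIntegral_of_eventually (h := fun p : Unit → ℝ => ∫ w, crossPull z G (p (), w))
    (hcont.comp (continuous_apply ())) ?_
  filter_upwards [Ioo_mem_nhdsGT (mul_pos two_pos hr)] with η hη
  rw [setIntegral_unit (fun c => ∫ w, crossPull z G (c, w)), ← setIntegral_cross hG]
  have hset : {y : Fin 4 → ℝ | ∀ _ : Unit, |cross z y| < η / 2} = {y | |cross z y| < η / 2} := by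
    ext y
    simp
  rw [hset]
  refine setIntegral_congr_fun (isOpen_lt hcr.abs continuous_const).measurableSet fun y hy => ?_
  exact hFG y (lt_trans hy (by linarith [hη.2]))

/-! ### Comparison with the momentum shell -/

/-- The slope of `z̄₃` in `ω₄` on the momentum shell. -/
def shellSlope (z ε : Fin 4 → ℝ) (τ x s : ℝ) : ℝ := slope₃ z ε * (x - s) / τ

/-- Energy conservation contracted with `z_i - z₂`, which eliminates particle 2; the next lemma
eliminates particle 1. -/
theorem shellT_zero {z ε : Fin 4 → ℝ} (hz : Injective z) (hε : ∀ j, ε j ≠ 0) (τ ω x s : ℝ) :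
    ε 0 * shellT z ε ![τ, ω, x, s] 0 * (z 0 - z 1) =
      ε 2 * τ * (z 1 - z 2) + ε 3 * ω * (z 1 - z 3) := by
  have h01 := ne_of_injective hz (i := 0) (j := 1) (by decide)
  have e0 := hε 0
  simp only [shellT, energies, Matrix.cons_val]
  field_simp
  ring

theorem shellT_one {z ε : Fin 4 → ℝ} (hz : Injective z) (hε : ∀ j, ε j ≠ 0) (τ ω x s : ℝ) :
    ε 1 * shellT z ε ![τ, ω, x, s] 1 * (z 0 - z 1) =
      ε 2 * τ * (z 2 - z 0) + ε 3 * ω * (z 3 - z 0) := by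
  have h01 := ne_of_injective hz (i := 1) (j := 0) (by decide)
  have e1 := hε 1
  simp only [shellT, energies, Matrix.cons_val]
  field_simp
  ring

/-- On the shell the slope of `cross` is proportional to `ω₁`, so it is nonzero there and supplies
the energy factor of the Jacobian. -/
theorem crossSlope_shell {z ε : Fin 4 → ℝ} (hz : Injective z) (hε : ∀ j, ε j ≠ 0) {τ : ℝ}
    (hτ : τ ≠ 0) (ω x s : ℝ) :
    crossSlope z ![0, x, x + shellSlope z ε τ x s * ω, s] =
      -((x - s) / τ * (z 0 - z 3) / ε 2 * (ε 0 * shellT z ε ![τ, ω, x, s] 0 * (z 0 - z 1))) := by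
  have h02 := ne_of_injective hz (i := 0) (j := 2) (by decide)
  have e2 := hε 2
  rw [shellT_zero hz hε]
  simp only [crossSlope, shellSlope, slope₃, Matrix.cons_val]
  field_simp
  ring

theorem shellZ_zero_sub {z ε : Fin 4 → ℝ} (hz : Injective z) (hε : ∀ j, ε j ≠ 0) {τ ω x s : ℝ}
    (ht : shellT z ε ![τ, ω, x, s] 0 ≠ 0) :
    shellZ z ε ![τ, ω, x, s] 0 - s = -(ε 1 * shellT z ε ![τ, ω, x, s] 1 * (z 1 - z 2) * (x - s) /
      (ε 0 * shellT z ε ![τ, ω, x, s] 0 * (z 0 - z 2))) := by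
  have h01 := ne_of_injective hz (i := 0) (j := 1) (by decide)
  have h02 := ne_of_injective hz (i := 0) (j := 2) (by decide)
  have e0 := hε 0
  have k0 := shellT_zero hz hε τ ω x s
  have k1 := shellT_one hz hε τ ω x s
  have k3 : shellT z ε ![τ, ω, x, s] 3 = ω := rfl
  simp only [shellZ, coords, Matrix.cons_val]
  rw [k3]
  generalize shellT z ε ![τ, ω, x, s] 0 = t₀ at *
  generalize shellT z ε ![τ, ω, x, s] 1 = t₁ at *
  have k : ε 0 * t₀ * (z 0 - z 2) + ε 1 * t₁ * (z 1 - z 2) + ε 3 * ω * (z 3 - z 2) = 0 := by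
    refine (mul_eq_zero.1 ?_).resolve_left h01
    linear_combination (z 0 - z 2) * k0 + (z 1 - z 2) * k1
  field_simp
  linear_combination -s * k

theorem shellZ_two_sub {z ε : Fin 4 → ℝ} (hz : Injective z) (hε : ∀ j, ε j ≠ 0) {τ ω x s : ℝ}
    (hτ : τ ≠ 0) :
    shellZ z ε ![τ, ω, x, s] 2 - s = ε 1 * shellT z ε ![τ, ω, x, s] 1 * (z 0 - z 1) * (x - s) /
      (ε 2 * τ * (z 2 - z 0)) := by
  have h20 := ne_of_injective hz (i := 2) (j := 0) (by decide)
  have e2 := hε 2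
  have k1 := shellT_one hz hε τ ω x s
  have k2 : shellT z ε ![τ, ω, x, s] 2 = τ := rfl
  have k3 : shellT z ε ![τ, ω, x, s] 3 = ω := rfl
  simp only [shellZ, coords, Matrix.cons_val]
  rw [k3, k2]
  generalize shellT z ε ![τ, ω, x, s] 1 = t₁ at *
  field_simp
  linear_combination s * k1

theorem shellZ_two {z ε : Fin 4 → ℝ} (hz : Injective z) (hε : ∀ j, ε j ≠ 0) {τ ω x s : ℝ}
    (hτ : τ ≠ 0) : shellZ z ε ![τ, ω, x, s] 2 = x + shellSlope z ε τ x s * ω := by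
  have h02 := ne_of_injective hz (i := 0) (j := 2) (by decide)
  have h20 := ne_of_injective hz (i := 2) (j := 0) (by decide)
  have e2 := hε 2
  have k1 := shellT_one hz hε τ ω x s
  have k2 : shellT z ε ![τ, ω, x, s] 2 = τ := rfl
  have k3 : shellT z ε ![τ, ω, x, s] 3 = ω := rfl
  simp only [shellZ, coords, Matrix.cons_val]
  rw [k3, k2]
  simp only [shellSlope, slope₃]
  generalize shellT z ε ![τ, ω, x, s] 1 = t₁ at *
  field_simp
  linear_combination -x * (z 2 - z 0) * k1

/-- Momentum conservation implies `cross = 0`, and an affine equation with nonzero slope has a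
single root `z̄₁`. Thus the shell and the zero set of `cross` are the same points, with `ω₄` at
fixed `τ, x, s` corresponding to `z̄₃`. -/
theorem crossSolve_shell {z ε : Fin 4 → ℝ} (hz : Injective z) (hε : ∀ j, ε j ≠ 0) {τ ω x s : ℝ}
    (hτ : τ ≠ 0) (hxs : x - s ≠ 0) (ht : shellT z ε ![τ, ω, x, s] 0 ≠ 0) :
    crossSolve z 0 ![x, x + shellSlope z ε τ x s * ω, s] = shellZ z ε ![τ, ω, x, s] := by
  have h01 := ne_of_injective hz (i := 0) (j := 1) (by decide)
  have h02 := ne_of_injective hz (i := 0) (j := 2) (by decide)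
  have h20 := ne_of_injective hz (i := 2) (j := 0) (by decide)
  have h03 := ne_of_injective hz (i := 0) (j := 3) (by decide)
  have e0 := hε 0
  have e2 := hε 2
  have hD := crossSlope_shell hz hε hτ ω x s
  have hD2 : crossSlope z ![0, x, x + shellSlope z ε τ x s * ω, s] ≠ 0 := by
    rw [hD]
    exact neg_ne_zero.2 (mul_ne_zero (div_ne_zero (mul_ne_zero (div_ne_zero hxs hτ) h03) e2)
      (mul_ne_zero (mul_ne_zero e0 ht) h01))
  have y0 := shellZ_zero_sub hz hε ht
  have y2 := shellZ_two_sub (ω := ω) (x := x) (s := s) hz hε hτ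
  have y2' := shellZ_two (ω := ω) (x := x) (s := s) hz hε hτ
  funext j
  fin_cases j
  · refine (div_eq_iff hD2).2 ?_
    change 0 - crossConst z ![0, x, x + shellSlope z ε τ x s * ω, s] =
      shellZ z ε ![τ, ω, x, s] 0 * crossSlope z ![0, x, x + shellSlope z ε τ x s * ω, s]
    have h1 : (shellZ z ε ![τ, ω, x, s] 0 - s) *
        crossSlope z ![0, x, x + shellSlope z ε τ x s * ω, s] =
        -((x - s) * (shellZ z ε ![τ, ω, x, s] 2 - s) * ((z 0 - z 3) * (z 1 - z 2))) := by
      rw [hD, y0, y2]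
      field_simp
      ring
    rw [← y2'] at h1 ⊢
    simp only [crossSlope, crossConst, Matrix.cons_val] at h1 ⊢
    linear_combination -h1
  · rfl
  · exact y2'.symm
  · rfl

theorem ratios_shell {z ε : Fin 4 → ℝ} (hz : Injective z) (hε : ∀ j, ε j ≠ 0) {τ ω x s : ℝ}
    (hτ : τ ≠ 0) (ht : shellT z ε ![τ, ω, x, s] 0 ≠ 0)
    (hreg : shellZ z ε ![τ, ω, x, s] ∈ region) :
    ratio₁ z ε (shellZ z ε ![τ, ω, x, s]) * τ = shellT z ε ![τ, ω, x, s] 0 ∧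
    ratio₂ z ε (shellZ z ε ![τ, ω, x, s]) * τ = shellT z ε ![τ, ω, x, s] 1 ∧
    ratio₄ z ε (shellZ z ε ![τ, ω, x, s]) * τ = ω := by
  have h01 := ne_of_injective hz (i := 0) (j := 1) (by decide)
  have h02 := ne_of_injective hz (i := 0) (j := 2) (by decide)
  have h20 := ne_of_injective hz (i := 2) (j := 0) (by decide)
  have h12 := ne_of_injective hz (i := 1) (j := 2) (by decide)
  have h31 := ne_of_injective hz (i := 3) (j := 1) (by decide)
  have e0 := hε 0
  have e1 := hε 1
  have e2 := hε 2
  have e3 := hε 3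
  have k0 := shellT_zero hz hε τ ω x s
  have y03 := shellZ_zero_sub hz hε ht
  have y23 := shellZ_two_sub (ω := ω) (x := x) (s := s) hz hε hτ
  obtain ⟨_, n03, n13, _⟩ := region_ne hreg
  have y1 : shellZ z ε ![τ, ω, x, s] 1 = x := rfl
  have y3 : shellZ z ε ![τ, ω, x, s] 3 = s := rfl
  rw [y3] at n03 n13
  rw [y1] at n13
  have nt : shellT z ε ![τ, ω, x, s] 1 ≠ 0 := by
    intro h
    rw [y03, h] at n03
    simp at n03
  have y02 : shellZ z ε ![τ, ω, x, s] 0 - shellZ z ε ![τ, ω, x, s] 2 =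
      (shellZ z ε ![τ, ω, x, s] 0 - s) - (shellZ z ε ![τ, ω, x, s] 2 - s) := by ring
  have n31 : s - x ≠ 0 := by rw [← neg_sub]; exact neg_ne_zero.2 n13
  rw [ratio₁, ratio₂, ratio₄, y1, y3, y02, y03, y23]
  generalize shellT z ε ![τ, ω, x, s] 0 = t₀ at *
  generalize shellT z ε ![τ, ω, x, s] 1 = t₁ at *
  refine ⟨?_, ?_, ?_⟩
  · field_simp
    ring
  · field_simp
    ring
  · field_simp
    linear_combination (z 0 - z 2) * k0

/-- On the shell `ratios * τ` are the energies themselves, so the powers of the ratios become powers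
of energies and the comparison with `density` is algebraic. -/
theorem jacobian_rayIntegrand (κ : ℝ) {z ε : Fin 4 → ℝ} (hz : Injective z)
    (hε : ∀ j, ε j = 1 ∨ ε j = -1) {φ : (Fin 4 → ℝ) × (Fin 4 → ℝ) → ℂ} (hφ : IsTest goodSet φ)
    {τ x s : ℝ} (ω : ℝ) (hτ : τ ≠ 0) (hxs : x - s ≠ 0) :
    ((|shellSlope z ε τ x s| *
      |(crossSlope z ![0, x, x + shellSlope z ε τ x s * ω, s])⁻¹| : ℝ) : ℂ) *
      rayIntegrand κ z ε φ (crossSolve z 0 ![x, x + shellSlope z ε τ x s * ω, s], τ) =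
    shellIntegrand κ z ε φ ![τ, ω, x, s] := by
  have hε' := eps_ne_zero hε
  by_cases ht : shellT z ε ![τ, ω, x, s] 0 = 0
  · have h1 : shellIntegrand κ z ε φ ![τ, ω, x, s] = 0 := by
      by_contra h
      exact ((hφ.mem (right_ne_zero_of_mul h)).1 0).ne' ht
    -- At `ω₁ = 0` the slope of `cross` is zero, and `0⁻¹ = 0` makes the left side vanish as well.
    rw [h1, crossSlope_shell hz hε' hτ, ht]
    simp
  rw [crossSolve_shell hz hε' hτ hxs ht]
  by_cases hreg : shellZ z ε ![τ, ω, x, s] ∈ region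
  swap
  · have h1 : ∀ t, φ (t, shellZ z ε ![τ, ω, x, s]) = 0 := fun t => by
      by_contra h
      exact hreg (hφ.mem h).2
    rw [shellIntegrand, rayIntegrand, h1, h1]
    simp
  obtain ⟨r1, r2, r4⟩ := ratios_shell hz hε' hτ ht hreg
  have hr : (fun j => ratios z ε (shellZ z ε ![τ, ω, x, s]) j * τ) =
      shellT z ε ![τ, ω, x, s] := by
    funext j
    fin_cases j
    · exact r1
    · exact r2
    · exact one_mul τ
    · exact r4
  rw [shellIntegrand, rayIntegrand]
  simp only [hr]
  by_cases hf : φ (shellT z ε ![τ, ω, x, s], shellZ z ε ![τ, ω, x, s]) = 0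
  · simp [hf]
  have hpos : ∀ j, 0 < shellT z ε ![τ, ω, x, s] j := (hφ.mem hf).1
  rw [← mul_assoc, ← Complex.ofReal_mul]
  congr 2
  have k2 : shellT z ε ![τ, ω, x, s] 2 = τ := rfl
  have k3 : shellT z ε ![τ, ω, x, s] 3 = ω := rfl
  have p0 := hpos 0
  have p2 := hpos 2
  have p3 := hpos 3
  have h01 := ne_of_injective hz (i := 0) (j := 1) (by decide)
  have h02 := ne_of_injective hz (i := 0) (j := 2) (by decide)
  have h20 := ne_of_injective hz (i := 2) (j := 0) (by decide)
  have h03 := ne_of_injective hz (i := 0) (j := 3) (by decide)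
  have h30 := ne_of_injective hz (i := 3) (j := 0) (by decide)
  have h31 := ne_of_injective hz (i := 3) (j := 1) (by decide)
  have h12 := ne_of_injective hz (i := 1) (j := 2) (by decide)
  have h13 := ne_of_injective hz (i := 1) (j := 3) (by decide)
  have h23 := ne_of_injective hz (i := 2) (j := 3) (by decide)
  have a01 := abs_ne_zero.2 h01
  have a02 := abs_ne_zero.2 h02
  have habs : ∀ j, |ε j| = 1 := fun j => by rcases hε j with h | h <;> simp [h]
  -- The factors `x - s`, `τ` and `z₁₄` cancel between the two slopes.
  have hJ : |shellSlope z ε τ x s| * |(crossSlope z ![0, x, x + shellSlope z ε τ x s * ω, s])⁻¹| =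
      (|z 0 - z 1| * |z 0 - z 2| * shellT z ε ![τ, ω, x, s] 0)⁻¹ := by
    have b1 := abs_ne_zero.2 hxs
    have b2 := abs_ne_zero.2 hτ
    have b3 := abs_ne_zero.2 h03
    rw [crossSlope_shell hz hε' hτ, shellSlope, slope₃]
    simp only [abs_mul, abs_div, abs_inv, abs_neg, habs, abs_of_pos p0]
    field_simp
  have e1 : ratio₁ z ε (shellZ z ε ![τ, ω, x, s]) = shellT z ε ![τ, ω, x, s] 0 / τ :=
    eq_div_of_mul_eq hτ r1
  have e2 : ratio₂ z ε (shellZ z ε ![τ, ω, x, s]) = shellT z ε ![τ, ω, x, s] 1 / τ :=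
    eq_div_of_mul_eq hτ r2
  have e4 : ratio₄ z ε (shellZ z ε ![τ, ω, x, s]) = ω / τ :=
    eq_div_of_mul_eq hτ r4
  rw [hJ, e1, e2, e4, fourPointCoeff, density, k2, k3]
  rw [k3] at p3
  have p0' := p0.ne'
  have p3' := p3.ne'
  generalize shellT z ε ![τ, ω, x, s] 0 = t₀ at *
  generalize shellT z ε ![τ, ω, x, s] 1 = t₁ at *
  have m1 : z 3 - z 0 = -(z 0 - z 3) := by ring
  have m2 : z 3 - z 1 = -(z 1 - z 3) := by ring
  have m3 : z 2 - z 0 = -(z 0 - z 2) := by ring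
  rw [m1, m2, m3]
  field_simp

/-- A cutoff near the zero set of `cross`, which removes the zeros of the slope of `cross`. -/
theorem exists_cutoff (κ : ℝ) {z ε : Fin 4 → ℝ} (hz : Injective z) (hε : ∀ j, ε j ≠ 0)
    {φ : (Fin 4 → ℝ) × (Fin 4 → ℝ) → ℂ} (hφ : IsTest goodSet φ) :
    ∃ χ : ℝ → ℝ, ∃ r > 0, (∀ c, |c| < r → χ c = 1) ∧
      (∀ t y, |cross z y| < r → φ (t, y) ≠ 0 → 0 < crossProd z y) ∧
      IsTest {P : (Fin 4 → ℝ) × ℝ | crossSlope z P.1 ≠ 0 ∧ P.1 ∈ region ∧ 0 < P.2}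
        fun P => (χ (cross z P.1) : ℂ) * rayIntegrand κ z ε φ P := by
  obtain ⟨_, K, hK, hKS, h0⟩ := id hφ
  obtain ⟨hN, K', hK', hKS', h0'⟩ := isTest_rayIntegrand κ hz hε hφ
  have hK1 : IsCompact (Prod.snd '' K ∪ Prod.fst '' K') :=
    (hK.image continuous_snd).union (hK'.image continuous_fst)
  -- The bound is needed on the `z̄` supports of both `φ` and `rayIntegrand`: the first to identify
  -- the support condition, the second to keep the slope away from zero.
  obtain ⟨δ, hδ, hb⟩ := exists_cross_bound hz hK1 (by
    rintro _ (⟨p, hp, rfl⟩ | ⟨p, hp, rfl⟩)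
    · exact (hKS hp).2
    · exact (hKS' hp).1)
  let χ : ContDiffBump (0 : ℝ) := ⟨δ / 3, δ / 2, by positivity, by linarith⟩
  have hcr : ContDiff ℝ (⊤ : ℕ∞) (cross z) := by unfold cross; fun_prop
  refine ⟨χ, δ / 3, by positivity, fun c hc => χ.one_of_mem_closedBall ?_, ?_, ?_⟩
  · simpa [χ] using hc.le
  · intro t y hy hne
    refine (hb y (Or.inl ⟨(t, y), ?_, rfl⟩) (hy.trans (by linarith))).1
    by_contra h
    exact hne (h0 _ h)
  · refine IsTest.of_contDiffAt (K := K' ∩ {P | |cross z P.1| ≤ δ / 2})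
      (hK'.inter_right (isClosed_le (hcr.continuous.comp continuous_fst).abs continuous_const))
      ?_ ?_ ?_
    · rintro P ⟨hP, hP2⟩
      exact ⟨(hb P.1 (Or.inr ⟨P, hP, rfl⟩) (lt_of_le_of_lt hP2 (by linarith))).2,
        (hKS' hP).1, (hKS' hP).2.2⟩
    · intro P _
      exact (ContDiff.mul (Complex.ofRealCLM.contDiff.comp
        (χ.contDiff.comp (hcr.comp contDiff_fst))) hN).contDiffAt
    · intro P hP
      by_cases hP1 : P ∈ K'
      · have : χ (cross z P.1) = 0 := by
          refine χ.zero_of_le_dist ?_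
          have : ¬ |cross z P.1| ≤ δ / 2 := fun h => hP ⟨hP1, h⟩
          simpa [χ, Real.dist_eq] using (not_le.1 this).le
        rw [this]
        simp
      · rw [h0' P hP1, mul_zero]

/-- The pullback to the zero set of `cross` of a function of `(z̄, ω₃)`. -/
theorem isTest_crossPull_zero {z : Fin 4 → ℝ} {W : (Fin 4 → ℝ) × ℝ → ℂ}
    {S : Set ((Fin 4 → ℝ) × ℝ)}
    (hW : IsTest S W) (hS : ∀ P ∈ S, crossSlope z P.1 ≠ 0) :
    IsTest Set.univ fun v : Fin 4 → ℝ =>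
      ((|(crossSlope z ![0, v 0, v 1, v 2])⁻¹| : ℝ) : ℂ) *
        W (crossSolve z 0 ![v 0, v 1, v 2], v 3) := by
  have hw : ContDiff ℝ (⊤ : ℕ∞) fun v : Fin 4 → ℝ => ((0 : ℝ), (![v 0, v 1, v 2] : Fin 3 → ℝ)) := by
    refine contDiff_const.prodMk ?_
    rw [contDiff_pi]
    intro j
    fin_cases j <;> simp <;> fun_prop
  have hT := hW.mul_comp' (T := {v : Fin 4 → ℝ | crossSlope z ![0, v 0, v 1, v 2] ≠ 0})
    (m := fun v : Fin 4 → ℝ => (crossSolve z 0 ![v 0, v 1, v 2], v 3))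
    (w := fun v => ((|(crossSlope z ![0, v 0, v 1, v 2])⁻¹| : ℝ) : ℂ))
    (fun P => ![P.1 1, P.1 2, P.1 3, P.2]) ?_ ?_ ?_ ?_ ?_
  · exact hT.mono (Set.subset_univ _)
  · refine Continuous.continuousOn (continuous_pi fun j => ?_)
    fin_cases j <;> simp <;> fun_prop
  · intro v _
    funext j
    fin_cases j <;> rfl
  · intro P hP
    exact hS P hP
  · intro v hv
    refine ContDiffAt.prodMk ?_ (by fun_prop)
    exact ContDiffAt.comp (g := fun p : ℝ × (Fin 3 → ℝ) => crossSolve z p.1 p.2) v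
      (contDiffAt_crossSolve (p := (0, ![v 0, v 1, v 2])) hv) hw.contDiffAt
  · intro v hv
    have h1 : ContDiffAt ℝ (⊤ : ℕ∞)
        (fun v : Fin 4 → ℝ => (crossSlope z ![0, v 0, v 1, v 2])⁻¹) v := by
      refine ContDiffAt.inv ?_ hv
      simp only [crossSlope, Matrix.cons_val]; fun_prop
    exact ContDiffAt.comp (g := Complex.ofReal) v Complex.ofRealCLM.contDiff.contDiffAt
      (h1.abs (inv_ne_zero hv))

theorem integral_crossPull_zero {z : Fin 4 → ℝ} {W : (Fin 4 → ℝ) × ℝ → ℂ}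
    {S : Set ((Fin 4 → ℝ) × ℝ)}
    (hW : IsTest S W) (hS : ∀ P ∈ S, crossSlope z P.1 ≠ 0) :
    ∫ w, crossPull z (fun y => ∫ τ : ℝ, W (y, τ)) (0, w) = ∫ v : Fin 4 → ℝ,
      ((|(crossSlope z ![0, v 0, v 1, v 2])⁻¹| : ℝ) : ℂ) *
        W (crossSolve z 0 ![v 0, v 1, v 2], v 3) := by
  have hG : IsTest {y | crossSlope z y ≠ 0} fun y => ∫ τ : ℝ, W (y, τ) :=
    (hW.integral (μ := volume)).mono (by
      rintro _ ⟨P, hP, rfl⟩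
      exact hS P hP)
  have hg : IsTest Set.univ fun w => crossPull z (fun y => ∫ τ : ℝ, W (y, τ)) (0, w) :=
    (isTest_crossPull hG).comp (m := fun w : Fin 3 → ℝ => ((0 : ℝ), w)) Prod.snd (by fun_prop)
      (fun _ _ => rfl) (fun _ _ => trivial) (fun _ _ => contDiffAt_const.prodMk contDiffAt_id)
  rw [hg.integral_fin_three, (isTest_crossPull_zero hW hS).integral_fin_four]
  congr 1
  funext x
  congr 1
  funext y
  congr 1
  funext s
  rw [crossPull, ← integral_const_mul]
  rfl

/-- Near `cross = 0` the formula coincides with the cut-off ray integral, which is a test function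
where the slope is nonzero; the delta function sees only this neighbourhood. The resulting integral
over the zero set is the shell integral after the substitution from `z̄₃` to `ω₄`. -/
theorem isDeltaIntegral_fourPoint (κ : ℝ) {z ε : Fin 4 → ℝ} (hz : Injective z)
    (hε : ∀ j, ε j = 1 ∨ ε j = -1) (c : Fin 3 → ℝ) {φ : (Fin 4 → ℝ) × (Fin 4 → ℝ) → ℂ}
    (hφ : IsTest goodSet φ) :
    IsDeltaIntegral (fun y (_ : Unit) => cross z y) (fourPoint κ z ε c φ)
      (∫ q, shellIntegrand κ z ε φ q) := by
  have hε' := eps_ne_zero hε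
  obtain ⟨χ, r, hr, h1, hpos, hW⟩ := exists_cutoff κ hz hε' hφ
  have hS : ∀ P ∈ {P : (Fin 4 → ℝ) × ℝ | crossSlope z P.1 ≠ 0 ∧ P.1 ∈ region ∧ 0 < P.2},
      crossSlope z P.1 ≠ 0 := fun P hP => hP.1
  have hG : IsTest {y | crossSlope z y ≠ 0} fun y =>
      ∫ τ : ℝ, (χ (cross z y) : ℂ) * rayIntegrand κ z ε φ (y, τ) :=
    (hW.integral (μ := volume)).mono (by
      rintro _ ⟨P, hP, rfl⟩
      exact hP.1)
  have hmain := isDeltaIntegral_cross (F := fourPoint κ z ε c φ) hG hr fun y hy => by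
    simp only [h1 _ hy, Complex.ofReal_one, one_mul]
    by_cases h : ∀ t, φ (t, y) = 0
    · exact fourPoint_of_forall_eq_zero κ z ε c h
    · push Not at h
      obtain ⟨t, ht⟩ := h
      exact fourPoint_eq_integral κ hz hε' c hφ (hφ.mem ht).2 (hpos t y hy ht)
  have hint := integral_crossPull_zero hW hS
  have hM := isTest_crossPull_zero hW hS
  simp only at hint hM
  rw [hint] at hmain
  convert hmain using 1
  -- Both integrals are ordered as `τ, z̄₂, z̄₄` outside, leaving `ω₄` innermost on the shell and
  -- `z̄₃` innermost on the zero set.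
  let e₁ : Fin 4 ≃ Fin 4 := ⟨![0, 3, 1, 2], ![0, 2, 3, 1], by decide, by decide⟩
  let e₂ : Fin 4 ≃ Fin 4 := ⟨![1, 3, 2, 0], ![3, 0, 2, 1], by decide, by decide⟩
  have a₁ : ∀ a b c d : ℝ, (fun j => (![a, b, c, d] : Fin 4 → ℝ) (e₁ j)) = ![a, d, b, c] := by
    intro a b c d
    funext j
    fin_cases j <;> rfl
  have hSh := isTest_shellIntegrand κ hz hε' hφ
  rw [hSh.integral_fin_four' e₁, hM.integral_fin_four' e₂]
  simp_rw [a₁]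
  symm
  change ∫ τ : ℝ, ∫ x : ℝ, ∫ s : ℝ, ∫ y : ℝ, ((|(crossSlope z ![0, x, y, s])⁻¹| : ℝ) : ℂ) *
    ((χ (cross z (crossSolve z 0 ![x, y, s])) : ℂ) *
      rayIntegrand κ z ε φ (crossSolve z 0 ![x, y, s], τ)) = _
  congr 1
  funext τ
  congr 1
  funext x
  congr 1
  funext s
  by_cases hd : 0 < τ ∧ x - s ≠ 0
  swap
  · have e1 : ∀ ω, shellIntegrand κ z ε φ ![τ, ω, x, s] = 0 := by
      intro ω
      by_contra h
      have hτ : 0 < τ := hSh.mem h 2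
      refine hd ⟨hτ, ?_⟩
      have h2 := region_ne (hφ.mem (right_ne_zero_of_mul h)).2
      exact h2.2.2.1
    have e2 : ∀ y, ((χ (cross z (crossSolve z 0 ![x, y, s])) : ℝ) : ℂ) *
        rayIntegrand κ z ε φ (crossSolve z 0 ![x, y, s], τ) = 0 := by
      intro y
      by_contra h
      have h2 := hW.mem (x := (crossSolve z 0 ![x, y, s], τ)) h
      exact hd ⟨h2.2.2, (region_ne h2.2.1).2.2.1⟩
    simp [e1, e2]
  obtain ⟨hτ, hxs⟩ := hd
  have hb : shellSlope z ε τ x s ≠ 0 :=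
    div_ne_zero (mul_ne_zero (slope₃_ne_zero hz hε') hxs) hτ.ne'
  -- At fixed `τ, x, s` the shell has `z̄₃ = x + shellSlope * ω₄`, with nonzero slope.
  rw [integral_affine _ x _ hb, ← integral_smul]
  congr 1
  funext ω
  rw [← jacobian_rayIntegrand κ hz hε hφ ω hτ.ne' hxs]
  by_cases hD : crossSlope z ![0, x, x + shellSlope z ε τ x s * ω, s] = 0
  · simp [hD]
  · have : cross z (crossSolve z 0 ![x, x + shellSlope z ε τ x s * ω, s]) = 0 :=
      cross_crossSolve hD
    rw [this, h1 0 (by simpa using hr), Complex.real_smul]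
    push_cast
    ring

/-! ### The exchange of the particles 1 and 2 -/

/-- The exchange of the particles 1 and 2 in energies and coordinates. -/
def swapPair (p : (Fin 4 → ℝ) × (Fin 4 → ℝ)) : (Fin 4 → ℝ) × (Fin 4 → ℝ) :=
  (swap₁₂ p.1, swap₁₂ p.2)

theorem swap₁₂_eq {X : Type} (x : Fin 4 → X) : swap₁₂ x = ![x 1, x 0, x 2, x 3] := by
  funext j
  fin_cases j <;> rfl

theorem swap₁₂_swap₁₂ {X : Type} (x : Fin 4 → X) : swap₁₂ (swap₁₂ x) = x := by
  funext j
  fin_cases j <;> rfl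

theorem swap₁₂_mem_region {y : Fin 4 → ℝ} (hy : y ∈ region) : swap₁₂ y ∈ region := by
  obtain ⟨h1, h2, h3⟩ := hy
  rw [swap₁₂_eq]
  refine ⟨?_, ?_, ?_⟩
  · simp only [Matrix.cons_val]
    rw [← neg_sub]
    exact neg_ne_zero.2 h1
  · simp only [Matrix.cons_val]
    rw [← inv_div]
    exact inv_pos.2 h2
  · simp only [Matrix.cons_val]
    have n : y 1 - y 3 ≠ 0 := fun h => by simp [h] at h2
    have := div_pos h3 h2
    rwa [div_div_div_cancel_right₀ n] at this

theorem contDiff_swapPair : ContDiff ℝ (⊤ : ℕ∞) swapPair := by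
  refine ContDiff.prodMk ?_ ?_ <;>
  · rw [contDiff_pi]
    intro j
    simp only [swap₁₂, comp_apply]
    fun_prop

theorem IsTest.comp_swapPair {φ : (Fin 4 → ℝ) × (Fin 4 → ℝ) → ℂ} (hφ : IsTest goodSet φ) :
    IsTest goodSet fun p => φ (swapPair p) := by
  refine hφ.comp (m := swapPair) swapPair contDiff_swapPair.continuous.continuousOn ?_ ?_
    fun _ _ => contDiff_swapPair.contDiffAt
  · intro p _
    exact Prod.ext (swap₁₂_swap₁₂ _) (swap₁₂_swap₁₂ _)
  · rintro p ⟨h1, h2⟩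
    exact ⟨fun j => h1 _, swap₁₂_mem_region h2⟩

theorem totalMomentum_swap (z ε : Fin 4 → ℝ) (p : (Fin 4 → ℝ) × (Fin 4 → ℝ)) (k : Fin 2 × Fin 2) :
    totalMomentum (swap₁₂ z) (swap₁₂ ε) p k = totalMomentum z ε (swapPair p) k := by
  simp only [totalMomentum]
  rw [← Equiv.sum_comp (Equiv.swap (0 : Fin 4) 1)]
  refine Finset.sum_congr rfl fun i _ => ?_
  simp [lam, lamTilde, swapPair, swap₁₂]

theorem momentumIntegrand_swap (κ : ℝ) (z ε : Fin 4 → ℝ) (φ : (Fin 4 → ℝ) × (Fin 4 → ℝ) → ℂ)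
    (p : (Fin 4 → ℝ) × (Fin 4 → ℝ)) :
    momentumIntegrand κ (swap₁₂ z) (swap₁₂ ε) (fun p => φ (swapPair p)) p =
      momentumIntegrand κ z ε φ (swapPair p) := by
  have hl : ∀ i, lam (swap₁₂ z) (swap₁₂ ε) p.1 i =
      lam z ε (swapPair p).1 (Equiv.swap 0 1 i) := by
    intro i
    simp [lam, swapPair, swap₁₂]
  have ht : ∀ i, lamTilde p.2 p.1 i = lamTilde (swapPair p).2 (swapPair p).1 (Equiv.swap 0 1 i) := by
    intro i
    simp [lamTilde, swapPair, swap₁₂]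
  have hp : ∏ j, (swapPair p).1 j = ∏ j, p.1 j := Equiv.prod_comp (Equiv.swap (0 : Fin 4) 1) p.1
  have hA : treeAmplitude (swap₁₂ z) (swap₁₂ ε) p = treeAmplitude z ε (swapPair p) := by
    have hb : ∀ a b : Fin 2 → ℝ, bracket a b = -bracket b a := fun a b => by
      simp only [bracket]; ring
    simp only [treeAmplitude, hl, ht]
    have s0 : Equiv.swap (0 : Fin 4) 1 0 = 1 := rfl
    have s1 : Equiv.swap (0 : Fin 4) 1 1 = 0 := rfl
    have s2 : Equiv.swap (0 : Fin 4) 1 2 = 2 := rfl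
    have s3 : Equiv.swap (0 : Fin 4) 1 3 = 3 := rfl
    -- The numerator `⟨12⟩⁷ [12]` contains eight antisymmetric brackets, so it is even; the
    -- denominator is permuted.
    rw [s0, s1, s2, s3, hb (lam z ε (swapPair p).1 1) (lam z ε (swapPair p).1 0),
      hb (lamTilde (swapPair p).2 (swapPair p).1 1)]
    congr 1 <;> ring
  rw [momentumIntegrand, momentumIntegrand, hA, hp]

theorem setIntegral_swapPair (A : Set ((Fin 4 → ℝ) × (Fin 4 → ℝ)))
    (G : (Fin 4 → ℝ) × (Fin 4 → ℝ) → ℂ) :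
    ∫ p in swapPair ⁻¹' A, G (swapPair p) = ∫ p in A, G p := by
  have h := volume_measurePreserving_piCongrLeft (fun _ : Fin 4 => ℝ) (Equiv.swap 0 1)
  have h2 := h.prod h
  have he : (Prod.map (MeasurableEquiv.piCongrLeft (fun _ : Fin 4 => ℝ) (Equiv.swap 0 1))
      (MeasurableEquiv.piCongrLeft (fun _ : Fin 4 => ℝ) (Equiv.swap 0 1))) = swapPair := by
    funext p
    refine Prod.ext ?_ ?_ <;>
    · funext j
      fin_cases j <;> rfl
  have h3 : MeasurableEmbedding swapPair := by
    rw [← he]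
    exact ((MeasurableEquiv.piCongrLeft (fun _ : Fin 4 => ℝ) (Equiv.swap 0 1)).prodCongr
      (MeasurableEquiv.piCongrLeft (fun _ : Fin 4 => ℝ) (Equiv.swap 0 1))).measurableEmbedding
  rw [he] at h2
  exact h2.setIntegral_preimage_emb h3 G A

/-- The integral over the momentum shell does not change under the relabelling. -/
theorem integral_shellIntegrand_swap (κ : ℝ) {z ε : Fin 4 → ℝ} (hz : Injective z)
    (hε : ∀ j, ε j = 1 ∨ ε j = -1) {φ : (Fin 4 → ℝ) × (Fin 4 → ℝ) → ℂ} (hφ : IsTest goodSet φ) :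
    ∫ q, shellIntegrand κ (swap₁₂ z) (swap₁₂ ε) (fun p => φ (swapPair p)) q =
      ∫ q, shellIntegrand κ z ε φ q := by
  have h1 := isDeltaIntegral_momentum κ hz hε hφ
  have h2 := isDeltaIntegral_momentum κ (z := swap₁₂ z) (ε := swap₁₂ ε)
    (hz.comp (Equiv.injective _)) (fun j => hε _) hφ.comp_swapPair
  -- The box integrals of the relabelled and of the original amplitude agree for every `η`, hence so
  -- do their limits, the two shell integrals.
  refine tendsto_nhds_unique h2 (Tendsto.congr (fun η => ?_) h1)
  congr 1
  rw [← setIntegral_swapPair]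
  simp only [totalMomentum_swap, momentumIntegrand_swap]
  rfl

end Celestial

end

/-! ### The theorem -/

theorem mainTheorem5 (κ : ℝ) (z ε : Fin 4 → ℝ) (hz : Function.Injective z)
    (hε : ∀ j, ε j = 1 ∨ ε j = -1)
    (d : Fin 2 → ℝ) (c₄ : ℝ) (c : Fin 3 → ℝ) :
    (∀ φ : (Fin 4 → ℝ) × (Fin 4 → ℝ) → ℂ,
      ContDiff ℝ (⊤ : ℕ∞) φ → HasCompactSupport φ →
      tsupport φ ⊆ {t | ∀ j, 0 < t j} ×ˢ Celestial.region →
        -- the recursion, applied to the three-point amplitude, gives the four-point formula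
        Celestial.IsDeltaIntegral (fun zb (_ : Unit) => Celestial.cross z zb)
          (Celestial.fourPoint κ z ε c φ)
          (Celestial.recursion κ z ε ![-2, -2, 2] c₄
            (Celestial.threePoint (z ∘ Fin.castSucc) (ε ∘ Fin.castSucc) d) φ) ∧
        -- the formula is symmetric under the exchange of the particles 1 and 2
        Celestial.IsDeltaIntegral
          (fun zb (_ : Unit) => Celestial.cross (Celestial.swap₁₂ z) zb)
          (Celestial.fourPoint κ (Celestial.swap₁₂ z) (Celestial.swap₁₂ ε) c
            (fun p => φ (Celestial.swap₁₂ p.1, Celestial.swap₁₂ p.2)))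
          (Celestial.recursion κ z ε ![-2, -2, 2] c₄
            (Celestial.threePoint (z ∘ Fin.castSucc) (ε ∘ Fin.castSucc) d) φ) ∧
        -- it agrees with the Mellin transform of the momentum-space amplitude
        Celestial.IsDeltaIntegral (Celestial.totalMomentum z ε)
          (Celestial.momentumIntegrand κ z ε φ)
          (Celestial.recursion κ z ε ![-2, -2, 2] c₄
            (Celestial.threePoint (z ∘ Fin.castSucc) (ε ∘ Fin.castSucc) d) φ)) ∧
    -- the support is where the three bases of the powers are positive
    (∀ zb ∈ Celestial.region, Celestial.cross z zb = 0 →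
      (Celestial.InSupport z ε zb ↔
        0 < Celestial.ratio₁ z ε zb ∧ 0 < Celestial.ratio₂ z ε zb ∧
          0 < Celestial.ratio₄ z ε zb)) := by
  refine ⟨fun φ h1 h2 h3 => ?_, fun zb hzb hc => ?_⟩
  · have hφ : Celestial.IsTest Celestial.goodSet φ := Celestial.IsTest.of_tsupport h1 h2 h3
    rw [Celestial.recursion_eq_integral κ hz hε hφ]
    refine ⟨Celestial.isDeltaIntegral_fourPoint κ hz hε c hφ, ?_,
      Celestial.isDeltaIntegral_momentum κ hz hε hφ⟩
    -- The relabelled formula has the shell integral of the relabelled data as its limit; invariance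
    -- of that integral gives the exchange symmetry.
    rw [← Celestial.integral_shellIntegrand_swap κ hz hε hφ]
    exact Celestial.isDeltaIntegral_fourPoint κ (z := Celestial.swap₁₂ z)
      (ε := Celestial.swap₁₂ ε) (hz.comp (Equiv.injective _)) (fun j => hε _) c hφ.comp_swapPair
  · exact Celestial.inSupport_iff hz (Celestial.eps_ne_zero hε) hzb
      (Celestial.crossProd_pos hz hzb hc)
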